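/- Let $\gamma>1$, $M_\gamma=\{(\zeta_1,\zeta_2)\in\mathbb C^2:\operatorname{Im}\zeta_2=|\zeta_1|^\gamma\}$ and $\Omega_\gamma=\{(z_1,z_2)\in\mathbb C^2:\operatorname{Im}z_2>|z_1|^\gamma\}$. For $r\in\mathbb R$ let $\mu_r=\frac1{2i}|\zeta_1|^{r-1}\,d\zeta_2\wedge d\bar\zeta_1\wedge d\zeta_1$ on $M_\gamma$, which is the positive measure $\alpha^r\,ds\,d\alpha\,d\theta$ in the coordinates $\zeta=(\alpha e^{i\theta},s+i\alpha^\gamma)$, and let $\sigma=\mu_{\gamma-1}$. The Leray transform of $f$ on $M_\gamma$ is $$\mathbf Lf(z)=\frac{\gamma^2}{8\pi^2 i}\int_{M_\gamma} f(\zeta)\,\frac{|\zeta_1|^{\gamma-2}\,d\zeta_2\wedge d\bar\zeta_1\wedge d\zeta_1}{\left[\gamma\bar\zeta_1|\zeta_1|^{\gamma-2}(\zeta_1-z_1)+i(\zeta_2-z_2)\right]^2},\qquad z\in\Omega_\gamma,$$ and as an operator on $L^2(M_\gamma,\mu_r)$ it sends $f$ to the boundary value of this function, i.e. to the limit in $L^2(M_\gamma,\mu_r)$,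 as $\varepsilon\to0^+$, of $z\mapsto\mathbf Lf(z_1,z_2+i\varepsilon)$, $z\in M_\gamma$. **Theorem.** Let $r\in\mathcal I_0=(-1,2\gamma-1)$. Then for every $f\in L^2(M_\gamma,\mu_r)$ the integral $\mathbf Lf(z)$ converges absolutely at every $z\in\Omega_\gamma$, and $\mathbf L$ is a well-defined bounded operator on $L^2(M_\gamma,\mu_r)$ (in particular, for $r=\gamma-1$, on $L^2(M_\gamma,\sigma)$). Its adjoint in $L^2(M_\gamma,\mu_r)$ is given by the integral $$\mathbf L^{(*,\mu_r)}g(z)=\frac{\gamma^2|z_1|^{\gamma-1-r}}{8\pi^2 i}\int_{M_\gamma} g(\zeta)\,\frac{|\zeta_1|^{r-1}\,d\zeta_2\wedge d\bar\zeta_1\wedge d\zeta_1}{\left[\gamma z_1|z_1|^{\gamma-2}(\bar z_1-\bar\zeta_1)-i(\bar z_2-\bar\zeta_2)\right]^2}$$ in the following sense. For each $g\in L^2(M_\gamma,\mu_r)$ and each $\varepsilon>0$, the integral with $\zeta_2$ replaced by $\zeta_2+i\varepsilon$ in the denominator converges absolutely for all $z\in M_\gamma$; as $\varepsilon\to0^+$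 the right-hand side so modified converges to $\mathbf L^{(*,\mu_r)}g$ in $L^2(M_\gamma,\mu_r)$; and the displayed formula itself holds at $\mu_r$-almost every $z$ at which its integral converges absolutely. Moreover, put $r'=2(\gamma-1)-r$. Multiplication by $|\zeta_1|^{\gamma-1-r}$ is an isometric isomorphism $\mathbf R_r$ of $L^2(M_\gamma,\mu_{r'})$ onto $L^2(M_\gamma,\mu_r)$; the adjoint $\mathbf L^{(*,\sigma)}$ of $\mathbf L$ in $L^2(M_\gamma,\sigma)$, restricted to $L^2(M_\gamma,\sigma)\cap L^2(M_\gamma,\mu_{r'})$, extends to a bounded operator on $L^2(M_\gamma,\mu_{r'})$, given (in the same sense, now in $L^2(M_\gamma,\mu_{r'})$) by the above integral with $\gamma-1$ in place of $r$ in the exponents of $|z_1|$ and $|\zeta_1|$; and, with this extension still denoted $\mathbf L^{(*,\sigma)}$, $$\mathbf L^{(*,\mu_r)}=\mathbf R_r\,\mathbf L^{(*,\sigma)}\,\mathbf R_r^{-1}.$$ -/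

import Mathlib

open MeasureTheory Set Filter Topology
open scoped ComplexConjugate

namespace LerayModel

noncomputable section

/-- The real hypersurface `M_γ = {(ζ₁, ζ₂) ∈ ℂ² : Im ζ₂ = |ζ₁|^γ}`. -/
def M (γ : ℝ) : Set (ℂ × ℂ) := {ζ | ζ.2.im = ‖ζ.1‖ ^ γ}

/-- The domain `Ω_γ = {(z₁, z₂) ∈ ℂ² : Im z₂ > |z₁|^γ}` on the `ℂ`-convex side of `M_γ`. -/
def Ω (γ : ℝ) : Set (ℂ × ℂ) := {z | ‖z.1‖ ^ γ < z.2.im}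

/-- The graph parametrization `(ζ₁, s) ↦ (ζ₁, s + i |ζ₁|^γ)` of `M_γ`, where `s = Re ζ₂`. -/
def graphMap (γ : ℝ) (p : ℂ × ℝ) : M γ :=
  ⟨(p.1, (p.2 : ℂ) + ((‖p.1‖ ^ γ : ℝ) : ℂ) * Complex.I), by simp [M]⟩

theorem measurable_graphMap (γ : ℝ) : Measurable (graphMap γ) := by
  unfold graphMap
  fun_prop

/-- The positive measure `(1 / 2i) dζ₂ ∧ dζ̄₁ ∧ dζ₁` on `M_γ`. Since `dζ̄₁ ∧ dζ₁ = 2i dx ∧ dy` with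
`ζ₁ = x + iy`, it is `ds dx dy`, the image of Lebesgue measure under the graph parametrization. -/
def surf (γ : ℝ) : Measure (M γ) := (volume : Measure (ℂ × ℝ)).map (graphMap γ)

/-- The measure `μ_r = (1 / 2i) |ζ₁|^(r-1) dζ₂ ∧ dζ̄₁ ∧ dζ₁`, that is, `α^r ds dα dθ` in the
coordinates `ζ = (α e^{iθ}, s + i α^γ)` (recall `dx dy = α dα dθ`). -/
def μ (γ r : ℝ) : Measure (M γ) :=
  (surf γ).withDensity fun ζ => ENNReal.ofReal (‖ζ.1.1‖ ^ (r - 1))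

/-- The measure `σ = α^(γ-1) ds dα dθ`. -/
abbrev σ (γ : ℝ) : Measure (M γ) := μ γ (γ - 1)

/-- The Hilbert space `L²(M_γ, μ_r)`. -/
abbrev L2 (γ r : ℝ) : Type := Lp ℂ 2 (μ γ r)

/-- The vertical translate `(z₁, z₂ + iε)`. For `ε > 0` it moves a point of `M_γ` into `Ω_γ`. -/
def lift (ε : ℝ) (z : ℂ × ℂ) : ℂ × ℂ := (z.1, z.2 + (ε : ℂ) * Complex.I)

/-- The integrand of the Leray transform of `M_γ` with respect to `(1 / 2i) dζ₂ ∧ dζ̄₁ ∧ dζ₁`: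
`f(ζ) |ζ₁|^(γ-2) / [γ ζ̄₁ |ζ₁|^(γ-2) (ζ₁ - z₁) + i (ζ₂ - z₂)]²`. -/
def lerayIntegrand (γ : ℝ) (f : M γ → ℂ) (z : ℂ × ℂ) (ζ : M γ) : ℂ :=
  f ζ * ((‖ζ.1.1‖ ^ (γ - 2) : ℝ) : ℂ) /
    ((γ : ℂ) * conj ζ.1.1 * ((‖ζ.1.1‖ ^ (γ - 2) : ℝ) : ℂ) * (ζ.1.1 - z.1)
      + Complex.I * (ζ.1.2 - z.2)) ^ 2

/-- The Leray integral of `f` at a point `z` of `Ω_γ`. The constant is `γ² / (8π² i) · 2i`,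
because `dζ₂ ∧ dζ̄₁ ∧ dζ₁` is `2i` times the measure `surf γ`. -/
def lerayIntegral (γ : ℝ) (f : M γ → ℂ) (z : ℂ × ℂ) : ℂ :=
  (γ : ℂ) ^ 2 / (4 * (Real.pi : ℂ) ^ 2) * ∫ ζ, lerayIntegrand γ f z ζ ∂(surf γ)

/-- `L` is the Leray transform as a bounded operator on `L²(M_γ, μ_r)`: for each `f` the Leray
integral converges absolutely on all of `Ω_γ`, and `L f` is its boundary value on `M_γ`, namely the
limit in `L²(M_γ, μ_r)` of its vertical translates. (On `M_γ` itself the kernel is singular.) -/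
def IsLerayTransform (γ r : ℝ) (L : L2 γ r →L[ℂ] L2 γ r) : Prop :=
  ∀ f : L2 γ r,
    (∀ z ∈ Ω γ, Integrable (lerayIntegrand γ f z) (surf γ)) ∧
    Tendsto (fun ε : ℝ => eLpNorm (fun z : M γ => lerayIntegral γ f (lift ε z.1) - L f z) 2 (μ γ r))
      (𝓝[>] 0) (𝓝 0)

/-- The integrand
`g(ζ) |ζ₁|^(q-1) / [γ z₁ |z₁|^(γ-2) (z̄₁ - w̄₁) - i (z̄₂ - w̄₂)]²` with `w = (ζ₁, ζ₂ + iε)`.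
The literal integrand is the case `ε = 0`; the denominator is the square of the complex conjugate
of the one in the Leray kernel, with the roles of the two points interchanged. -/
def adjointIntegrand (γ q : ℝ) (g : M γ → ℂ) (ε : ℝ) (z ζ : M γ) : ℂ :=
  g ζ * ((‖ζ.1.1‖ ^ (q - 1) : ℝ) : ℂ) /
    ((γ : ℂ) * z.1.1 * ((‖z.1.1‖ ^ (γ - 2) : ℝ) : ℂ) * (conj z.1.1 - conj (lift ε ζ.1).1)
      - Complex.I * (conj z.1.2 - conj (lift ε ζ.1).2)) ^ 2

/-- The conjugate-kernel integral, weighted by `|z₁|^(γ-1-q)` and `|ζ₁|^(q-1)`. The constant is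
`γ² / (8π² i) · 2i`, as in `lerayIntegral`. -/
def adjointIntegral (γ q : ℝ) (g : M γ → ℂ) (ε : ℝ) (z : M γ) : ℂ :=
  (γ : ℂ) ^ 2 * ((‖z.1.1‖ ^ (γ - 1 - q) : ℝ) : ℂ) / (4 * (Real.pi : ℂ) ^ 2) *
    ∫ ζ, adjointIntegrand γ q g ε z ζ ∂(surf γ)

/-- The operator `T` on `L²(M_γ, μ_p)` is computed by the conjugate-kernel integral of weight `q`:
for `ε > 0` the integral converges absolutely at every point; it tends to `T g` in `L²(M_γ, μ_p)`
as `ε → 0⁺`; and `T g` is given by the literal integral (`ε = 0`) at almost every point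
at which that converges absolutely. -/
def IsAdjointIntegral (γ q p : ℝ) (T : L2 γ p →L[ℂ] L2 γ p) : Prop :=
  ∀ g : L2 γ p,
    (∀ ε > 0, ∀ z : M γ, Integrable (adjointIntegrand γ q g ε z) (surf γ)) ∧
    Tendsto (fun ε : ℝ => eLpNorm (fun z : M γ => adjointIntegral γ q g ε z - T g z) 2 (μ γ p))
      (𝓝[>] 0) (𝓝 0) ∧
    ∀ᵐ z ∂(μ γ p), Integrable (adjointIntegrand γ q g 0 z) (surf γ) →
      T g z = adjointIntegral γ q g 0 z

end

end LerayModel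

namespace LerayModel

/-! In the graph coordinates $(z,t)$, $(w,s)$ of $M_\gamma$, the Leray denominator at height
$\varepsilon$ is the square of $A(z,w)+\varepsilon+i(s-t)$, where $A$ is `lerayPhase`. Its real part
is nonnegative: it is the Bregman divergence of $x^\gamma$ at $(|w|,|z|)$ plus an angular term. With
respect to $\mu_r$ the kernel carries the weight $|w|^{\gamma-1-r}$, and it is invariant under
translation in $t$.

Writing $a^{-2}=\int_0^\infty\eta e^{-a\eta}\,d\eta$ shows that the Fourier transform in $t$ splits
the operator into a family indexed by $\eta>0$, acting on $L^2(|w|^{r-1}dw)$ with kernels bounded by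
a multiple of $\eta|w|^{\gamma-1-r}e^{-\eta\operatorname{Re}A}$; $\varepsilon$ enters only through a
factor $e^{-2\pi\varepsilon\eta}$. Schur's test with a power weight bounds the family uniformly in
$\eta$ (`exists_schur_bounds`); a suitable power exists because $-1<r<2\gamma-1$. Plancherel then
bounds the operators uniformly in $\varepsilon$ (`lintegral_resolvent_comb_le`). Dominated
convergence on the frequency side gives limits for data of bounded support in $s$, and density gives
them for all data (`exists_limit`).

The adjoint has the conjugate transposed kernel, in which the weight has moved to the output
variable. At fixed $\varepsilon>0$ this is Fubini on truncated data; the identity survives the limit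
(`eq_adjoint_of_tendsto`). Where the integral at $\varepsilon=0$ converges absolutely, it dominates
those with $\varepsilon>0$, so it equals the boundary value almost everywhere
(`tendsto_adjointIntegral`).

Finally, the adjoint integrals for $\mu_r$ and $\sigma$ differ only by powers of $|z_1|$ and
$|\zeta_1|$, so multiplication by $|\zeta_1|^{\gamma-1-r}$ intertwines them at every $\varepsilon$
(`rpow_mul_adjointIntegral`). The conjugated operator on $L^2(\mu_{r'})$ agrees with the
$\sigma$-adjoint on the intersection because both are limits of the same functions. -/

open scoped FourierTransform SchwartzMap ENNReal NNReal ContDiff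

/-! ### Plancherel for integrable functions -/

/-- The `L²` Fourier transform of an integrable square-integrable function is its Fourier integral. -/
theorem fourier_toLp_ae_eq {h : ℝ → ℂ} (h1 : Integrable h) (h2 : MemLp h 2) :
    ((𝓕 (h2.toLp h) : Lp (α := ℝ) ℂ 2) : ℝ → ℂ) =ᵐ[volume] 𝓕 h := by
  have hcont : Continuous (𝓕 h) :=
    VectorFourier.fourierIntegral_continuous Real.continuous_fourierChar
      (L := innerₗ ℝ) (μ := volume) continuous_inner h1
  have hloc : LocallyIntegrable ((𝓕 (h2.toLp h) : Lp (α := ℝ) ℂ 2 volume) : ℝ → ℂ) volume :=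
    (Lp.memLp _).locallyIntegrable (by norm_num)
  -- Both sides are locally integrable, so it suffices to test against smooth compactly supported
  -- functions. There the distributional definition and the multiplication formula $\int\hat\varphi
  -- h=\int\varphi\hat h$ give the same value.
  refine ae_eq_of_integral_contDiff_smul_eq hloc hcont.locallyIntegrable fun g hg hgc => ?_
  have hG1 : HasCompactSupport (Complex.ofRealCLM ∘ g) := hgc.comp_left rfl
  have hG2 : ContDiff ℝ ∞ (Complex.ofRealCLM ∘ g) := by fun_prop
  set φ : 𝓢(ℝ, ℂ) := hG1.toSchwartzMap hG2 with hφ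
  have hφv : ∀ x, φ x = (g x : ℂ) := fun x => rfl
  have e1 := congrArg (fun T => T φ) (Lp.fourier_toTemperedDistribution_eq (h2.toLp h))
  simp only [TemperedDistribution.fourier_apply, Lp.toTemperedDistribution_apply] at e1
  have e2 : ∫ x, (𝓕 φ) x • (h2.toLp h) x = ∫ x, (𝓕 (φ : ℝ → ℂ)) x • h x := by
    refine integral_congr_ae ?_
    filter_upwards [h2.coeFn_toLp] with x hx
    rw [hx, SchwartzMap.fourier_coe]
  have e3 := VectorFourier.integral_fourierIntegral_smul_eq_flip (L := innerₗ ℝ)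
    (μ := volume) (ν := volume) Real.continuous_fourierChar continuous_inner φ.integrable h1
  simp only [flip_innerₗ] at e3
  have e4 : ∫ x, (𝓕 (φ : ℝ → ℂ)) x • h x = ∫ x, φ x • (𝓕 h) x := e3
  rw [e2, e4] at e1
  simpa only [hφv, Complex.real_smul, smul_eq_mul] using e1.symm

/-- Plancherel inequality for the Fourier integral of an integrable function. -/
theorem lintegral_fourier_sq_le {h : ℝ → ℂ} (h1 : Integrable h) :
    ∫⁻ x, ‖𝓕 h x‖ₑ ^ 2 ≤ ∫⁻ x, ‖h x‖ₑ ^ 2 := by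
  by_cases h2 : MemLp h 2
  · have e : eLpNorm (𝓕 h) 2 volume = eLpNorm h 2 volume := by
      rw [← eLpNorm_congr_ae (fourier_toLp_ae_eq h1 h2), ← eLpNorm_congr_ae h2.coeFn_toLp,
        ← Lp.enorm_def, ← Lp.enorm_def, ← ofReal_norm, ← ofReal_norm, Lp.norm_fourier_eq]
    have key : ∀ u : ℝ → ℂ, ∫⁻ x, ‖u x‖ₑ ^ 2 = eLpNorm u 2 volume ^ 2 := fun u => by
      have := eLpNorm_nnreal_pow_eq_lintegral (f := u) (μ := volume) (p := 2) (by norm_num)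
      simpa using this.symm
    rw [key, key, e]
  -- Outside $L^2$ the right-hand side is infinite, so the inequality needs no square integrability.
  · have : ∫⁻ x, ‖h x‖ₑ ^ 2 = (⊤ : ℝ≥0∞) := by
      by_contra hne
      refine h2 ⟨h1.1, ?_⟩
      rw [eLpNorm_lt_top_iff_lintegral_rpow_enorm_lt_top (by norm_num) (by norm_num)]
      simpa using lt_top_iff_ne_top.2 hne
    rw [this]; exact le_top

theorem lintegral_fourierInv_sq_le {h : ℝ → ℂ} (h1 : Integrable h) :
    ∫⁻ x, ‖𝓕⁻ h x‖ₑ ^ 2 ≤ ∫⁻ x, ‖h x‖ₑ ^ 2 := by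
  have : ∀ x, 𝓕⁻ h x = 𝓕 h (-x) := fun x => Real.fourierInv_eq_fourier_neg h x
  simp_rw [this]
  rw [lintegral_neg_eq_self (μ := volume) (fun x => ‖𝓕 h x‖ₑ ^ 2)]
  exact lintegral_fourier_sq_le h1

/-! ### Laplace integrals and $L^2$ preliminaries -/

theorem integrableOn_mul_exp_neg_Ioi {a : ℝ} (ha : 0 < a) :
    IntegrableOn (fun η : ℝ => η * Real.exp (-(a * η))) (Ioi 0) := by
  have := integrableOn_rpow_mul_exp_neg_mul_rpow (p := 1) (s := 1) (b := a)
    (by norm_num) (by norm_num) ha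
  simpa using this

theorem integral_mul_exp_neg_Ioi {a : ℂ} (ha : 0 < a.re) :
    ∫ η in Ioi (0 : ℝ), (η : ℂ) * Complex.exp (-(a * η)) = 1 / a ^ 2 := by
  have ha0 : a ≠ 0 := fun h => by simp [h] at ha
  have hnorm : ∀ η : ℝ, ‖Complex.exp (-(a * η))‖ = Real.exp (-(a.re * η)) := fun η => by
    rw [Complex.norm_exp]; simp
  -- An explicit antiderivative: it vanishes at infinity and equals $-1/a^2$ at $0$.
  have hderiv : ∀ x ∈ Ioi (0 : ℝ), HasDerivAt
      (fun η : ℝ => -((η : ℂ) / a + 1 / a ^ 2) * Complex.exp (-(a * η)))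
      ((x : ℂ) * Complex.exp (-(a * x))) x := fun x _ => by
    have hx : HasDerivAt (fun η : ℝ => (η : ℂ)) 1 x := Complex.ofRealCLM.hasDerivAt
    convert! (((hx.div_const a).add_const (1 / a ^ 2)).neg).mul ((hx.const_mul a).neg.cexp) using 1
    simp only [Pi.neg_apply]
    field_simp
    ring
  have hint : IntegrableOn (fun η : ℝ => (η : ℂ) * Complex.exp (-(a * η))) (Ioi 0) := by
    refine (integrableOn_mul_exp_neg_Ioi ha).mono' (by fun_prop) ?_
    filter_upwards [ae_restrict_mem measurableSet_Ioi] with η hη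
    rw [norm_mul, hnorm, Complex.norm_real, Real.norm_of_nonneg (le_of_lt hη)]
  have hlim : Tendsto (fun η : ℝ => -((η : ℂ) / a + 1 / a ^ 2) * Complex.exp (-(a * η)))
      atTop (𝓝 0) := by
    have h0 : Tendsto (fun η : ℝ => Real.exp (-(a.re * η))) atTop (𝓝 0) :=
      Real.tendsto_exp_neg_atTop_nhds_zero.comp (tendsto_id.const_mul_atTop ha)
    have h1 : Tendsto (fun η : ℝ => η * Real.exp (-(a.re * η))) atTop (𝓝 0) := by
      have := (Real.tendsto_pow_mul_exp_neg_atTop_nhds_zero 1).comp (tendsto_id.const_mul_atTop ha)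
      have := this.const_mul (a.re)⁻¹
      simp only [mul_zero] at this
      refine this.congr fun η => ?_
      simp only [Function.comp, id, pow_one]
      field_simp
    rw [tendsto_zero_iff_norm_tendsto_zero]
    have h2 := (h1.const_mul ‖a‖⁻¹).add (h0.const_mul (‖a‖ ^ 2)⁻¹)
    simp only [mul_zero, add_zero] at h2
    refine squeeze_zero' (Eventually.of_forall fun _ => norm_nonneg _) ?_ h2
    filter_upwards [eventually_ge_atTop 0] with η hη
    rw [norm_mul, norm_neg, hnorm]
    calc _ ≤ (‖(η : ℂ) / a‖ + ‖1 / a ^ 2‖) * Real.exp (-(a.re * η)) := by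
          gcongr; exact norm_add_le _ _
      _ = _ := by
          rw [norm_div, Complex.norm_real, Real.norm_of_nonneg hη, norm_div, norm_pow, norm_one]
          ring
  rw [integral_Ioi_of_hasDerivAt_of_tendsto ?_ hderiv hint hlim]
  · simp
  · exact Continuous.continuousWithinAt (by fun_prop)

theorem integral_mul_exp_neg_Ioi_real {a : ℝ} (ha : 0 < a) :
    ∫ η in Ioi (0 : ℝ), η * Real.exp (-(a * η)) = 1 / a ^ 2 := by
  have := Real.integral_rpow_mul_exp_neg_mul_Ioi (a := 2) (r := a) (by norm_num) ha
  norm_num at this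
  simpa using this

theorem eLpNorm_two_sq {α : Type*} [MeasurableSpace α] (ν : Measure α) (f : α → ℂ) :
    eLpNorm f 2 ν ^ 2 = ∫⁻ x, ‖f x‖ₑ ^ 2 ∂ν := by
  have := eLpNorm_nnreal_pow_eq_lintegral (f := f) (μ := ν) (p := 2) (by norm_num)
  simpa using this

theorem memLp_two_iff {α : Type*} [MeasurableSpace α] {ν : Measure α} {f : α → ℂ}
    (hf : AEStronglyMeasurable f ν) : MemLp f 2 ν ↔ ∫⁻ x, ‖f x‖ₑ ^ 2 ∂ν < ⊤ := by
  rw [← eLpNorm_two_sq, ENNReal.pow_lt_top_iff]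
  simp [MemLp, hf]

/-- Cauchy–Schwarz for lower integrals. -/
theorem lintegral_mul_sq_le {α : Type*} [MeasurableSpace α] {ν : Measure α} {f g : α → ℝ≥0∞}
    (hf : AEMeasurable f ν) (hg : AEMeasurable g ν) :
    (∫⁻ x, f x * g x ∂ν) ^ 2 ≤ (∫⁻ x, f x ^ 2 ∂ν) * ∫⁻ x, g x ^ 2 ∂ν := by
  have h := ENNReal.lintegral_mul_le_Lp_mul_Lq ν (p := 2) (q := 2) Real.HolderConjugate.two_two hf hg
  simp only [Pi.mul_apply, ENNReal.rpow_two] at h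
  calc _ ≤ _ := pow_le_pow_left' h 2
    _ = _ := by
      rw [mul_pow, ← ENNReal.rpow_mul_natCast, ← ENNReal.rpow_mul_natCast]
      norm_num

theorem lintegral_inv_sq_add_sq_lt_top {ε : ℝ} (hε : 0 < ε) (c : ℝ) :
    ∫⁻ s : ℝ, ENNReal.ofReal (ε ^ 2 + (s + c) ^ 2)⁻¹ < ⊤ := by
  rw [lintegral_add_right_eq_self (μ := volume) (fun s : ℝ => ENNReal.ofReal (ε ^ 2 + s ^ 2)⁻¹) c]
  have h : Integrable (fun s : ℝ => (ε ^ 2 + s ^ 2)⁻¹) := by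
    have := (integrable_inv_one_add_sq.comp_div hε.ne').const_mul (ε ^ 2)⁻¹
    refine this.congr (Eventually.of_forall fun s => ?_)
    have : 0 < ε ^ 2 + s ^ 2 := by positivity
    simp only
    field_simp
  exact h.lintegral_lt_top

/-! ### Kernels on $X\times\mathbb R$ invariant under translation in the real variable -/

section Denominator

variable {a : ℂ} {ε : ℝ} (u : ℝ)

theorem re_denom (a : ℂ) (ε u : ℝ) : (a + ε + Complex.I * u).re = a.re + ε := by simp

theorem re_add_le_norm_denom (a : ℂ) (ε : ℝ) :
    a.re + ε ≤ ‖a + ε + Complex.I * u‖ := by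
  rw [← re_denom a ε u]; exact Complex.re_le_norm _

theorem sq_add_sq_le_norm_denom (ha : 0 ≤ a.re) (hε : 0 < ε) :
    ε ^ 2 + (u + a.im) ^ 2 ≤ ‖a + ε + Complex.I * u‖ ^ 2 := by
  rw [← Complex.normSq_eq_norm_sq, Complex.normSq_apply]
  simp only [Complex.add_re, Complex.ofReal_re, Complex.mul_re, Complex.I_re, zero_mul,
    Complex.I_im, Complex.ofReal_im, mul_zero, sub_zero, add_zero, Complex.add_im, Complex.mul_im,
    one_mul, zero_add]
  nlinarith

end Denominator

section ResolventIntegral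

variable {X : Type*} [MeasurableSpace X] {ρ : Measure X}

/-- The kernel `k(x,y) / (A(x,y) + ε + i(s - t))²` on `X × ℝ`. -/
noncomputable def resolventKernel (k : X → X → ℝ) (A : X → X → ℂ) (ε : ℝ) (p q : X × ℝ) : ℂ :=
  (k p.1 q.1 : ℂ) / (A p.1 q.1 + ε + Complex.I * (q.2 - p.2)) ^ 2

/-- The integral operator with kernel `resolventKernel`. -/
noncomputable def resolventIntegral (ρ : Measure X) (k : X → X → ℝ) (A : X → X → ℂ) (ε : ℝ)
    (f : X × ℝ → ℂ) (p : X × ℝ) : ℂ :=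
  ∫ q, f q * resolventKernel k A ε p q ∂(ρ.prod volume)

/-- Hypotheses under which the integral operators with kernel `resolventKernel k A ε` are uniformly
bounded on `L²`. -/
structure SchurKernel (ρ : Measure X) (k : X → X → ℝ) (A : X → X → ℂ) (C : ℝ≥0) : Prop where
  measurable_k : Measurable (Function.uncurry k)
  measurable_A : Measurable (Function.uncurry A)
  nonneg : ∀ x y, 0 ≤ k x y
  re_nonneg : ∀ x y, 0 ≤ (A x y).re
  sq_lt_top : ∀ x, ∀ ε > 0, ∫⁻ y, ENNReal.ofReal ((k x y / ((A x y).re + ε)) ^ 2) ∂ρ < ⊤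
  schur : ∀ η > 0, ∀ u : X → ℝ≥0∞, Measurable u →
    ∫⁻ x, (∫⁻ y, ENNReal.ofReal (η * k x y * Real.exp (-(η * (A x y).re))) * u y ∂ρ) ^ 2 ∂ρ ≤
      C * ∫⁻ y, u y ^ 2 ∂ρ

namespace SchurKernel

variable {k : X → X → ℝ} {A : X → X → ℂ} {C : ℝ≥0} (h : SchurKernel ρ k A C)
include h

theorem measurable_k_right (x : X) : Measurable (k x) := h.measurable_k.comp measurable_prodMk_left
theorem measurable_A_right (x : X) : Measurable (A x) := h.measurable_A.comp measurable_prodMk_left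

theorem measurable_kernel (ε : ℝ) :
    Measurable (Function.uncurry (resolventKernel k A ε)) := by
  have h1 := h.measurable_k
  have h2 := h.measurable_A
  have h3 : Measurable (fun z : (X × ℝ) × (X × ℝ) => k z.1.1 z.2.1) :=
    h1.comp (f := fun z : (X × ℝ) × (X × ℝ) => (z.1.1, z.2.1)) (by fun_prop)
  have h4 : Measurable (fun z : (X × ℝ) × (X × ℝ) => A z.1.1 z.2.1) :=
    h2.comp (f := fun z : (X × ℝ) × (X × ℝ) => (z.1.1, z.2.1)) (by fun_prop)
  unfold resolventKernel Function.uncurry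
  fun_prop

end SchurKernel

/-- The squared kernel has $|a+\varepsilon+iu|^4$ in the denominator. Bounding two of these factors
below by $\operatorname{Re}a+\varepsilon$ and the other two by
$\varepsilon^2+(u+\operatorname{Im}a)^2$ separates the variables, since the shift
$\operatorname{Im}a$ does not affect the integral in $s$. -/
theorem memLp_resolvent {κ : X → ℝ} {a : X → ℂ} (hκ : Measurable κ) (ha : Measurable a)
    (hre : ∀ y, 0 ≤ (a y).re) {ε : ℝ} (hε : 0 < ε)
    (hint : ∫⁻ y, ENNReal.ofReal ((κ y / ((a y).re + ε)) ^ 2) ∂ρ < ⊤) (t : ℝ) :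
    MemLp (fun q : X × ℝ => (κ q.1 : ℂ) / (a q.1 + ε + Complex.I * (q.2 - t)) ^ 2) 2
      (ρ.prod volume) := by
  rw [memLp_two_iff (by fun_prop : Measurable _).aestronglyMeasurable]
  have hbound : ∀ q : X × ℝ, ‖(κ q.1 : ℂ) / (a q.1 + ε + Complex.I * (q.2 - t)) ^ 2‖ₑ ^ 2 ≤
      ENNReal.ofReal ((κ q.1 / ((a q.1).re + ε)) ^ 2) *
        ENNReal.ofReal (ε ^ 2 + (q.2 + ((a q.1).im - t)) ^ 2)⁻¹ := fun q => by
    have h1 := re_add_le_norm_denom (q.2 - t) (a q.1) ε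
    have h2 := sq_add_sq_le_norm_denom (q.2 - t) (hre q.1) hε
    push_cast at h1 h2
    have h3 := hre q.1
    have h4 : 0 < ε ^ 2 + (q.2 - t + (a q.1).im) ^ 2 := by positivity
    rw [← ofReal_norm, ← ENNReal.ofReal_pow (norm_nonneg _),
      ← ENNReal.ofReal_mul (by positivity)]
    refine ENNReal.ofReal_le_ofReal ?_
    rw [norm_div, norm_pow, Complex.norm_real, div_pow, Real.norm_eq_abs, sq_abs, div_pow,
      show (q.2 + ((a q.1).im - t)) = q.2 - t + (a q.1).im by ring]
    set N := ‖a q.1 + ε + Complex.I * (q.2 - t)‖ with hN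
    have hpos : 0 < (a q.1).re + ε := by positivity
    rw [← div_eq_mul_inv, div_div]
    refine div_le_div_of_nonneg_left (sq_nonneg _) (by positivity) ?_
    calc _ ≤ N ^ 2 * N ^ 2 := by gcongr
      _ = _ := by ring
  refine (lintegral_mono hbound).trans_lt ?_
  rw [lintegral_prod _ (by fun_prop)]
  have : ∀ y, ∫⁻ s : ℝ, ENNReal.ofReal ((κ y / ((a y).re + ε)) ^ 2) *
        ENNReal.ofReal (ε ^ 2 + (s + ((a y).im - t)) ^ 2)⁻¹ =
      ENNReal.ofReal ((κ y / ((a y).re + ε)) ^ 2) *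
        ∫⁻ s : ℝ, ENNReal.ofReal (ε ^ 2 + s ^ 2)⁻¹ := fun y => by
    rw [lintegral_const_mul _ (by fun_prop),
      lintegral_add_right_eq_self (μ := volume) (fun s : ℝ => ENNReal.ofReal (ε ^ 2 + s ^ 2)⁻¹)]
  simp only [this]
  rw [lintegral_mul_const _ (by fun_prop)]
  exact ENNReal.mul_lt_top hint (by simpa using lintegral_inv_sq_add_sq_lt_top hε 0)

theorem integrable_mul_resolvent {κ : X → ℝ} {a : X → ℂ} (hκ : Measurable κ) (ha : Measurable a)
    (hre : ∀ y, 0 ≤ (a y).re) {ε : ℝ} (hε : 0 < ε)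
    (hint : ∫⁻ y, ENNReal.ofReal ((κ y / ((a y).re + ε)) ^ 2) ∂ρ < ⊤) (t : ℝ)
    {f : X × ℝ → ℂ} (hf : MemLp f 2 (ρ.prod volume)) :
    Integrable (fun q : X × ℝ => f q * ((κ q.1 : ℂ) / (a q.1 + ε + Complex.I * (q.2 - t)) ^ 2))
      (ρ.prod volume) :=
  hf.integrable_mul (memLp_resolvent hκ ha hre hε hint t)

namespace SchurKernel

variable {k : X → X → ℝ} {A : X → X → ℂ} {C : ℝ≥0} (h : SchurKernel ρ k A C)
include h

theorem memLp_kernel {ε : ℝ} (hε : 0 < ε) (p : X × ℝ) :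
    MemLp (resolventKernel k A ε p) 2 (ρ.prod volume) :=
  memLp_resolvent (h.measurable_k_right p.1) (h.measurable_A_right p.1) (h.re_nonneg p.1) hε
    (h.sq_lt_top p.1 ε hε) p.2

theorem integrable_mul_kernel {ε : ℝ} (hε : 0 < ε) (p : X × ℝ) {f : X × ℝ → ℂ}
    (hf : MemLp f 2 (ρ.prod volume)) :
    Integrable (fun q => f q * resolventKernel k A ε p q) (ρ.prod volume) :=
  hf.integrable_mul (h.memLp_kernel hε p)

variable [SFinite ρ]

theorem stronglyMeasurable_integral (ε : ℝ) {f : X × ℝ → ℂ} (hf : StronglyMeasurable f) :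
    StronglyMeasurable (resolventIntegral ρ k A ε f) := by
  unfold resolventIntegral
  refine StronglyMeasurable.integral_prod_right (f := fun p q => f q * resolventKernel k A ε p q) ?_
  exact (hf.comp_measurable measurable_snd).mul (h.measurable_kernel ε).stronglyMeasurable

end SchurKernel

/-! ### The operators on the frequency side -/

/-- The partial Fourier transform in the real variable of the integral operator with kernel
`resolventKernel k A 0`. -/
noncomputable def spectralIntegral (ρ : Measure X) (k : X → X → ℝ) (A : X → X → ℂ)
    (f : X × ℝ → ℂ) (x : X) (η : ℝ) : ℂ :=
  ∫ q, f q * ((k x q.1 : ℂ) * (4 * (Real.pi : ℂ) ^ 2 *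
    (η * Complex.exp (-(2 * Real.pi * (A x q.1 + Complex.I * q.2) * η))))) ∂(ρ.prod volume)

/-- The exponential factors: $t$ enters only through a character and $\varepsilon$ only through a
damping factor. Both are constants in $q$, so no integrability is needed. -/
theorem integral_laplace_eq (ρ : Measure X) (k : X → X → ℝ) (A : X → X → ℂ) (f : X × ℝ → ℂ) {ε : ℝ} (x : X) (t η : ℝ) :
    ∫ q, f q * ((k x q.1 : ℂ) * (4 * (Real.pi : ℂ) ^ 2 *
      (η * Complex.exp (-(2 * Real.pi * (A x q.1 + ε + Complex.I * (q.2 - t)) * η)))))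
        ∂(ρ.prod volume) =
    Complex.exp (2 * Real.pi * (η * t) * Complex.I) *
      ((Real.exp (-(2 * Real.pi * ε * η)) : ℝ) * spectralIntegral ρ k A f x η) := by
  unfold spectralIntegral
  rw [← integral_const_mul, ← integral_const_mul]
  refine integral_congr_ae (Eventually.of_forall fun q => ?_)
  simp only
  have : Complex.exp (-(2 * Real.pi * (A x q.1 + ε + Complex.I * (q.2 - t)) * η)) =
      Complex.exp (2 * Real.pi * (η * t) * Complex.I) * (Complex.exp (-(2 * Real.pi * ε * η)) *
      Complex.exp (-(2 * Real.pi * (A x q.1 + Complex.I * q.2) * η))) := by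
    rw [← Complex.exp_add, ← Complex.exp_add]
    congr 1
    ring
  rw [this]
  push_cast
  ring

namespace SchurKernel

variable {k : X → X → ℝ} {A : X → X → ℂ} {C : ℝ≥0} (h : SchurKernel ρ k A C)
include h

/-- Absolute values destroy the oscillation in $s$: integrating out $\eta$ leaves
$|f|\,k/(\operatorname{Re}A+\varepsilon)^2$, which has no decay in $s$. This is why $f$ must have
bounded support in $s$. On that strip the second factor is in $L^2$, being at most
$\varepsilon^{-1}k/(\operatorname{Re}A+\varepsilon)$. -/
theorem integrable_laplace {f : X × ℝ → ℂ} (hf : StronglyMeasurable f)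
    (hf2 : MemLp f 2 (ρ.prod volume)) {n : ℝ} (hn : ∀ q, n < |q.2| → f q = 0) {ε : ℝ} (hε : 0 < ε)
    (x : X) (t : ℝ) :
    Integrable (fun z : (X × ℝ) × ℝ => f z.1 * ((k x z.1.1 : ℂ) * (4 * (Real.pi : ℂ) ^ 2 *
      (z.2 * Complex.exp
        (-(2 * Real.pi * (A x z.1.1 + ε + Complex.I * (z.1.2 - t)) * z.2))))))
      ((ρ.prod volume).prod (volume.restrict (Ioi 0))) := by
  have hk := h.measurable_k_right x
  have hA := h.measurable_A_right x
  have hfm := hf.measurable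
  have hpos : ∀ y, 0 < 2 * Real.pi * ((A x y).re + ε) := fun y => by
    have := h.re_nonneg x y
    positivity
  have hre : ∀ (q : X × ℝ) (η : ℝ), ‖Complex.exp
        (-(2 * Real.pi * (A x q.1 + ε + Complex.I * (q.2 - t)) * η))‖ =
        Real.exp (-(2 * Real.pi * ((A x q.1).re + ε) * η)) := fun q η => by
    rw [Complex.norm_exp]
    congr 1
    simp
  rw [integrable_prod_iff (by fun_prop : Measurable _).aestronglyMeasurable]
  constructor
  · refine Eventually.of_forall fun q => ?_
    suffices h0 : Integrable (fun η : ℝ => (η : ℂ) * Complex.exp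
        (-(2 * Real.pi * (A x q.1 + ε + Complex.I * (q.2 - t)) * η))) (volume.restrict (Ioi 0)) from
      ((h0.const_mul (4 * (Real.pi : ℂ) ^ 2)).const_mul (k x q.1 : ℂ)).const_mul (f q)
    refine (integrableOn_mul_exp_neg_Ioi (hpos q.1)).mono'
      (by fun_prop : Measurable _).aestronglyMeasurable ?_
    filter_upwards [ae_restrict_mem measurableSet_Ioi] with η hη
    rw [norm_mul, hre, Complex.norm_real, Real.norm_of_nonneg (le_of_lt hη)]
  · have e : ∀ q : X × ℝ, ∫ η in Ioi (0 : ℝ), ‖f q * ((k x q.1 : ℂ) * (4 * (Real.pi : ℂ) ^ 2 *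
        (η * Complex.exp (-(2 * Real.pi * (A x q.1 + ε + Complex.I * (q.2 - t)) * η)))))‖ =
        ‖f q‖ * (k x q.1 / ((A x q.1).re + ε) ^ 2) := fun q => by
      have e1 : ∀ η ∈ Ioi (0 : ℝ), ‖f q * ((k x q.1 : ℂ) * (4 * (Real.pi : ℂ) ^ 2 *
        (η * Complex.exp (-(2 * Real.pi * (A x q.1 + ε + Complex.I * (q.2 - t)) * η)))))‖ =
        (‖f q‖ * (k x q.1 * (4 * Real.pi ^ 2))) *
          (η * Real.exp (-(2 * Real.pi * ((A x q.1).re + ε) * η))) := fun η hη => by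
        simp only [norm_mul, hre, norm_pow, Complex.norm_real]
        rw [Real.norm_of_nonneg (le_of_lt hη), Real.norm_of_nonneg Real.pi_pos.le,
          Real.norm_of_nonneg (h.nonneg _ _)]
        norm_num
        ring
      rw [setIntegral_congr_fun measurableSet_Ioi e1, integral_const_mul,
        integral_mul_exp_neg_Ioi_real (hpos q.1)]
      have := hpos q.1
      field_simp
      norm_num
    simp only [e]
    have hg : MemLp (fun q : X × ℝ => (Icc (-n) n).indicator
        (fun _ => k x q.1 / ((A x q.1).re + ε) ^ 2) q.2) 2 (ρ.prod volume) := by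
      have hmeas : Measurable (fun q : X × ℝ => (Icc (-n) n).indicator
          (fun _ => k x q.1 / ((A x q.1).re + ε) ^ 2) q.2) := by
        have : (fun q : X × ℝ => (Icc (-n) n).indicator
          (fun _ => k x q.1 / ((A x q.1).re + ε) ^ 2) q.2) =
          (Prod.snd ⁻¹' Icc (-n) n).indicator (fun q => k x q.1 / ((A x q.1).re + ε) ^ 2) := by
          ext q; rfl
        rw [this]
        exact Measurable.indicator (by fun_prop) (measurable_snd measurableSet_Icc)
      refine ⟨hmeas.aestronglyMeasurable, ?_⟩
      rw [eLpNorm_lt_top_iff_lintegral_rpow_enorm_lt_top (by norm_num) (by norm_num)]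
      have hb : ∀ q : X × ℝ, ‖(Icc (-n) n).indicator
          (fun _ => k x q.1 / ((A x q.1).re + ε) ^ 2) q.2‖ₑ ^ (2 : ℝ≥0∞).toReal ≤
          ENNReal.ofReal (ε⁻¹ ^ 2) * ENNReal.ofReal ((k x q.1 / ((A x q.1).re + ε)) ^ 2) *
            (Icc (-n) n).indicator (fun _ => 1) q.2 := fun q => by
        by_cases hq : q.2 ∈ Icc (-n) n
        · simp only [indicator_of_mem hq, mul_one, ENNReal.toReal_ofNat, ENNReal.rpow_ofNat]
          rw [← ENNReal.ofReal_mul (by positivity), ← ofReal_norm,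
            ← ENNReal.ofReal_pow (norm_nonneg _)]
          refine ENNReal.ofReal_le_ofReal ?_
          rw [Real.norm_eq_abs, sq_abs]
          have h0 := h.re_nonneg x q.1
          have h1 : (k x q.1 / ((A x q.1).re + ε) ^ 2) ^ 2 =
            (((A x q.1).re + ε)⁻¹) ^ 2 * (k x q.1 / ((A x q.1).re + ε)) ^ 2 := by
            field_simp
          rw [h1]
          gcongr
          linarith
        · simp [indicator_of_notMem hq]
      refine (lintegral_mono hb).trans_lt ?_
      rw [lintegral_prod_mul (f := fun y => ENNReal.ofReal (ε⁻¹ ^ 2) *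
          ENNReal.ofReal ((k x y / ((A x y).re + ε)) ^ 2)) (by fun_prop)
          (measurable_const.indicator measurableSet_Icc).aemeasurable,
        lintegral_const_mul _ (by fun_prop), lintegral_indicator measurableSet_Icc]
      refine ENNReal.mul_lt_top (ENNReal.mul_lt_top ENNReal.ofReal_lt_top (h.sq_lt_top x ε hε)) ?_
      simp
    refine (hf2.norm.integrable_mul hg).congr (Eventually.of_forall fun q => ?_)
    by_cases hq : q.2 ∈ Icc (-n) n
    · simp [indicator_of_mem hq]
    · have : n < |q.2| := by
        by_contra hcon
        exact hq (abs_le.1 (not_lt.1 hcon))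
      simp [hn q this]

variable [SFinite ρ]

theorem stronglyMeasurable_spectralIntegral {f : X × ℝ → ℂ} (hf : StronglyMeasurable f) :
    StronglyMeasurable (Function.uncurry (spectralIntegral ρ k A f)) := by
  unfold spectralIntegral Function.uncurry
  have h3 : Measurable (fun z : (X × ℝ) × (X × ℝ) => k z.1.1 z.2.1) :=
    h.measurable_k.comp (f := fun z : (X × ℝ) × (X × ℝ) => (z.1.1, z.2.1)) (by fun_prop)
  have h4 : Measurable (fun z : (X × ℝ) × (X × ℝ) => A z.1.1 z.2.1) :=
    h.measurable_A.comp (f := fun z : (X × ℝ) × (X × ℝ) => (z.1.1, z.2.1)) (by fun_prop)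
  refine StronglyMeasurable.integral_prod_right (f := fun (p : X × ℝ) (q : X × ℝ) =>
    f q * ((k p.1 q.1 : ℂ) * (4 * (Real.pi : ℂ) ^ 2 *
    (p.2 * Complex.exp (-(2 * Real.pi * (A p.1 q.1 + Complex.I * q.2) * p.2)))))) ?_
  refine Measurable.stronglyMeasurable ?_
  exact (hf.measurable.comp measurable_snd).mul ((Complex.measurable_ofReal.comp h3).mul
    (measurable_const.mul ((by fun_prop : Measurable fun z : (X × ℝ) × (X × ℝ) =>
      ((z.1.2 : ℝ) : ℂ)).mul (Complex.measurable_exp.comp (((h4.add (by fun_prop)).const_mul _).mul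
        (by fun_prop)).neg))))

theorem integrableOn_spectralIntegral {f : X × ℝ → ℂ} (hf : StronglyMeasurable f)
    (hf2 : MemLp f 2 (ρ.prod volume)) {n : ℝ} (hn : ∀ q, n < |q.2| → f q = 0) {ε : ℝ} (hε : 0 < ε)
    (x : X) :
    IntegrableOn (fun η : ℝ => (Real.exp (-(2 * Real.pi * ε * η)) : ℝ) *
      spectralIntegral ρ k A f x η) (Ioi 0) := by
  have := (h.integrable_laplace hf hf2 hn hε x 0).integral_prod_right
  refine this.congr (Eventually.of_forall fun η => ?_)
  simp only
  rw [integral_laplace_eq ρ k A f x 0 η]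
  simp

/-- The Laplace formula at $2\pi(A+\varepsilon+i(s-t))$, followed by Fubini, exhibits the operator
in the variable $t$ as a Fourier inversion integral over positive frequencies. -/
theorem resolventIntegral_eq_fourierInv {f : X × ℝ → ℂ} (hf : StronglyMeasurable f)
    (hf2 : MemLp f 2 (ρ.prod volume)) {n : ℝ} (hn : ∀ q, n < |q.2| → f q = 0) {ε : ℝ} (hε : 0 < ε)
    (x : X) (t : ℝ) :
    resolventIntegral ρ k A ε f (x, t) =
      𝓕⁻ ((Ioi 0).indicator fun η : ℝ => (Real.exp (-(2 * Real.pi * ε * η)) : ℝ) *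
        spectralIntegral ρ k A f x η) t := by
  have hI := h.integrable_laplace hf hf2 hn hε x t
  have e1 : resolventIntegral ρ k A ε f (x, t) = ∫ q, (∫ η in Ioi (0 : ℝ),
      f q * ((k x q.1 : ℂ) * (4 * (Real.pi : ℂ) ^ 2 *
      (η * Complex.exp (-(2 * Real.pi * (A x q.1 + ε + Complex.I * (q.2 - t)) * η))))))
        ∂(ρ.prod volume) := by
    refine integral_congr_ae (Eventually.of_forall fun q => ?_)
    simp only [resolventKernel]
    have hre : 0 < (2 * Real.pi * (A x q.1 + ε + Complex.I * (q.2 - t))).re := by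
      have := h.re_nonneg x q.1
      simp
      positivity
    rw [integral_const_mul, integral_const_mul, integral_const_mul, integral_mul_exp_neg_Ioi hre,
      mul_pow, mul_pow]
    have hpi : (Real.pi : ℂ) ≠ 0 := by exact_mod_cast Real.pi_ne_zero
    rw [show (4 : ℂ) * Real.pi ^ 2 * (1 / (2 ^ 2 * Real.pi ^ 2 *
      (A x q.1 + ε + Complex.I * (q.2 - t)) ^ 2)) =
      (A x q.1 + ε + Complex.I * (q.2 - t))⁻¹ ^ 2 by field_simp; norm_num]
    rw [div_eq_mul_inv, inv_pow]
  rw [e1, integral_integral_swap hI, Real.fourierInv_eq', ← integral_indicator measurableSet_Ioi]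
  refine integral_congr_ae (Eventually.of_forall fun η => ?_)
  by_cases hη : η ∈ Ioi (0 : ℝ)
  · simp only [indicator_of_mem hη]
    rw [integral_laplace_eq ρ k A f x t η]
    simp
    left
    congr 1
    ring
  · simp [indicator_of_notMem hη]

/-- Integrating in $s$ first produces the partial Fourier transform of $f$. The constant
$4\pi^2\eta$ is split as $2\pi\cdot2\pi\eta$, so that what remains is the kernel of
`SchurKernel.schur` at frequency $2\pi\eta$. -/
theorem enorm_spectralIntegral_le (f : X × ℝ → ℂ) (x : X) {η : ℝ} (hη : 0 < η) :
    ‖spectralIntegral ρ k A f x η‖ₑ ≤ ENNReal.ofReal (2 * Real.pi) *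
      ∫⁻ y, ENNReal.ofReal (2 * Real.pi * η * k x y * Real.exp (-(2 * Real.pi * η * (A x y).re))) *
        ‖𝓕 (fun s => f (y, s)) η‖ₑ ∂ρ := by
  by_cases hI : Integrable (fun q : X × ℝ => f q * ((k x q.1 : ℂ) * (4 * (Real.pi : ℂ) ^ 2 *
    (η * Complex.exp (-(2 * Real.pi * (A x q.1 + Complex.I * q.2) * η)))))) (ρ.prod volume)
  · unfold spectralIntegral
    rw [integral_prod _ hI, ← lintegral_const_mul' _ _ ENNReal.ofReal_ne_top]
    refine (enorm_integral_le_lintegral_enorm _).trans (lintegral_mono fun y => ?_)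
    have e : ∫ s, f (y, s) * ((k x y : ℂ) * (4 * (Real.pi : ℂ) ^ 2 *
        (η * Complex.exp (-(2 * Real.pi * (A x y + Complex.I * s) * η))))) =
        ((k x y : ℂ) * (4 * (Real.pi : ℂ) ^ 2 *
        (η * Complex.exp (-(2 * Real.pi * η * A x y))))) * 𝓕 (fun s => f (y, s)) η := by
      rw [Real.fourier_eq', ← integral_const_mul]
      refine integral_congr_ae (Eventually.of_forall fun s => ?_)
      have : Complex.exp (-(2 * Real.pi * (A x y + Complex.I * s) * η)) =
        Complex.exp (-(2 * Real.pi * η * A x y)) *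
          Complex.exp (((-2 * Real.pi * inner ℝ s η : ℝ) : ℂ) * Complex.I) := by
        rw [← Complex.exp_add]
        congr 1
        simp
        ring
      simp only [this, smul_eq_mul]
      ring
    simp only
    rw [e, enorm_mul, ← mul_assoc (ENNReal.ofReal _), ← ENNReal.ofReal_mul (by positivity)]
    gcongr
    rw [← ofReal_norm]
    refine ENNReal.ofReal_le_ofReal (le_of_eq ?_)
    simp only [norm_mul, norm_pow, Complex.norm_real, Complex.norm_exp]
    rw [Real.norm_of_nonneg hη.le, Real.norm_of_nonneg Real.pi_pos.le,
      Real.norm_of_nonneg (h.nonneg _ _)]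
    have : (-(2 * Real.pi * η * A x y) : ℂ).re = -(2 * Real.pi * η * (A x y).re) := by simp
    rw [this]
    norm_num
    ring
  -- A divergent integral has the default value $0$, and the bound is then trivial.
  · rw [spectralIntegral, integral_undef hI]
    simp

end SchurKernel

/-! ### Uniform $L^2$ bounds and the limit $\varepsilon\to0^+$ -/

theorem tendsto_lintegral_sub_indicator {α : Type*} [MeasurableSpace α] {ν : Measure α}
    {f : α → ℂ} (hf : StronglyMeasurable f) (hf2 : MemLp f 2 ν) {S : ℕ → Set α}
    (hS : ∀ n, MeasurableSet (S n)) (hcov : ∀ x, ∀ᶠ n in atTop, x ∈ S n) :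
    Tendsto (fun n => ∫⁻ x, ‖f x - (S n).indicator f x‖ₑ ^ 2 ∂ν) atTop (𝓝 0) := by
  have hfin := (memLp_two_iff hf2.1).1 hf2
  have hm := hf.measurable
  have := tendsto_lintegral_of_dominated_convergence (μ := ν)
    (F := fun n x => ‖f x - (S n).indicator f x‖ₑ ^ 2) (f := fun _ => 0)
    (fun x => ‖f x‖ₑ ^ 2)
    (fun n => ((hm.sub (hm.indicator (hS n))).enorm.pow_const 2))
    (fun n => Eventually.of_forall fun x => ?_) hfin.ne
    (Eventually.of_forall fun x => ?_)
  · simpa using this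
  · by_cases hx : x ∈ S n
    · simp [hx]
    · simp [hx]
  · refine tendsto_const_nhds.congr' ?_
    filter_upwards [hcov x] with n hn
    simp [hn]

theorem fourierInv_linear {u v : ℝ → ℂ} (hu : Integrable u) (hv : Integrable v) (c d : ℂ) (t : ℝ) :
    c * 𝓕⁻ u t + d * 𝓕⁻ v t = 𝓕⁻ (fun η => c * u η + d * v η) t := by
  have hI : ∀ {w : ℝ → ℂ}, Integrable w → Integrable fun η : ℝ =>
      Complex.exp (((2 * Real.pi * inner ℝ η t : ℝ) : ℂ) * Complex.I) * w η := fun {w} hw => by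
    refine hw.bdd_mul (c := 1) (by fun_prop) (Eventually.of_forall fun η => ?_)
    rw [Complex.norm_exp_ofReal_mul_I]
  simp only [Real.fourierInv_eq', smul_eq_mul]
  rw [← integral_const_mul, ← integral_const_mul, ← integral_add ((hI hu).const_mul _)
    ((hI hv).const_mul _)]
  refine integral_congr_ae (Eventually.of_forall fun η => ?_)
  simp only
  ring

theorem stronglyMeasurable_partialFourier {f : X × ℝ → ℂ} (hf : StronglyMeasurable f) :
    StronglyMeasurable (fun z : X × ℝ => 𝓕 (fun s => f (z.1, s)) z.2) := by
  simp only [Real.fourier_eq', smul_eq_mul]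
  refine StronglyMeasurable.integral_prod_right (f := fun (z : X × ℝ) (s : ℝ) =>
    Complex.exp (((-2 * Real.pi * inner ℝ s z.2 : ℝ) : ℂ) * Complex.I) * f (z.1, s)) ?_
  refine Measurable.stronglyMeasurable ?_
  exact (Complex.measurable_exp.comp (by fun_prop)).mul
    (hf.measurable.comp (by fun_prop))

/-- Almost every slice is in $L^2$ and has bounded support, hence is integrable, so Plancherel
applies slice by slice. -/
theorem lintegral_partialFourier_sq_le {f : X × ℝ → ℂ} (hf : StronglyMeasurable f)
    (hf2 : MemLp f 2 (ρ.prod volume)) {n : ℝ} (hn : ∀ q, n < |q.2| → f q = 0) :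
    ∫⁻ y, (∫⁻ η, ‖𝓕 (fun s => f (y, s)) η‖ₑ ^ 2) ∂ρ ≤ ∫⁻ q, ‖f q‖ₑ ^ 2 ∂(ρ.prod volume) := by
  have hfin := (memLp_two_iff hf2.1).1 hf2
  have hm := hf.measurable
  rw [lintegral_prod _ (by fun_prop)] at hfin ⊢
  have hae := ae_lt_top (Measurable.lintegral_prod_right' (hm.enorm.pow_const 2)) hfin.ne
  refine lintegral_mono_ae ?_
  filter_upwards [hae] with y hy
  have hmy : Measurable fun s => f (y, s) := hm.comp measurable_prodMk_left
  refine lintegral_fourier_sq_le ?_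
  have h2 : MemLp (fun s => f (y, s)) 2 volume :=
    (memLp_two_iff hmy.aestronglyMeasurable).2 hy
  rw [← integrableOn_iff_integrable_of_support_subset (s := Icc (-n) n)]
  · exact (h2.restrict _).integrable (by norm_num)
  · intro s hs
    by_contra hcon
    exact hs (hn (y, s) (by
      by_contra hcon2
      exact hcon (abs_le.1 (not_lt.1 hcon2))))

variable [SFinite ρ]

namespace SchurKernel

variable {k : X → X → ℝ} {A : X → X → ℂ} {C : ℝ≥0} (h : SchurKernel ρ k A C)
include h

/-- Plancherel in $t$, Tonelli, and Schur's bound at each frequency. Treating a combination of two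
values of $\varepsilon$ covers both uses: $(c,d)=(1,0)$ gives the uniform bound, $(1,-1)$ the Cauchy
property. -/
theorem lintegral_resolvent_comb_le {f : X × ℝ → ℂ} (hf : StronglyMeasurable f)
    (hf2 : MemLp f 2 (ρ.prod volume)) {n : ℝ} (hn : ∀ q, n < |q.2| → f q = 0) {ε δ : ℝ}
    (hε : 0 < ε) (hδ : 0 < δ) (c d : ℂ) :
    ∫⁻ p, ‖c * resolventIntegral ρ k A ε f p + d * resolventIntegral ρ k A δ f p‖ₑ ^ 2
      ∂(ρ.prod volume) ≤ ENNReal.ofReal (2 * Real.pi) ^ 2 * C * ∫⁻ y, (∫⁻ η in Ioi (0 : ℝ),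
        ‖c * (Real.exp (-(2 * Real.pi * ε * η)) : ℝ) +
          d * (Real.exp (-(2 * Real.pi * δ * η)) : ℝ)‖ₑ ^ 2 *
        ‖𝓕 (fun s => f (y, s)) η‖ₑ ^ 2) ∂ρ := by
  set m : ℝ → ℂ := fun η => c * (Real.exp (-(2 * Real.pi * ε * η)) : ℝ) +
          d * (Real.exp (-(2 * Real.pi * δ * η)) : ℝ) with hm_def
  have hm : Measurable m := by fun_prop
  have hG := (h.stronglyMeasurable_spectralIntegral hf).measurable
  have hF := (stronglyMeasurable_partialFourier hf).measurable
  have hTε := (h.stronglyMeasurable_integral ε hf).measurable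
  have hTδ := (h.stronglyMeasurable_integral δ hf).measurable
  rw [lintegral_prod _ (by fun_prop)]
  calc _ ≤ ∫⁻ x, (∫⁻ η in Ioi (0 : ℝ), ‖m η‖ₑ ^ 2 * ‖spectralIntegral ρ k A f x η‖ₑ ^ 2) ∂ρ := by
        refine lintegral_mono fun x => ?_
        have hi1 := h.integrableOn_spectralIntegral hf hf2 hn hε x
        have hi2 := h.integrableOn_spectralIntegral hf hf2 hn hδ x
        rw [← integrable_indicator_iff measurableSet_Ioi] at hi1 hi2
        simp only [h.resolventIntegral_eq_fourierInv hf hf2 hn hε,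
          h.resolventIntegral_eq_fourierInv hf hf2 hn hδ, fourierInv_linear hi1 hi2]
        refine (lintegral_fourierInv_sq_le ((hi1.const_mul _).add (hi2.const_mul _))).trans
          (le_of_eq ?_)
        rw [← lintegral_indicator measurableSet_Ioi]
        refine lintegral_congr fun η => ?_
        by_cases hη : η ∈ Ioi (0 : ℝ)
        · simp only [Pi.add_apply, indicator_of_mem hη, hm_def]
          rw [← mul_pow, ← enorm_mul]
          congr 2
          ring
        · simp [indicator_of_notMem hη]
    _ = ∫⁻ η in Ioi (0 : ℝ), ∫⁻ x, ‖m η‖ₑ ^ 2 * ‖spectralIntegral ρ k A f x η‖ₑ ^ 2 ∂ρ := by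
        refine lintegral_lintegral_swap ?_
        exact (((hm.comp measurable_snd).enorm.pow_const 2).mul
          (hG.enorm.pow_const 2)).aemeasurable
    _ ≤ ∫⁻ η in Ioi (0 : ℝ), ENNReal.ofReal (2 * Real.pi) ^ 2 * C *
          ∫⁻ y, ‖m η‖ₑ ^ 2 * ‖𝓕 (fun s => f (y, s)) η‖ₑ ^ 2 ∂ρ := by
        refine setLIntegral_mono' measurableSet_Ioi fun η hη => ?_
        have hFη : Measurable fun y => ‖𝓕 (fun s => f (y, s)) η‖ₑ :=
          (hF.comp measurable_prodMk_right).enorm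
        have hGη : Measurable fun x => spectralIntegral ρ k A f x η :=
          hG.comp measurable_prodMk_right
        have hη' : 0 < 2 * Real.pi * η := mul_pos (by positivity) hη
        rw [lintegral_const_mul _ (by fun_prop), lintegral_const_mul _ (by fun_prop)]
        calc _ ≤ ‖m η‖ₑ ^ 2 * ∫⁻ x, ENNReal.ofReal (2 * Real.pi) ^ 2 * (∫⁻ y, ENNReal.ofReal
                (2 * Real.pi * η * k x y * Real.exp (-(2 * Real.pi * η * (A x y).re))) *
                ‖𝓕 (fun s => f (y, s)) η‖ₑ ∂ρ) ^ 2 ∂ρ := by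
              gcongr with x
              rw [← mul_pow]
              exact pow_le_pow_left' (h.enorm_spectralIntegral_le f x hη) 2
          _ ≤ ‖m η‖ₑ ^ 2 * (ENNReal.ofReal (2 * Real.pi) ^ 2 *
                (C * ∫⁻ y, ‖𝓕 (fun s => f (y, s)) η‖ₑ ^ 2 ∂ρ)) := by
              rw [lintegral_const_mul' _ _ (ENNReal.pow_ne_top ENNReal.ofReal_ne_top)]
              gcongr
              exact h.schur _ hη' _ hFη
          _ = _ := by ring
    _ = _ := by
        rw [lintegral_const_mul' _ _ (ENNReal.mul_ne_top (ENNReal.pow_ne_top ENNReal.ofReal_ne_top) ENNReal.coe_ne_top)]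
        congr 1
        refine lintegral_lintegral_swap ?_
        exact (((hm.comp measurable_fst).enorm.pow_const 2).mul
          ((hF.comp measurable_swap).enorm.pow_const 2)).aemeasurable

theorem lintegral_resolvent_le_of_support {f : X × ℝ → ℂ} (hf : StronglyMeasurable f)
    (hf2 : MemLp f 2 (ρ.prod volume)) {n : ℝ} (hn : ∀ q, n < |q.2| → f q = 0) {ε : ℝ}
    (hε : 0 < ε) :
    ∫⁻ p, ‖resolventIntegral ρ k A ε f p‖ₑ ^ 2 ∂(ρ.prod volume) ≤
      ENNReal.ofReal (2 * Real.pi) ^ 2 * C * ∫⁻ q, ‖f q‖ₑ ^ 2 ∂(ρ.prod volume) := by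
  have := h.lintegral_resolvent_comb_le hf hf2 hn hε hε 1 0
  simp only [one_mul, zero_mul, add_zero] at this
  refine this.trans ?_
  gcongr
  refine le_trans ?_ (lintegral_partialFourier_sq_le hf hf2 hn)
  refine lintegral_mono fun y => (setLIntegral_mono' measurableSet_Ioi fun η hη => ?_).trans
    (setLIntegral_le_lintegral _ _)
  refine mul_le_of_le_one_left' (pow_le_one' ?_ 2)
  rw [← ofReal_norm, Complex.norm_real, Real.norm_of_nonneg (Real.exp_pos _).le]
  have : 0 < 2 * Real.pi * ε * η := mul_pos (by positivity) hη
  simpa using this.le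

/-- On the frequency side the difference is the multiplier
$e^{-2\pi\varepsilon\eta}-e^{-2\pi\delta\eta}$. It is at most $1$ in modulus and tends to $0$
pointwise, so dominated convergence applies with majorant $|\hat f|^2$. -/
theorem tendsto_lintegral_resolvent_sub {f : X × ℝ → ℂ} (hf : StronglyMeasurable f)
    (hf2 : MemLp f 2 (ρ.prod volume)) {n : ℝ} (hn : ∀ q, n < |q.2| → f q = 0) :
    Tendsto (fun e : ℝ × ℝ => ∫⁻ p, ‖resolventIntegral ρ k A e.1 f p -
      resolventIntegral ρ k A e.2 f p‖ₑ ^ 2 ∂(ρ.prod volume)) (𝓝[>] 0 ×ˢ 𝓝[>] 0) (𝓝 0) := by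
  have hF := (stronglyMeasurable_partialFourier hf).measurable
  have hfin := (memLp_two_iff hf2.1).1 hf2
  have hpos : ∀ᶠ e : ℝ × ℝ in 𝓝[>] 0 ×ˢ 𝓝[>] 0, 0 < e.1 ∧ 0 < e.2 :=
    (eventually_mem_nhdsWithin.prod_inl _).and (eventually_mem_nhdsWithin.prod_inr _)
  have hmain : Tendsto (fun e : ℝ × ℝ => ∫⁻ z : X × ℝ, ‖((Real.exp (-(2 * Real.pi * e.1 * z.2)) : ℝ) : ℂ)
      - (Real.exp (-(2 * Real.pi * e.2 * z.2)) : ℝ)‖ₑ ^ 2 * ‖𝓕 (fun s => f (z.1, s)) z.2‖ₑ ^ 2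
      ∂(ρ.prod (volume.restrict (Ioi 0)))) (𝓝[>] 0 ×ˢ 𝓝[>] 0) (𝓝 0) := by
    have hIoi : ∀ᵐ z : X × ℝ ∂(ρ.prod (volume.restrict (Ioi 0))), 0 < z.2 :=
      Measure.quasiMeasurePreserving_snd.ae (ae_restrict_mem measurableSet_Ioi)
    have hlim := tendsto_lintegral_filter_of_dominated_convergence
      (μ := ρ.prod (volume.restrict (Ioi 0))) (l := 𝓝[>] (0 : ℝ) ×ˢ 𝓝[>] (0 : ℝ))
      (F := fun (e : ℝ × ℝ) (z : X × ℝ) => ‖((Real.exp (-(2 * Real.pi * e.1 * z.2)) : ℝ) : ℂ)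
      - (Real.exp (-(2 * Real.pi * e.2 * z.2)) : ℝ)‖ₑ ^ 2 * ‖𝓕 (fun s => f (z.1, s)) z.2‖ₑ ^ 2)
      (f := fun _ => 0) (fun z => ‖𝓕 (fun s => f (z.1, s)) z.2‖ₑ ^ 2)
      (Eventually.of_forall fun e => by fun_prop) ?_ ?_ ?_
    · simpa using hlim
    · filter_upwards [hpos] with e he
      filter_upwards [hIoi] with z hz
      refine mul_le_of_le_one_left' (pow_le_one' ?_ 2)
      rw [← Complex.ofReal_sub, ← ofReal_norm, Complex.norm_real, ← ENNReal.ofReal_one]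
      refine ENNReal.ofReal_le_ofReal ?_
      have h1 : 0 < 2 * Real.pi * e.1 * z.2 := mul_pos (mul_pos (by positivity) he.1) hz
      have h2 : 0 < 2 * Real.pi * e.2 * z.2 := mul_pos (mul_pos (by positivity) he.2) hz
      have h3 : Real.exp (-(2 * Real.pi * e.1 * z.2)) ≤ 1 := by simpa using h1.le
      have h4 : Real.exp (-(2 * Real.pi * e.2 * z.2)) ≤ 1 := by simpa using h2.le
      have h5 := Real.exp_pos (-(2 * Real.pi * e.1 * z.2))
      have h6 := Real.exp_pos (-(2 * Real.pi * e.2 * z.2))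
      rw [Real.norm_eq_abs, abs_le]
      constructor <;> linarith
    · rw [lintegral_prod _ (hF.enorm.pow_const 2).aemeasurable]
      refine ne_of_lt (lt_of_le_of_lt ?_ hfin)
      refine le_trans (lintegral_mono fun y => setLIntegral_le_lintegral _ _)
        (lintegral_partialFourier_sq_le hf hf2 hn)
    · refine Eventually.of_forall fun z => ?_
      by_cases hz : ‖𝓕 (fun s => f (z.1, s)) z.2‖ₑ ^ 2 = 0
      · simp [hz]
      · have hc : Tendsto (fun e : ℝ × ℝ => ‖((Real.exp (-(2 * Real.pi * e.1 * z.2)) : ℝ) : ℂ)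
          - (Real.exp (-(2 * Real.pi * e.2 * z.2)) : ℝ)‖ₑ ^ 2) (𝓝 0) (𝓝 0) := by
          have : Continuous (fun e : ℝ × ℝ => ‖((Real.exp (-(2 * Real.pi * e.1 * z.2)) : ℝ) : ℂ)
            - (Real.exp (-(2 * Real.pi * e.2 * z.2)) : ℝ)‖ₑ ^ 2) := by
            refine (ENNReal.continuous_pow 2).comp (Continuous.enorm ?_)
            fun_prop
          simpa using this.tendsto 0
        have hle : 𝓝[>] (0 : ℝ) ×ˢ 𝓝[>] (0 : ℝ) ≤ 𝓝 (0 : ℝ × ℝ) := by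
          rw [Prod.zero_eq_mk, nhds_prod_eq]
          exact Filter.prod_mono nhdsWithin_le_nhds nhdsWithin_le_nhds
        have := ENNReal.Tendsto.mul_const (b := ‖𝓕 (fun s => f (z.1, s)) z.2‖ₑ ^ 2)
          (hc.mono_left hle) (Or.inr (by finiteness))
        simpa using this
  have hmul := ENNReal.Tendsto.const_mul (a := ENNReal.ofReal (2 * Real.pi) ^ 2 * C) hmain
    (Or.inr (ENNReal.mul_ne_top (ENNReal.pow_ne_top ENNReal.ofReal_ne_top) ENNReal.coe_ne_top))
  rw [mul_zero] at hmul
  refine tendsto_of_tendsto_of_tendsto_of_le_of_le' tendsto_const_nhds hmul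
    (Eventually.of_forall fun _ => zero_le) ?_
  filter_upwards [hpos] with e he
  have := h.lintegral_resolvent_comb_le hf hf2 hn he.1 he.2 1 (-1)
  simp only [one_mul, neg_one_mul, ← sub_eq_add_neg] at this
  rwa [lintegral_prod (fun z : X × ℝ => ‖((Real.exp (-(2 * Real.pi * e.1 * z.2)) : ℝ) : ℂ)
      - (Real.exp (-(2 * Real.pi * e.2 * z.2)) : ℝ)‖ₑ ^ 2 * ‖𝓕 (fun s => f (z.1, s)) z.2‖ₑ ^ 2)
    ((by fun_prop : Measurable _).mul (hF.enorm.pow_const 2)).aemeasurable]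

/-- The support condition is removed by truncating in $s$: the integrals converge pointwise because
each row of the kernel is in $L^2$, and Fatou's lemma carries the uniform bound to the limit. -/
theorem lintegral_resolvent_le {f : X × ℝ → ℂ} (hf : StronglyMeasurable f)
    (hf2 : MemLp f 2 (ρ.prod volume)) {ε : ℝ} (hε : 0 < ε) :
    ∫⁻ p, ‖resolventIntegral ρ k A ε f p‖ₑ ^ 2 ∂(ρ.prod volume) ≤
      ENNReal.ofReal (2 * Real.pi) ^ 2 * C * ∫⁻ q, ‖f q‖ₑ ^ 2 ∂(ρ.prod volume) := by
  set S : ℕ → Set (X × ℝ) := fun n => {q | |q.2| ≤ n} with hS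
  have hSm : ∀ n, MeasurableSet (S n) := fun n =>
    measurableSet_le (by fun_prop) measurable_const
  have hlim : ∀ p, Tendsto (fun n => resolventIntegral ρ k A ε ((S n).indicator f) p) atTop
      (𝓝 (resolventIntegral ρ k A ε f p)) := fun p => by
    have hI := h.integrable_mul_kernel hε p hf2
    refine tendsto_integral_of_dominated_convergence
      (fun q => ‖f q * resolventKernel k A ε p q‖) (fun n => ?_) hI.norm
      (fun n => Eventually.of_forall fun q => ?_) (Eventually.of_forall fun q => ?_)
    · simp only [← indicator_mul_left]
      exact hI.1.indicator (hSm n)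
    · by_cases hq : q ∈ S n <;> simp [hq, mul_nonneg]
    · refine tendsto_const_nhds.congr' ?_
      filter_upwards [eventually_ge_atTop (Nat.ceil |q.2|)] with n hn
      have : q ∈ S n := (Nat.le_ceil |q.2|).trans (by exact_mod_cast hn)
      simp [this]
  calc _ = ∫⁻ p, liminf (fun n => ‖resolventIntegral ρ k A ε ((S n).indicator f) p‖ₑ ^ 2) atTop
        ∂(ρ.prod volume) := by
        refine lintegral_congr fun p => ?_
        exact (((ENNReal.continuous_pow 2).tendsto _).comp (hlim p).enorm).liminf_eq.symm
    _ ≤ liminf (fun n => ∫⁻ p, ‖resolventIntegral ρ k A ε ((S n).indicator f) p‖ₑ ^ 2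
        ∂(ρ.prod volume)) atTop := lintegral_liminf_le fun n =>
          (h.stronglyMeasurable_integral ε (hf.indicator (hSm n))).measurable.enorm.pow_const 2
    _ ≤ liminf (fun _ : ℕ => ENNReal.ofReal (2 * Real.pi) ^ 2 * C *
        ∫⁻ q, ‖f q‖ₑ ^ 2 ∂(ρ.prod volume)) atTop := by
        refine liminf_le_liminf (Eventually.of_forall fun n => ?_)
        refine (h.lintegral_resolvent_le_of_support (hf.indicator (hSm n)) (hf2.indicator (hSm n))
          (n := n) (fun q hq => indicator_of_notMem (by simpa [hS] using hq) f) hε).trans ?_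
        gcongr with q
        exact enorm_indicator_le_enorm_self f q
    _ = _ := by simp

end SchurKernel

theorem tendsto_toLp_indicator {α : Type*} [MeasurableSpace α] {ν : Measure α}
    (f : Lp ℂ 2 ν) {S : ℕ → Set α}
    (hS : ∀ n, MeasurableSet (S n)) (hcov : ∀ x, ∀ᶠ n in atTop, x ∈ S n) :
    Tendsto (fun n => ((Lp.memLp f).indicator (hS n)).toLp _) atTop (𝓝 f) := by
  rw [tendsto_iff_edist_tendsto_0]
  have h := tendsto_lintegral_sub_indicator (Lp.stronglyMeasurable f) (Lp.memLp f) hS hcov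
  have h2 : Tendsto (fun n => (∫⁻ x, ‖f x - (S n).indicator f x‖ₑ ^ 2 ∂ν) ^ ((1 : ℝ) / 2)) atTop
      (𝓝 0) := by
    have := h.ennrpow_const ((1 : ℝ) / 2)
    rwa [ENNReal.zero_rpow_of_pos (by norm_num)] at this
  refine h2.congr fun n => ?_
  rw [edist_comm, Lp.edist_def, ← eLpNorm_two_sq, ← ENNReal.rpow_natCast, ← ENNReal.rpow_mul]
  norm_num
  refine eLpNorm_congr_ae ?_
  filter_upwards [((Lp.memLp f).indicator (hS n)).coeFn_toLp] with x hx
  simp [hx]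

namespace SchurKernel

variable {k : X → X → ℝ} {A : X → X → ℂ} {C : ℝ≥0} (h : SchurKernel ρ k A C)
include h

theorem memLp_resolventIntegral {f : X × ℝ → ℂ} (hf : StronglyMeasurable f)
    (hf2 : MemLp f 2 (ρ.prod volume)) {ε : ℝ} (hε : 0 < ε) :
    MemLp (resolventIntegral ρ k A ε f) 2 (ρ.prod volume) := by
  rw [memLp_two_iff (h.stronglyMeasurable_integral ε hf).aestronglyMeasurable]
  refine (h.lintegral_resolvent_le hf hf2 hε).trans_lt ?_
  exact ENNReal.mul_lt_top (ENNReal.mul_lt_top (ENNReal.pow_lt_top ENNReal.ofReal_lt_top)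
    ENNReal.coe_lt_top) ((memLp_two_iff hf2.1).1 hf2)

/-- The integral operator with kernel `resolventKernel`, as a bounded operator on `L²`. -/
theorem exists_clm {ε : ℝ} (hε : 0 < ε) :
    ∃ S : Lp ℂ 2 (ρ.prod (volume : Measure ℝ)) →L[ℂ] Lp ℂ 2 (ρ.prod (volume : Measure ℝ)),
      (∀ f, ‖S f‖ ≤ 2 * Real.pi * Real.sqrt C * ‖f‖) ∧
      ∀ f, S f =ᵐ[ρ.prod volume] resolventIntegral ρ k A ε f := by
  have hmem := fun f : Lp ℂ 2 (ρ.prod (volume : Measure ℝ)) =>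
    h.memLp_resolventIntegral (Lp.stronglyMeasurable f) (Lp.memLp f) hε
  let S₀ : Lp ℂ 2 (ρ.prod (volume : Measure ℝ)) →ₗ[ℂ] Lp ℂ 2 (ρ.prod (volume : Measure ℝ)) :=
    { toFun := fun f => (hmem f).toLp _
      map_add' := fun f g => by
        rw [← MemLp.toLp_add]
        refine MemLp.toLp_congr _ _ (Eventually.of_forall fun p => ?_)
        simp only [Pi.add_apply, resolventIntegral]
        rw [← integral_add (h.integrable_mul_kernel hε p (Lp.memLp f))
          (h.integrable_mul_kernel hε p (Lp.memLp g))]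
        refine integral_congr_ae ?_
        filter_upwards [Lp.coeFn_add f g] with q hq
        rw [hq, Pi.add_apply, add_mul]
      map_smul' := fun c f => by
        rw [RingHom.id_apply, ← MemLp.toLp_const_smul]
        refine MemLp.toLp_congr _ _ (Eventually.of_forall fun p => ?_)
        simp only [Pi.smul_apply, resolventIntegral]
        rw [← integral_smul]
        refine integral_congr_ae ?_
        filter_upwards [Lp.coeFn_smul c f] with q hq
        rw [hq, Pi.smul_apply, smul_mul_assoc] }
  have hbound : ∀ f, ‖S₀ f‖ ≤ 2 * Real.pi * Real.sqrt C * ‖f‖ := fun f => by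
    have h1 := h.lintegral_resolvent_le (Lp.stronglyMeasurable f) (Lp.memLp f) hε
    rw [← eLpNorm_two_sq, ← eLpNorm_two_sq, ← Lp.enorm_def] at h1
    have h2 : ‖S₀ f‖ₑ = eLpNorm (resolventIntegral ρ k A ε f) 2 (ρ.prod volume) :=
      Lp.enorm_toLp (hmem f)
    rw [← h2, ← ofReal_norm, ← ofReal_norm, ← ENNReal.ofReal_pow (norm_nonneg _),
      ← ENNReal.ofReal_pow (norm_nonneg _), ← ENNReal.ofReal_pow (by positivity),
      ← ENNReal.ofReal_coe_nnreal, ← ENNReal.ofReal_mul (by positivity),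
      ← ENNReal.ofReal_mul (by positivity), ENNReal.ofReal_le_ofReal_iff (by positivity)] at h1
    refine le_of_sq_le_sq ?_ (by positivity)
    calc _ ≤ _ := h1
      _ = _ := by rw [mul_pow (2 * Real.pi * Real.sqrt C), mul_pow (2 * Real.pi) (Real.sqrt C),
        Real.sq_sqrt C.coe_nonneg]
  exact ⟨S₀.mkContinuous _ hbound, hbound, fun f => (hmem f).coeFn_toLp⟩

/-- The operators are bounded uniformly in $\varepsilon$ and Cauchy on the dense set of functions
with bounded support in $s$, hence strongly Cauchy. The limit is bounded by Banach–Steinhaus. -/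
theorem exists_limit :
    ∃ T : Lp ℂ 2 (ρ.prod (volume : Measure ℝ)) →L[ℂ] Lp ℂ 2 (ρ.prod (volume : Measure ℝ)),
      ∀ f : Lp ℂ 2 (ρ.prod (volume : Measure ℝ)),
        Tendsto (fun ε : ℝ => eLpNorm (fun p => resolventIntegral ρ k A ε f p - T f p) 2
          (ρ.prod volume)) (𝓝[>] 0) (𝓝 0) := by
  have hex : ∀ ε : ℝ, ∃ S : Lp ℂ 2 (ρ.prod (volume : Measure ℝ)) →L[ℂ]
      Lp ℂ 2 (ρ.prod (volume : Measure ℝ)), 0 < ε →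
      (∀ f, ‖S f‖ ≤ 2 * Real.pi * Real.sqrt C * ‖f‖) ∧
      ∀ f, S f =ᵐ[ρ.prod volume] resolventIntegral ρ k A ε f := fun ε => by
    by_cases hε : 0 < ε
    · obtain ⟨S, hS⟩ := h.exists_clm hε
      exact ⟨S, fun _ => hS⟩
    · exact ⟨0, fun h => absurd h hε⟩
  choose S hS using hex
  set B : ℝ := 2 * Real.pi * Real.sqrt C with hB
  have hB0 : 0 ≤ B := by positivity
  have hpos : ∀ᶠ e : ℝ × ℝ in 𝓝[>] 0 ×ˢ 𝓝[>] 0, 0 < e.1 ∧ 0 < e.2 :=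
    (eventually_mem_nhdsWithin.prod_inl _).and (eventually_mem_nhdsWithin.prod_inr _)
  have htrunc : ∀ (f : Lp ℂ 2 (ρ.prod (volume : Measure ℝ))) (n : ℕ)
      (hn : MeasurableSet {q : X × ℝ | |q.2| ≤ n}),
      Tendsto (fun e : ℝ × ℝ => dist (S e.1 (((Lp.memLp f).indicator hn).toLp _))
        (S e.2 (((Lp.memLp f).indicator hn).toLp _))) (𝓝[>] 0 ×ˢ 𝓝[>] 0) (𝓝 0) := by
    intro f n hn
    have hlim := h.tendsto_lintegral_resolvent_sub ((Lp.stronglyMeasurable f).indicator hn)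
      ((Lp.memLp f).indicator hn) (n := n)
      (fun q hq => indicator_of_notMem (by simpa using hq) f)
    have hlim2 := hlim.ennrpow_const ((1 : ℝ) / 2)
    rw [ENNReal.zero_rpow_of_pos (by norm_num)] at hlim2
    have hlim3 := (ENNReal.tendsto_toReal ENNReal.zero_ne_top).comp hlim2
    refine hlim3.congr' ?_
    filter_upwards [hpos] with e he
    rw [Function.comp, dist_edist, Lp.edist_def, ← eLpNorm_two_sq, ← ENNReal.rpow_natCast,
      ← ENNReal.rpow_mul]
    norm_num
    congr 1
    refine eLpNorm_congr_ae ?_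
    filter_upwards [(hS e.1 he.1).2 (((Lp.memLp f).indicator hn).toLp _),
      (hS e.2 he.2).2 (((Lp.memLp f).indicator hn).toLp _)] with p h1 h2
    have hcongr : ∀ ε, resolventIntegral ρ k A ε (((Lp.memLp f).indicator hn).toLp _) p =
        resolventIntegral ρ k A ε ({q : X × ℝ | |q.2| ≤ n}.indicator f) p := fun ε => by
      refine integral_congr_ae ?_
      filter_upwards [((Lp.memLp f).indicator hn).coeFn_toLp] with q hq
      rw [hq]
    rw [Pi.sub_apply, h1, h2, hcongr, hcongr]
  have hcauchy : ∀ f, ∃ g, Tendsto (fun ε => S ε f) (𝓝[>] 0) (𝓝 g) := fun f => by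
    refine cauchy_map_iff_exists_tendsto.1 ?_
    rw [cauchy_map_iff]
    refine ⟨inferInstance, ?_⟩
    rw [tendsto_uniformity_iff_dist_tendsto_zero, Metric.tendsto_nhds]
    intro r hr
    have hSm : ∀ n : ℕ, MeasurableSet {q : X × ℝ | |q.2| ≤ n} := fun n =>
      measurableSet_le (by fun_prop) measurable_const
    have hconv := tendsto_toLp_indicator f hSm (fun q => by
      filter_upwards [eventually_ge_atTop (Nat.ceil |q.2|)] with n hn
      exact (Nat.le_ceil |q.2|).trans (by exact_mod_cast hn))
    rw [Metric.tendsto_atTop] at hconv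
    -- With this radius the two approximation errors, each at most $B$ times the distance, sum to at
    -- most $r/2$; using $2B+1$ instead of $2B$ allows $B=0$.
    obtain ⟨n, hn⟩ := hconv (r / (2 * (2 * B + 1))) (by positivity)
    have hn := hn n le_rfl
    set fn := ((Lp.memLp f).indicator (hSm n)).toLp _ with hfn
    have ht := htrunc f n (hSm n)
    rw [Metric.tendsto_nhds] at ht
    filter_upwards [ht (r / 2) (by positivity), hpos] with e he hpe
    rw [Real.dist_0_eq_abs, abs_of_nonneg dist_nonneg] at he ⊢
    have hb : ∀ ε, 0 < ε → dist (S ε fn) (S ε f) ≤ B * dist fn f := fun ε hε => by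
      rw [dist_eq_norm, ← map_sub, dist_eq_norm]
      exact (hS ε hε).1 _
    have h1 := hb e.1 hpe.1
    have h2 := hb e.2 hpe.2
    have h3 := dist_triangle4 (S e.1 f) (S e.1 fn) (S e.2 fn) (S e.2 f)
    rw [dist_comm (S e.1 f) (S e.1 fn)] at h3
    have h4 : 2 * (B * dist fn f) ≤ r / 2 := by
      have : (2 * B + 1) * dist fn f ≤ (2 * B + 1) * (r / (2 * (2 * B + 1))) := by gcongr
      have h5 : (2 * B + 1) * (r / (2 * (2 * B + 1))) = r / 2 := by field_simp
      have := dist_nonneg (x := fn) (y := f)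
      nlinarith
    linarith
  choose T hT using hcauchy
  refine ⟨continuousLinearMapOfTendsto (g := S) (l := 𝓝[>] 0) (f := T)
    (tendsto_pi_nhds.2 hT), fun f => ?_⟩
  have h0 := tendsto_iff_edist_tendsto_0.1 (hT f)
  refine h0.congr' ?_
  filter_upwards [self_mem_nhdsWithin] with ε hε
  rw [Lp.edist_def]
  refine eLpNorm_congr_ae ?_
  filter_upwards [(hS ε hε).2 f] with p hp
  rw [Pi.sub_apply, hp]
  rfl

end SchurKernel

/-! ### Adjoints of the limit operators -/

/-- Integration against the adjoint kernel, on functions for which Fubini's theorem applies. -/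
theorem integral_conj_resolventIntegral_mul {k k' : X → X → ℝ} {A A' : X → X → ℂ} {C : ℝ≥0}
    (h : SchurKernel ρ k A C)
    (hk : ∀ x y, k' x y = k y x) (hA : ∀ x y, A' x y = conj (A y x)) {ε : ℝ}
    {f g : X × ℝ → ℂ} (hf : StronglyMeasurable f) (hg : StronglyMeasurable g)
    (hf2 : MemLp f 2 (ρ.prod volume))
    (hfin : ∫⁻ p, ‖g p‖ₑ * (∫⁻ q, ‖resolventKernel k A ε p q‖ₑ ^ 2 ∂(ρ.prod volume)) ^ ((1 : ℝ) / 2)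
      ∂(ρ.prod volume) < ⊤) :
    ∫ q, conj (resolventIntegral ρ k' A' ε g q) * f q ∂(ρ.prod volume) =
      ∫ p, conj (g p) * resolventIntegral ρ k A ε f p ∂(ρ.prod volume) := by
  have hK := h.measurable_kernel ε
  have hKp : ∀ p, Measurable (resolventKernel k A ε p) := fun p => hK.comp measurable_prodMk_left
  -- Conjugation and the exchange of the two points each reverse the sign of $i(s-t)$, so this term
  -- is preserved.
  have hconj : ∀ p q, conj (resolventKernel k' A' ε q p) = resolventKernel k A ε p q := by
    intro p q
    simp only [resolventKernel, hk, hA, map_div₀, map_pow, map_add, map_mul, Complex.conj_ofReal,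
      Complex.conj_conj, map_sub, Complex.conj_I]
    ring_nf
  have hmeas : Measurable fun z : (X × ℝ) × (X × ℝ) =>
      conj (g z.1) * (f z.2 * resolventKernel k A ε z.1 z.2) :=
    (Complex.continuous_conj.measurable.comp (hg.measurable.comp measurable_fst)).mul
      ((hf.measurable.comp measurable_snd).mul hK)
  have hint : Integrable (fun z : (X × ℝ) × (X × ℝ) =>
      conj (g z.1) * (f z.2 * resolventKernel k A ε z.1 z.2))
      ((ρ.prod volume).prod (ρ.prod volume)) := by
    refine ⟨hmeas.aestronglyMeasurable, ?_⟩
    rw [hasFiniteIntegral_iff_enorm, lintegral_prod _ hmeas.enorm.aemeasurable]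
    have hb : ∀ p, ∫⁻ q, ‖conj (g p) * (f q * resolventKernel k A ε p q)‖ₑ ∂(ρ.prod volume) ≤
        (‖g p‖ₑ * (∫⁻ q, ‖resolventKernel k A ε p q‖ₑ ^ 2 ∂(ρ.prod volume)) ^ ((1 : ℝ) / 2)) *
        (∫⁻ q, ‖f q‖ₑ ^ 2 ∂(ρ.prod volume)) ^ ((1 : ℝ) / 2) := fun p => by
      have hcs := lintegral_mul_sq_le (ν := ρ.prod volume) (f := fun q => ‖f q‖ₑ)
        (g := fun q => ‖resolventKernel k A ε p q‖ₑ) hf.measurable.enorm.aemeasurable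
        (hKp p).enorm.aemeasurable
      have hcs2 := ENNReal.rpow_le_rpow hcs (z := (1 : ℝ) / 2) (by norm_num)
      rw [← ENNReal.rpow_natCast, ← ENNReal.rpow_mul,
        ENNReal.mul_rpow_of_nonneg _ _ (by norm_num)] at hcs2
      norm_num at hcs2
      simp only [enorm_mul, RCLike.enorm_conj]
      rw [lintegral_const_mul' _ _ enorm_ne_top, mul_assoc]
      gcongr
      rw [mul_comm]
      simpa using hcs2
    refine (lintegral_mono hb).trans_lt ?_
    rw [lintegral_mul_const'']
    · refine ENNReal.mul_lt_top hfin (ENNReal.rpow_lt_top_of_nonneg (by norm_num) ?_)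
      exact ((memLp_two_iff hf2.1).1 hf2).ne
    · refine (hg.measurable.enorm.mul (Measurable.pow_const ?_ _)).aemeasurable
      exact Measurable.lintegral_prod_right' (f := fun z : (X × ℝ) × (X × ℝ) =>
        ‖resolventKernel k A ε z.1 z.2‖ₑ ^ 2) (hK.enorm.pow_const 2)
  have e1 : ∀ q, conj (resolventIntegral ρ k' A' ε g q) * f q =
      ∫ p, conj (g p) * (f q * resolventKernel k A ε p q) ∂(ρ.prod volume) := fun q => by
    rw [resolventIntegral, ← integral_conj, ← integral_mul_const]
    refine integral_congr_ae (Eventually.of_forall fun p => ?_)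
    simp only [map_mul, hconj]
    ring
  have e2 : ∀ p, conj (g p) * resolventIntegral ρ k A ε f p =
      ∫ q, conj (g p) * (f q * resolventKernel k A ε p q) ∂(ρ.prod volume) := fun p => by
    rw [resolventIntegral, ← integral_const_mul]
  simp only [e1, e2]
  exact (integral_integral_swap hint).symm

/-- The adjoint of a limit of operators with kernel `resolventKernel` is the limit of the operators
with the adjoint kernel. -/
theorem eq_adjoint_of_tendsto [SigmaFinite ρ] {k k' : X → X → ℝ} {A A' : X → X → ℂ} {C C' : ℝ≥0}
    (h : SchurKernel ρ k A C) (h' : SchurKernel ρ k' A' C')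
    (hk : ∀ x y, k' x y = k y x) (hA : ∀ x y, A' x y = conj (A y x))
    {T T' : Lp ℂ 2 (ρ.prod (volume : Measure ℝ)) →L[ℂ] Lp ℂ 2 (ρ.prod (volume : Measure ℝ))}
    (hT : ∀ f : Lp ℂ 2 (ρ.prod (volume : Measure ℝ)),
      Tendsto (fun ε : ℝ => eLpNorm (fun p => resolventIntegral ρ k A ε f p - T f p) 2
        (ρ.prod volume)) (𝓝[>] 0) (𝓝 0))
    (hT' : ∀ f : Lp ℂ 2 (ρ.prod (volume : Measure ℝ)),
      Tendsto (fun ε : ℝ => eLpNorm (fun p => resolventIntegral ρ k' A' ε f p - T' f p) 2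
        (ρ.prod volume)) (𝓝[>] 0) (𝓝 0)) :
    T' = ContinuousLinearMap.adjoint T := by
  rw [ContinuousLinearMap.eq_adjoint_iff]
  intro g f
  have key : ∀ (ε : ℝ) (hε : 0 < ε), inner ℂ ((h'.memLp_resolventIntegral (Lp.stronglyMeasurable g)
      (Lp.memLp g) hε).toLp _) f = inner ℂ g ((h.memLp_resolventIntegral
      (Lp.stronglyMeasurable f) (Lp.memLp f) hε).toLp _) := by
    intro ε hε
    obtain ⟨S, -, hS⟩ := h.exists_clm hε
    obtain ⟨S', -, hS'⟩ := h'.exists_clm hε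
    have e1 : (h.memLp_resolventIntegral (Lp.stronglyMeasurable f)
        (Lp.memLp f) hε).toLp _ = S f :=
      Lp.ext ((MemLp.coeFn_toLp _).trans (hS f).symm)
    have e2 : (h'.memLp_resolventIntegral (Lp.stronglyMeasurable g)
        (Lp.memLp g) hε).toLp _ = S' g :=
      Lp.ext ((MemLp.coeFn_toLp _).trans (hS' g).symm)
    rw [e1, e2]
    have hK := h.measurable_kernel ε
    set N : X × ℝ → ℝ≥0∞ := fun p => (∫⁻ q, ‖resolventKernel k A ε p q‖ₑ ^ 2
      ∂(ρ.prod volume)) ^ ((1 : ℝ) / 2) with hN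
    have hNm : Measurable N := Measurable.pow_const (Measurable.lintegral_prod_right'
      (f := fun z : (X × ℝ) × (X × ℝ) => ‖resolventKernel k A ε z.1 z.2‖ₑ ^ 2)
      (hK.enorm.pow_const 2)) _
    have hNfin : ∀ p, N p < ⊤ := fun p => ENNReal.rpow_lt_top_of_nonneg (by norm_num)
      ((memLp_two_iff (h.memLp_kernel hε p).1).1 (h.memLp_kernel hε p)).ne
    -- On $E_n$ the row norm of the kernel is at most $n$ and the measure is finite, so Fubini
    -- applies to the truncation of $g$. These sets exhaust the space, and both sides of the
    -- identity are continuous in $g$.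
    set E : ℕ → Set (X × ℝ) := fun n => {p | N p ≤ n} ∩ spanningSets (ρ.prod volume) n with hE
    have hEm : ∀ n, MeasurableSet (E n) := fun n =>
      (measurableSet_le hNm measurable_const).inter (measurableSet_spanningSets _ _)
    have hEcov : ∀ p, ∀ᶠ n in atTop, p ∈ E n := fun p => by
      obtain ⟨m, hm⟩ := ENNReal.exists_nat_gt (hNfin p).ne
      filter_upwards [eventually_ge_atTop m, eventually_mem_spanningSets (ρ.prod volume) p]
        with n hn hn2
      exact ⟨hm.le.trans (by exact_mod_cast hn), hn2⟩
    have hlim := tendsto_toLp_indicator g hEm hEcov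
    set gn := fun n => ((Lp.memLp g).indicator (hEm n)).toLp _ with hgn
    have heq : ∀ n, inner ℂ (S' (gn n)) f = inner ℂ (gn n) (S f) := fun n => by
      rw [L2.inner_def, L2.inner_def]
      have hfin : ∫⁻ p, ‖gn n p‖ₑ * N p ∂(ρ.prod volume) < ⊤ := by
        have hae := ((Lp.memLp g).indicator (hEm n)).coeFn_toLp
        calc _ = ∫⁻ p, ‖(E n).indicator g p‖ₑ * N p ∂(ρ.prod volume) := by
              refine lintegral_congr_ae ?_
              filter_upwards [hae] with p hp
              rw [hp]
          _ ≤ ∫⁻ p, ‖g p‖ₑ * (E n).indicator (fun _ => (n : ℝ≥0∞)) p ∂(ρ.prod volume) := by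
              refine lintegral_mono fun p => ?_
              by_cases hp : p ∈ E n
              · simp only [indicator_of_mem hp]
                gcongr
                exact hp.1
              · simp [indicator_of_notMem hp]
          _ < ⊤ := by
              have hcs := lintegral_mul_sq_le (ν := ρ.prod volume) (f := fun p => ‖g p‖ₑ)
                (g := (E n).indicator (fun _ => (n : ℝ≥0∞)))
                (Lp.stronglyMeasurable g).measurable.enorm.aemeasurable
                (measurable_const.indicator (hEm n)).aemeasurable
              have hlt := hcs.trans_lt (ENNReal.mul_lt_top
                ((memLp_two_iff (Lp.memLp g).1).1 (Lp.memLp g)) (by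
                  have : (fun p => (E n).indicator (fun _ => (n : ℝ≥0∞)) p ^ 2) =
                      (E n).indicator (fun _ => (n : ℝ≥0∞) ^ 2) := by
                    ext p
                    by_cases hp : p ∈ E n <;> simp [hp]
                  rw [this, lintegral_indicator (hEm n), setLIntegral_const]
                  refine ENNReal.mul_lt_top (by finiteness) ?_
                  exact (measure_mono inter_subset_right).trans_lt
                    (measure_spanningSets_lt_top _ _)))
              rw [ENNReal.pow_lt_top_iff] at hlt
              simpa using hlt
      have hF := integral_conj_resolventIntegral_mul h hk hA (Lp.stronglyMeasurable f)
        (Lp.stronglyMeasurable (gn n)) (Lp.memLp f) hfin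
      refine Eq.trans (integral_congr_ae ?_) (hF.trans (integral_congr_ae ?_))
      · filter_upwards [hS' (gn n)] with q hq
        rw [hq, RCLike.inner_apply, mul_comm]
      · filter_upwards [hS f] with q hq
        rw [hq, RCLike.inner_apply, mul_comm]
    refine tendsto_nhds_unique (((S'.continuous.tendsto g).comp hlim).inner tendsto_const_nhds) ?_
    refine (hlim.inner tendsto_const_nhds).congr fun n => (heq n).symm
  -- The limit is restated over the subtype $\varepsilon>0$, because the integrals are known to
  -- define elements of $L^2$ only there.
  have aux : ∀ {κ : X → X → ℝ} {B : X → X → ℂ} {D : ℝ≥0} (hκ : SchurKernel ρ κ B D)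
      {U : Lp ℂ 2 (ρ.prod (volume : Measure ℝ)) →L[ℂ] Lp ℂ 2 (ρ.prod (volume : Measure ℝ))}
      (u : Lp ℂ 2 (ρ.prod (volume : Measure ℝ))),
      Tendsto (fun ε : ℝ => eLpNorm (fun p => resolventIntegral ρ κ B ε u p - U u p) 2
        (ρ.prod volume)) (𝓝[>] 0) (𝓝 0) →
      Tendsto (fun ε : Ioi (0 : ℝ) => (hκ.memLp_resolventIntegral (Lp.stronglyMeasurable u)
        (Lp.memLp u) ε.2).toLp _) (comap Subtype.val (𝓝[>] 0)) (𝓝 (U u)) := by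
    intro κ B D hκ U u hu
    rw [tendsto_iff_edist_tendsto_0]
    refine (hu.comp tendsto_comap).congr fun ε => ?_
    rw [Lp.edist_def]
    refine eLpNorm_congr_ae ?_
    filter_upwards [MemLp.coeFn_toLp (hκ.memLp_resolventIntegral (Lp.stronglyMeasurable u)
        (Lp.memLp u) ε.2)] with p hp
    rw [Pi.sub_apply, hp]
  have : (comap (Subtype.val : Ioi (0 : ℝ) → ℝ) (𝓝[>] 0)).NeBot := by
    rw [comap_neBot_iff_frequently]
    refine Eventually.frequently ?_
    filter_upwards [self_mem_nhdsWithin] with x hx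
    exact ⟨⟨x, hx⟩, rfl⟩
  refine tendsto_nhds_unique ((aux h' g (hT' g)).inner tendsto_const_nhds) ?_
  exact (tendsto_const_nhds.inner (aux h f (hT f))).congr fun ε => (key ε ε.2).symm

end ResolventIntegral

/-! ### Radial integrals and the Bregman divergence of $x^\gamma$ -/

theorem lintegral_rpow_mul_exp_neg_mul_rpow {p q b : ℝ} (hp : 1 ≤ p) (hq : -2 < q) (hb : 0 < b) :
    ∫⁻ x : ℂ, ENNReal.ofReal (‖x‖ ^ q * Real.exp (-b * ‖x‖ ^ p)) =
      ENNReal.ofReal ((2 * Real.pi / p) * b ^ (-(q + 2) / p) * Real.Gamma ((q + 2) / p)) := by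
  have h := Complex.integral_rpow_mul_exp_neg_mul_rpow hp hq hb
  have hpos : 0 < (2 * Real.pi / p) * b ^ (-(q + 2) / p) * Real.Gamma ((q + 2) / p) := by
    have : 0 < Real.Gamma ((q + 2) / p) := Real.Gamma_pos_of_pos (div_pos (by linarith) (by linarith))
    positivity
  rw [← h, ofReal_integral_eq_lintegral_ofReal]
  -- Integrability is read off from the value: a non-integrable function would have integral $0$,
  -- but the closed form is positive.
  · by_contra hI
    rw [integral_undef hI] at h
    exact hpos.ne h
  · exact Eventually.of_forall fun x => by positivity

theorem rpow_le_two_rpow_abs_mul {a b : ℝ} (ha : 0 < a) (hb : 0 < b) (hab : a ≤ 2 * b)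
    (hba : b ≤ 2 * a) (p : ℝ) : a ^ p ≤ 2 ^ |p| * b ^ p := by
  rcases le_total 0 p with hp | hp
  · rw [abs_of_nonneg hp, ← Real.mul_rpow (by norm_num) hb.le]
    exact Real.rpow_le_rpow ha.le hab hp
  · rw [abs_of_nonpos hp]
    have h1 : (2 * a) ^ p ≤ b ^ p := Real.rpow_le_rpow_of_nonpos hb hba hp
    rw [Real.mul_rpow (by norm_num) ha.le] at h1
    have h2 : (2 : ℝ) ^ (-p) * 2 ^ p = 1 := by
      rw [← Real.rpow_add (by norm_num)]; simp
    calc a ^ p = 2 ^ (-p) * (2 ^ p * a ^ p) := by rw [← mul_assoc, h2, one_mul]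
      _ ≤ _ := by gcongr

/-- The Bregman divergence of `x ↦ x ^ γ`. -/
noncomputable def bregman (γ a b : ℝ) : ℝ := (γ - 1) * a ^ γ - γ * a ^ (γ - 1) * b + b ^ γ

theorem bregman_eq_mul_right (γ : ℝ) {a b : ℝ} (ha : 0 < a) (hb : 0 ≤ b) :
    bregman γ a b = a ^ γ * bregman γ 1 (b / a) := by
  have h1 : a ^ (γ - 1) = a ^ γ / a := by rw [Real.rpow_sub ha, Real.rpow_one]
  have h2 : 0 < a ^ γ := Real.rpow_pos_of_pos ha _
  rw [bregman, bregman, Real.div_rpow hb ha.le, h1, Real.one_rpow, Real.one_rpow]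
  field_simp

theorem bregman_eq_mul_left (γ : ℝ) {a b : ℝ} (ha : 0 ≤ a) (hb : 0 < b) :
    bregman γ a b = b ^ γ * bregman γ (a / b) 1 := by
  have h1 : b ^ (γ - 1) = b ^ γ / b := by rw [Real.rpow_sub hb, Real.rpow_one]
  have h2 : 0 < b ^ γ := Real.rpow_pos_of_pos hb _
  rw [bregman, bregman, Real.div_rpow ha hb.le, Real.div_rpow ha hb.le, h1, Real.one_rpow]
  field_simp

section Bregman

variable {γ : ℝ} (hγ : 1 < γ)
include hγ

/-- By homogeneity this is the strict Bernoulli inequality at $b/a$. -/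
theorem bregman_pos {a b : ℝ} (ha : 0 ≤ a) (hb : 0 ≤ b) (hab : a ≠ b) : 0 < bregman γ a b := by
  rcases ha.eq_or_lt with rfl | ha
  · have hb : 0 < b := lt_of_le_of_ne hb hab
    simp only [bregman]
    rw [Real.zero_rpow (by linarith), Real.zero_rpow (by linarith)]
    have := Real.rpow_pos_of_pos hb γ
    simpa
  · rw [bregman_eq_mul_right γ ha hb]
    refine mul_pos (Real.rpow_pos_of_pos ha _) ?_
    have hs : b / a - 1 ≠ 0 := fun h => hab (by field_simp at h; linarith)
    have := one_add_mul_self_lt_rpow_one_add (s := b / a - 1)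
      (by have : 0 ≤ b / a := by positivity
          linarith) hs hγ
    rw [add_sub_cancel] at this
    simp only [bregman, Real.one_rpow]
    linarith

theorem bregman_nonneg {a b : ℝ} (ha : 0 ≤ a) (hb : 0 ≤ b) : 0 ≤ bregman γ a b := by
  by_cases h : a = b
  · subst h
    rcases ha.eq_or_lt with rfl | ha
    · simp only [bregman]
      rw [Real.zero_rpow (by linarith), Real.zero_rpow (by linarith)]
      simp
    · have h1 : a ^ (γ - 1) = a ^ γ / a := by rw [Real.rpow_sub ha, Real.rpow_one]
      rw [bregman, h1]
      field_simp
      ring_nf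
      rfl
  · exact (bregman_pos hγ ha hb h).le

/-- Strong convexity: on $[1/2,2]$ the second derivative of $x^\gamma$ is at least $2c$, so
$x^\gamma-cx^2$ is convex and lies above its tangent at $1$. -/
theorem exists_sq_le_bregman_one :
    ∃ c > 0, ∀ t ∈ Icc (1 / 2 : ℝ) 2, c * (t - 1) ^ 2 ≤ bregman γ 1 t := by
  set c : ℝ := γ * (γ - 1) / 2 * 2 ^ (-|γ - 2|) with hc
  have hc0 : 0 < c := by
    have : 0 < γ * (γ - 1) := mul_pos (by linarith) (by linarith)
    positivity
  refine ⟨c, hc0, fun t ht => ?_⟩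
  have hne : ∀ x ∈ Icc (1 / 2 : ℝ) 2, x ≠ 0 := fun x hx => by
    have := hx.1
    intro h
    norm_num [h] at this
  set G : ℝ → ℝ := fun x => x ^ γ - c * x ^ 2 with hG
  have hd : ∀ x ∈ Icc (1 / 2 : ℝ) 2, HasDerivAt G (γ * x ^ (γ - 1) - c * (2 * x)) x := fun x hx => by
    have h1 := Real.hasDerivAt_rpow_const (x := x) (p := γ) (Or.inl (hne x hx))
    have h2 := (hasDerivAt_pow 2 x).const_mul c
    convert! h1.sub h2 using 1
    simp
  have hd2 : ∀ x ∈ Icc (1 / 2 : ℝ) 2, HasDerivAt (fun x : ℝ => γ * x ^ (γ - 1) - c * (2 * x))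
      (γ * ((γ - 1) * x ^ (γ - 2)) - c * 2) x := fun x hx => by
    have h1 := (Real.hasDerivAt_rpow_const (x := x) (p := γ - 1) (Or.inl (hne x hx))).const_mul γ
    have h2 := ((hasDerivAt_id x).const_mul 2).const_mul c
    convert! h1.sub h2 using 1
    rw [show γ - 1 - 1 = γ - 2 by ring]
    simp
  have hmono : MonotoneOn (fun x : ℝ => γ * x ^ (γ - 1) - c * (2 * x)) (Icc (1 / 2 : ℝ) 2) := by
    refine monotoneOn_of_deriv_nonneg (convex_Icc _ _)
      (fun x hx => (hd2 x hx).continuousAt.continuousWithinAt)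
      (fun x hx => (hd2 x (interior_subset hx)).differentiableAt.differentiableWithinAt)
      fun x hx => ?_
    have hx' := interior_subset hx
    rw [(hd2 x hx').deriv]
    have hx0 : 0 < x := lt_of_lt_of_le (by norm_num) hx'.1
    have h1 := rpow_le_two_rpow_abs_mul one_pos hx0 (by linarith [hx'.1]) (by linarith [hx'.2])
      (γ - 2)
    rw [Real.one_rpow] at h1
    have h2 : (2 : ℝ) ^ (-|γ - 2|) * 2 ^ |γ - 2| = 1 := by
      rw [← Real.rpow_add (by norm_num)]; simp
    have h3 : (2 : ℝ) ^ (-|γ - 2|) ≤ x ^ (γ - 2) := by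
      calc _ = (2 : ℝ) ^ (-|γ - 2|) * 1 := by ring
        _ ≤ (2 : ℝ) ^ (-|γ - 2|) * (2 ^ |γ - 2| * x ^ (γ - 2)) := by gcongr
        _ = _ := by rw [← mul_assoc, h2, one_mul]
    have h4 : 0 ≤ γ * (γ - 1) := mul_nonneg (by linarith) (by linarith)
    have h5 := mul_le_mul_of_nonneg_left h3 h4
    rw [hc]
    linarith
  have h1mem : (1 : ℝ) ∈ Icc (1 / 2 : ℝ) 2 := by constructor <;> norm_num
  have hconv : ConvexOn ℝ (Icc (1 / 2 : ℝ) 2) G := by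
    refine MonotoneOn.convexOn_of_deriv (convex_Icc _ _)
      (fun x hx => (hd x hx).continuousAt.continuousWithinAt)
      (fun x hx => (hd x (interior_subset hx)).differentiableAt.differentiableWithinAt)
      fun x hx y hy hxy => ?_
    rw [(hd x (interior_subset hx)).deriv, (hd y (interior_subset hy)).deriv]
    exact hmono (interior_subset hx) (interior_subset hy) hxy
  have key : G 1 + (γ * 1 ^ (γ - 1) - c * (2 * 1)) * (t - 1) ≤ G t := by
    rcases lt_trichotomy t 1 with h | h | h
    · have := hconv.slope_le_of_hasDerivAt ht h1mem h (hd 1 h1mem)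
      rw [slope_def_field, div_le_iff₀ (by linarith)] at this
      linarith
    · subst h; simp
    · have := hconv.le_slope_of_hasDerivAt h1mem ht h (hd 1 h1mem)
      rw [slope_def_field, le_div_iff₀ (by linarith)] at this
      linarith
  simp only [hG, Real.one_rpow] at key
  simp only [bregman, Real.one_rpow]
  nlinarith

theorem continuous_bregman : Continuous fun x : ℝ × ℝ => bregman γ x.1 x.2 := by
  unfold bregman
  have h1 : Continuous fun x : ℝ => x ^ γ := Real.continuous_rpow_const (by linarith)
  have h2 : Continuous fun x : ℝ => x ^ (γ - 1) := Real.continuous_rpow_const (by linarith)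
  fun_prop

/-- Homogeneity of degree $\gamma$ reduces each regime to one variable. Where the ratio is at most
$1/2$, the constant is a positive minimum over a compact interval; for comparable arguments it comes
from strong convexity. -/
theorem exists_bregman_lower :
    ∃ c > 0, ∀ a b : ℝ, 0 ≤ a → 0 ≤ b →
      (a ≤ b / 2 → c * b ^ γ ≤ bregman γ a b) ∧ (b ≤ a / 2 → c * a ^ γ ≤ bregman γ a b) ∧
      (a / 2 ≤ b → b ≤ 2 * a → c * (a ^ (γ - 2) * (a - b) ^ 2) ≤ bregman γ a b) := by
  obtain ⟨c₁, hc₁, h₁⟩ := exists_sq_le_bregman_one hγ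
  have hcont := continuous_bregman hγ
  have hne : (Icc (0 : ℝ) (1 / 2)).Nonempty := ⟨0, by norm_num⟩
  obtain ⟨x, hx, hxmin⟩ := isCompact_Icc.exists_isMinOn hne
    (hcont.comp (by fun_prop : Continuous fun s : ℝ => (s, (1 : ℝ)))).continuousOn
  obtain ⟨y, hy, hymin⟩ := isCompact_Icc.exists_isMinOn hne
    (hcont.comp (by fun_prop : Continuous fun s : ℝ => ((1 : ℝ), s))).continuousOn
  have hx0 : 0 < bregman γ x 1 := bregman_pos hγ hx.1 zero_le_one (by linarith [hx.2])
  have hy0 : 0 < bregman γ 1 y := bregman_pos hγ zero_le_one hy.1 (by linarith [hy.2])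
  refine ⟨min c₁ (min (bregman γ x 1) (bregman γ 1 y)), by positivity, fun a b ha hb => ?_⟩
  set c := min c₁ (min (bregman γ x 1) (bregman γ 1 y))
  have hcc₁ : c ≤ c₁ := min_le_left _ _
  have hcx : c ≤ bregman γ x 1 := (min_le_right _ _).trans (min_le_left _ _)
  have hcy : c ≤ bregman γ 1 y := (min_le_right _ _).trans (min_le_right _ _)
  refine ⟨fun hab => ?_, fun hba => ?_, fun hab hba => ?_⟩
  · rcases hb.eq_or_lt with rfl | hb
    · rw [Real.zero_rpow (by linarith), mul_zero]
      exact bregman_nonneg hγ ha le_rfl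
    · rw [bregman_eq_mul_left γ ha hb, mul_comm]
      gcongr
      exact hcx.trans (hxmin ⟨by positivity, by rw [div_le_iff₀ hb]; linarith⟩)
  · rcases ha.eq_or_lt with rfl | ha
    · rw [Real.zero_rpow (by linarith), mul_zero]
      exact bregman_nonneg hγ le_rfl hb
    · rw [bregman_eq_mul_right γ ha hb, mul_comm]
      gcongr
      exact hcy.trans (hymin ⟨by positivity, by rw [div_le_iff₀ ha]; linarith⟩)
  · rcases ha.eq_or_lt with rfl | ha
    · have : b = 0 := le_antisymm (by linarith) hb
      subst this
      simpa using bregman_nonneg hγ le_rfl le_rfl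
    · rw [bregman_eq_mul_right γ ha hb]
      have h2 := h₁ (b / a) ⟨by rw [le_div_iff₀ ha]; linarith, by rw [div_le_iff₀ ha]; linarith⟩
      have h3 : a ^ (γ - 2) = a ^ γ / a ^ 2 := by
        rw [Real.rpow_sub ha, Real.rpow_two]
      calc c * (a ^ (γ - 2) * (a - b) ^ 2) ≤ c₁ * (a ^ (γ - 2) * (a - b) ^ 2) := by gcongr
        _ = a ^ γ * (c₁ * (b / a - 1) ^ 2) := by
            rw [h3]; field_simp; ring
        _ ≤ _ := by gcongr

end Bregman

/-! ### The Leray phase and its lower bounds -/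

/-- The phase of the Leray kernel in the graph coordinates of `M_γ`. -/
noncomputable def lerayPhase (γ : ℝ) (z w : ℂ) : ℂ :=
  ((γ : ℂ) - 1) * ((‖w‖ ^ γ : ℝ) : ℂ) - (γ : ℂ) * conj w * ((‖w‖ ^ (γ - 2) : ℝ) : ℂ) * z +
    ((‖z‖ ^ γ : ℝ) : ℂ)

/-- The radial and angular contributions separate, and each is nonnegative. The identity
`norm_sub_sq_eq` splits $|z-w|^2$ in the same way, so the two can be compared term by term. -/
theorem lerayPhase_re {γ : ℝ} (hγ : 1 < γ) (z w : ℂ) : (lerayPhase γ z w).re =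
    bregman γ ‖w‖ ‖z‖ + γ * ‖w‖ ^ (γ - 2) * (‖w‖ * ‖z‖ - (conj w * z).re) := by
  have h : (lerayPhase γ z w).re = (γ - 1) * ‖w‖ ^ γ - γ * ‖w‖ ^ (γ - 2) * (conj w * z).re +
      ‖z‖ ^ γ := by
    have : lerayPhase γ z w = (((γ - 1) * ‖w‖ ^ γ : ℝ) : ℂ) -
        ((γ * ‖w‖ ^ (γ - 2) : ℝ) : ℂ) * (conj w * z) + ((‖z‖ ^ γ : ℝ) : ℂ) := by
      rw [lerayPhase]; push_cast; ring
    rw [this, Complex.add_re, Complex.sub_re, Complex.re_ofReal_mul, Complex.ofReal_re,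
      Complex.ofReal_re]
  rw [h, bregman]
  rcases eq_or_ne w 0 with rfl | hw
  · simp [sub_ne_zero.2 hγ.ne']
  · have hw' : 0 < ‖w‖ := norm_pos_iff.2 hw
    have : ‖w‖ ^ (γ - 1) = ‖w‖ ^ (γ - 2) * ‖w‖ := by
      rw [show γ - 1 = γ - 2 + 1 by ring, Real.rpow_add_one hw'.ne']
    rw [this]
    ring

theorem norm_sub_sq_eq (z w : ℂ) :
    ‖z - w‖ ^ 2 = (‖w‖ - ‖z‖) ^ 2 + 2 * (‖w‖ * ‖z‖ - (conj w * z).re) := by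
  have h1 := Complex.sq_norm z
  have h2 := Complex.sq_norm w
  have h3 := Complex.sq_norm (z - w)
  rw [Complex.normSq_apply] at h1 h2 h3
  simp at h3 ⊢
  nlinarith

theorem re_conj_mul_le (z w : ℂ) : (conj w * z).re ≤ ‖w‖ * ‖z‖ := by
  refine (Complex.re_le_norm _).trans (le_of_eq ?_)
  rw [norm_mul, RCLike.norm_conj]

/-- Lower bounds on a function `D` by which `w ↦ exp (-ξ D w)` decays away from `z`. -/
structure PhaseBound (γ c : ℝ) (z : ℂ) (D : ℂ → ℝ) : Prop where
  inner : ∀ w, ‖w‖ ≤ ‖z‖ / 2 → c * ‖z‖ ^ γ ≤ D w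
  outer : ∀ w, 2 * ‖z‖ ≤ ‖w‖ → c * ‖w‖ ^ γ ≤ D w
  near : ∀ w, ‖z‖ / 2 ≤ ‖w‖ → ‖w‖ ≤ 2 * ‖z‖ → c * (‖z‖ ^ (γ - 2) * ‖z - w‖ ^ 2) ≤ D w

section

variable {γ : ℝ} (hγ : 1 < γ)
include hγ

theorem bregman_le_lerayPhase_re (z w : ℂ) : bregman γ ‖w‖ ‖z‖ ≤ (lerayPhase γ z w).re := by
  rw [lerayPhase_re hγ]
  have h1 := re_conj_mul_le z w
  have h2 : 0 ≤ γ * ‖w‖ ^ (γ - 2) * (‖w‖ * ‖z‖ - (conj w * z).re) :=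
    mul_nonneg (by positivity) (by linarith)
  linarith

theorem lerayPhase_re_nonneg (z w : ℂ) : 0 ≤ (lerayPhase γ z w).re :=
  (bregman_nonneg hγ (norm_nonneg _) (norm_nonneg _)).trans (bregman_le_lerayPhase_re hγ z w)

/-- The phase is not symmetric, and the two integrals of Schur's test run over different arguments,
so the bounds are needed in both. -/
theorem exists_phaseBound : ∃ c > 0, ∀ z, PhaseBound γ c z (fun w => (lerayPhase γ z w).re) ∧
    PhaseBound γ c z (fun w => (lerayPhase γ w z).re) := by
  obtain ⟨c₀, hc₀, h⟩ := exists_bregman_lower hγ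
  -- The angular term has coefficient $2$ in $|z-w|^2$ and $\gamma$ in the phase, whence $\gamma/2$.
  set c := min c₀ (γ / 2) with hc
  have hcpos : 0 < c := by positivity
  have hnear : ∀ z w : ℂ, ‖w‖ / 2 ≤ ‖z‖ → ‖z‖ ≤ 2 * ‖w‖ →
      c * (‖w‖ ^ (γ - 2) * ‖z - w‖ ^ 2) ≤ (lerayPhase γ z w).re := fun z w h1 h2 => by
    rw [lerayPhase_re hγ, norm_sub_sq_eq]
    have h3 := (h ‖w‖ ‖z‖ (norm_nonneg _) (norm_nonneg _)).2.2 h1 h2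
    have h4 := re_conj_mul_le z w
    have h5 : 0 ≤ ‖w‖ ^ (γ - 2) * (‖w‖ - ‖z‖) ^ 2 := by positivity
    have h6 : 0 ≤ ‖w‖ ^ (γ - 2) * (‖w‖ * ‖z‖ - (conj w * z).re) :=
      mul_nonneg (by positivity) (by linarith)
    have h7 := mul_le_mul_of_nonneg_right (min_le_left c₀ (γ / 2)) h5
    have h8 := mul_le_mul_of_nonneg_right (min_le_right c₀ (γ / 2)) h6
    rw [← hc] at h7 h8
    nlinarith
  -- The cost of replacing $|w|^{\gamma-2}$ by $|z|^{\gamma-2}$ when the moduli differ by a factor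
  -- of at most $2$.
  set d := (2 : ℝ) ^ (-|γ - 2|) with hd
  have hd0 : 0 < d := by positivity
  have hd1 : d ≤ 1 := Real.rpow_le_one_of_one_le_of_nonpos (by norm_num) (by simp)
  have hcd : c * d ≤ c := by nlinarith
  have hcc₀ : c * d ≤ c₀ := hcd.trans (min_le_left _ _)
  refine ⟨c * d, by positivity, fun z => ⟨⟨fun w hw => ?_, fun w hw => ?_, fun w h1 h2 => ?_⟩,
    ⟨fun w hw => ?_, fun w hw => ?_, fun w h1 h2 => ?_⟩⟩⟩
  · refine le_trans ?_ (((h ‖w‖ ‖z‖ (norm_nonneg _) (norm_nonneg _)).1 hw).trans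
      (bregman_le_lerayPhase_re hγ z w))
    gcongr
  · refine le_trans ?_ (((h ‖w‖ ‖z‖ (norm_nonneg _) (norm_nonneg _)).2.1 (by linarith)).trans
      (bregman_le_lerayPhase_re hγ z w))
    gcongr
  · rcases (norm_nonneg z).eq_or_lt with hz | hz
    · have hz' : z = 0 := norm_eq_zero.1 hz.symm
      have hw : w = 0 := norm_eq_zero.1 (le_antisymm (by linarith) (norm_nonneg w))
      simpa [hw, hz'] using lerayPhase_re_nonneg hγ 0 0
    · refine le_trans ?_ (hnear z w (by linarith) (by linarith))
      rw [mul_assoc, ← mul_assoc d]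
      gcongr
      have h3 := rpow_le_two_rpow_abs_mul hz (by linarith : 0 < ‖w‖) (by linarith) h2 (γ - 2)
      calc d * ‖z‖ ^ (γ - 2) ≤ d * (2 ^ |γ - 2| * ‖w‖ ^ (γ - 2)) := by gcongr
        _ = _ := by
          rw [← mul_assoc, hd, ← Real.rpow_add (by norm_num)]
          simp
  · refine le_trans ?_ (((h ‖z‖ ‖w‖ (norm_nonneg _) (norm_nonneg _)).2.1 hw).trans
      (bregman_le_lerayPhase_re hγ w z))
    gcongr
  · refine le_trans ?_ (((h ‖z‖ ‖w‖ (norm_nonneg _) (norm_nonneg _)).1 (by linarith)).trans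
      (bregman_le_lerayPhase_re hγ w z))
    gcongr
  · refine le_trans ?_ (hnear w z h1 h2)
    rw [norm_sub_rev w z]
    gcongr

end

/-! ### Integral estimates and Schur's test -/

theorem lintegral_exp_phase_le {γ c a : ℝ} (hγ : 1 < γ) (hc : 0 < c) (ha : -γ < a) (ha0 : a ≤ 0) :
    ∃ K : ℝ≥0, ∀ (z : ℂ) (D : ℂ → ℝ), z ≠ 0 → PhaseBound γ c z D → ∀ ξ > 0,
      ∫⁻ w, ENNReal.ofReal (ξ * ‖w‖ ^ (γ - 2 + a) * Real.exp (-(ξ * D w))) ≤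
        K * ENNReal.ofReal (‖z‖ ^ a) := by
  set q : ℝ := γ - 2 + a with hq
  have hq2 : -2 < q := by linarith
  set K₁ : ℝ := Real.exp 1 / c * ((2 * Real.pi / γ) * Real.Gamma ((q + 2) / γ)) with hK₁
  set K₂ : ℝ := 2 ^ |q| * (Real.pi / c) with hK₂
  set K₃ : ℝ := 2 * Real.pi / γ / c with hK₃
  have hΓ : 0 < Real.Gamma ((q + 2) / γ) := Real.Gamma_pos_of_pos (div_pos (by linarith) (by linarith))
  have hK₁0 : 0 ≤ K₁ := by positivity
  have hK₂0 : 0 ≤ K₂ := by positivity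
  have hK₃0 : 0 ≤ K₃ := by positivity
  refine ⟨Real.toNNReal (K₁ + K₂ + K₃), fun z D hz hD ξ hξ => ?_⟩
  set R := ‖z‖ with hR
  have hR0 : 0 < R := norm_pos_iff.2 hz
  have hRγ : 0 < R ^ (-γ) := Real.rpow_pos_of_pos hR0 _
  have hRγ2 : 0 < R ^ (γ - 2) := Real.rpow_pos_of_pos hR0 _
  -- Majorants for $|w|\le R/2$, for $|w|$ comparable to $R$, and for $|w|\ge2R$ respectively. Each
  -- is kept on the whole plane, where its integral is an explicit Gamma value: a constant times
  -- $R^a$, with no dependence on $\xi$.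
  set F₁ : ℂ → ℝ := fun w => Real.exp 1 / c * R ^ (-γ) *
    (‖w‖ ^ q * Real.exp (-(R ^ (-γ)) * ‖w‖ ^ γ)) with hF₁
  set F₂ : ℂ → ℝ := fun w => 2 ^ |q| * R ^ q * ξ *
    (‖w - z‖ ^ (0 : ℝ) * Real.exp (-(ξ * c * R ^ (γ - 2)) * ‖w - z‖ ^ (2 : ℝ))) with hF₂
  set F₃ : ℂ → ℝ := fun w => R ^ a * ξ *
    (‖w‖ ^ (γ - 2) * Real.exp (-(ξ * c) * ‖w‖ ^ γ)) with hF₃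
  have hF₁0 : ∀ w, 0 ≤ F₁ w := fun w => by positivity
  have hF₂0 : ∀ w, 0 ≤ F₂ w := fun w => by positivity
  have hF₃0 : ∀ w, 0 ≤ F₃ w := fun w => by positivity
  have hpt : ∀ w, ξ * ‖w‖ ^ q * Real.exp (-(ξ * D w)) ≤ F₁ w + F₂ w + F₃ w := fun w => by
    rcases le_total ‖w‖ (R / 2) with h1 | h1
    · refine le_trans ?_ (by linarith [hF₂0 w, hF₃0 w] : F₁ w ≤ _)
      have h2 : ξ * Real.exp (-(ξ * D w)) ≤ 1 / c * R ^ (-γ) := by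
        have h3 := hD.inner w h1
        have h4 : 0 < c * R ^ γ := mul_pos hc (Real.rpow_pos_of_pos hR0 _)
        have h5 : Real.exp (-(ξ * D w)) ≤ Real.exp (-(ξ * (c * R ^ γ))) := by gcongr
        have h6 : ξ * (c * R ^ γ) ≤ Real.exp (ξ * (c * R ^ γ)) := by
          linarith [Real.add_one_le_exp (ξ * (c * R ^ γ))]
        have h7 : 1 / c * R ^ (-γ) = 1 / (c * R ^ γ) := by
          rw [Real.rpow_neg hR0.le]; field_simp
        rw [h7, le_div_iff₀ h4]
        calc _ = ξ * (c * R ^ γ) * Real.exp (-(ξ * D w)) := by ring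
          _ ≤ Real.exp (ξ * (c * R ^ γ)) * Real.exp (-(ξ * (c * R ^ γ))) := by gcongr
          _ = 1 := by rw [← Real.exp_add]; simp
      -- The factor $e\cdot e^{-(|w|/R)^\gamma}$ replaces the indicator of the disc, so the same
      -- radial formula serves.
      have h8 : 1 ≤ Real.exp 1 * Real.exp (-(R ^ (-γ)) * ‖w‖ ^ γ) := by
        rw [← Real.exp_add, Real.one_le_exp_iff]
        have : R ^ (-γ) * ‖w‖ ^ γ ≤ R ^ (-γ) * R ^ γ := by
          gcongr
          linarith
        rw [← Real.rpow_add hR0, neg_add_cancel, Real.rpow_zero] at this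
        linarith
      calc _ = (ξ * Real.exp (-(ξ * D w))) * ‖w‖ ^ q * 1 := by ring
        _ ≤ (1 / c * R ^ (-γ)) * ‖w‖ ^ q * (Real.exp 1 * Real.exp (-(R ^ (-γ)) * ‖w‖ ^ γ)) := by
            gcongr
        _ = F₁ w := by rw [hF₁]; ring
    · rcases le_total (2 * R) ‖w‖ with h2 | h2
      · refine le_trans ?_ (by linarith [hF₁0 w, hF₂0 w] : F₃ w ≤ _)
        have hw : 0 < ‖w‖ := by linarith
        have h3 : ‖w‖ ^ q = ‖w‖ ^ (γ - 2) * ‖w‖ ^ a := by rw [hq, Real.rpow_add hw]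
        have h4 : ‖w‖ ^ a ≤ R ^ a := Real.rpow_le_rpow_of_nonpos hR0 (by linarith) ha0
        have h5 := hD.outer w h2
        calc _ ≤ ξ * (‖w‖ ^ (γ - 2) * R ^ a) * Real.exp (-(ξ * (c * ‖w‖ ^ γ))) := by
              rw [h3]; gcongr
          _ = F₃ w := by
              rw [hF₃]
              simp only
              rw [show -(ξ * (c * ‖w‖ ^ γ)) = -(ξ * c) * ‖w‖ ^ γ by ring]
              ring
      · refine le_trans ?_ (by linarith [hF₁0 w, hF₃0 w] : F₂ w ≤ _)
        have hw : 0 < ‖w‖ := by linarith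
        have h3 := rpow_le_two_rpow_abs_mul hw hR0 h2 (by linarith) q
        have h4 := hD.near w h1 h2
        calc _ ≤ ξ * (2 ^ |q| * R ^ q) * Real.exp (-(ξ * (c * (R ^ (γ - 2) * ‖z - w‖ ^ 2)))) := by
              gcongr
          _ = F₂ w := by
              rw [hF₂]
              simp only
              rw [Real.rpow_zero, norm_sub_rev w z, Real.rpow_two,
                show -(ξ * (c * (R ^ (γ - 2) * ‖z - w‖ ^ 2))) =
                  -(ξ * c * R ^ (γ - 2)) * ‖z - w‖ ^ 2 by ring]
              ring
  have hI₁ : ∫⁻ w, ENNReal.ofReal (F₁ w) = ENNReal.ofReal (K₁ * R ^ a) := by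
    simp only [hF₁]
    simp_rw [ENNReal.ofReal_mul (by positivity : 0 ≤ Real.exp 1 / c * R ^ (-γ))]
    rw [lintegral_const_mul' _ _ ENNReal.ofReal_ne_top,
      lintegral_rpow_mul_exp_neg_mul_rpow hγ.le hq2 hRγ, ← ENNReal.ofReal_mul (by positivity)]
    congr 1
    have h1 : (R ^ (-γ)) ^ (-(q + 2) / γ) = R ^ (q + 2) := by
      rw [← Real.rpow_mul hR0.le]
      congr 1
      field_simp
    have h2 : R ^ (-γ) * R ^ (q + 2) = R ^ a := by
      rw [← Real.rpow_add hR0]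
      congr 1
      rw [hq]; ring
    rw [h1, hK₁, ← h2]
    ring
  have hI₂ : ∫⁻ w, ENNReal.ofReal (F₂ w) = ENNReal.ofReal (K₂ * R ^ a) := by
    simp only [hF₂]
    simp_rw [ENNReal.ofReal_mul (by positivity : 0 ≤ 2 ^ |q| * R ^ q * ξ)]
    rw [lintegral_const_mul' _ _ ENNReal.ofReal_ne_top,
      lintegral_sub_right_eq_self (μ := volume) (fun w : ℂ => ENNReal.ofReal (‖w‖ ^ (0 : ℝ) *
        Real.exp (-(ξ * c * R ^ (γ - 2)) * ‖w‖ ^ (2 : ℝ)))) z,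
      lintegral_rpow_mul_exp_neg_mul_rpow one_le_two (by norm_num) (by positivity),
      ← ENNReal.ofReal_mul (by positivity)]
    congr 1
    have h1 : R ^ q = R ^ (γ - 2) * R ^ a := by rw [hq, Real.rpow_add hR0]
    norm_num
    rw [Real.rpow_neg_one, h1, hK₂]
    field_simp
  have hI₃ : ∫⁻ w, ENNReal.ofReal (F₃ w) = ENNReal.ofReal (K₃ * R ^ a) := by
    simp only [hF₃]
    simp_rw [ENNReal.ofReal_mul (by positivity : 0 ≤ R ^ a * ξ)]
    rw [lintegral_const_mul' _ _ ENNReal.ofReal_ne_top,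
      lintegral_rpow_mul_exp_neg_mul_rpow hγ.le (by linarith) (by positivity),
      ← ENNReal.ofReal_mul (by positivity)]
    congr 1
    have hγ0 : γ ≠ 0 := by linarith
    rw [sub_add_cancel, neg_div, div_self hγ0, Real.Gamma_one, Real.rpow_neg_one, hK₃]
    field_simp
  calc _ ≤ ∫⁻ w, (ENNReal.ofReal (F₁ w) + ENNReal.ofReal (F₂ w) + ENNReal.ofReal (F₃ w)) := by
        refine lintegral_mono fun w => ?_
        rw [← ENNReal.ofReal_add (hF₁0 w) (hF₂0 w),
          ← ENNReal.ofReal_add (add_nonneg (hF₁0 w) (hF₂0 w)) (hF₃0 w)]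
        exact ENNReal.ofReal_le_ofReal (hpt w)
    _ = ENNReal.ofReal (K₁ * R ^ a) + ENNReal.ofReal (K₂ * R ^ a) + ENNReal.ofReal (K₃ * R ^ a) := by
        rw [lintegral_add_left (by fun_prop), lintegral_add_left (by fun_prop), hI₁, hI₂, hI₃]
    _ = _ := by
        have : 0 < R ^ a := Real.rpow_pos_of_pos hR0 a
        rw [← ENNReal.ofReal_add (by positivity) (by positivity),
          ← ENNReal.ofReal_add (by positivity) (by positivity), ← ENNReal.ofReal,
          ← ENNReal.ofReal_mul (by positivity)]
        congr 1
        ring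

/-- $D+\varepsilon$ dominates a multiple of $\max(1,|w|^\gamma)$. In the plane, $|w|^q$ is
integrable at $0$ for $q>-2$, and $|w|^{q-2\gamma}$ at infinity for $q<2\gamma-2$. -/
theorem lintegral_rpow_div_phase_sq_lt_top {γ c q : ℝ} (hγ : 1 < γ) (hc : 0 < c) (hq : -2 < q)
    (hq2 : q < 2 * γ - 2) {z : ℂ} {D : ℂ → ℝ} (hD : PhaseBound γ c z D) (hD0 : ∀ w, 0 ≤ D w)
    {ε : ℝ} (hε : 0 < ε) :
    ∫⁻ w, ENNReal.ofReal (‖w‖ ^ q / (D w + ε) ^ 2) < ⊤ := by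
  set R := ‖z‖
  -- The three entries serve $|w|\ge2R$, the constant bound $1$, and $|w|\le2R$; using $2R+1$ keeps
  -- the base positive when $z=0$.
  set m : ℝ := min c (min ε (ε / (2 * R + 1) ^ γ)) with hm
  have hR : 0 < 2 * R + 1 := by positivity
  have hm0 : 0 < m := by
    have : 0 < (2 * R + 1) ^ γ := Real.rpow_pos_of_pos hR _
    positivity
  have hlow : ∀ w, m * max 1 (‖w‖ ^ γ) ≤ D w + ε := fun w => by
    rw [mul_max_of_nonneg _ _ hm0.le, mul_one]
    refine max_le ?_ ?_
    · have : m ≤ ε := (min_le_right _ _).trans (min_le_left _ _)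
      linarith [hD0 w]
    · rcases le_total (2 * R) ‖w‖ with h | h
      · have h1 := hD.outer w h
        have h2 : m * ‖w‖ ^ γ ≤ c * ‖w‖ ^ γ := by
          gcongr
          exact min_le_left _ _
        linarith
      · have h1 : m * ‖w‖ ^ γ ≤ ε / (2 * R + 1) ^ γ * (2 * R + 1) ^ γ := by
          gcongr
          · exact (min_le_right _ _).trans (min_le_right _ _)
          · linarith
        rw [div_mul_cancel₀ _ (Real.rpow_pos_of_pos hR _).ne'] at h1
        linarith [hD0 w]
  have hint : Integrable (fun w : ℂ => ‖w‖ ^ q / (max 1 (‖w‖ ^ γ)) ^ 2) := by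
    rw [integrable_fun_norm_addHaar (μ := (volume : Measure ℂ))
      (f := fun y : ℝ => y ^ q / (max 1 (y ^ γ)) ^ 2), Complex.finrank_real_complex]
    have hsplit : Ioi (0 : ℝ) = Ioc 0 1 ∪ Ioi 1 := (Ioc_union_Ioi_eq_Ioi zero_le_one).symm
    rw [hsplit]
    refine IntegrableOn.union ?_ ?_
    · have h1 : IntegrableOn (fun y : ℝ => y ^ (q + 1)) (Ioc 0 1) := by
        rw [← intervalIntegrable_iff_integrableOn_Ioc_of_le zero_le_one]
        exact intervalIntegral.intervalIntegrable_rpow' (by linarith)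
      refine h1.congr_fun (fun y hy => ?_) measurableSet_Ioc
      have h2 : y ^ γ ≤ 1 := Real.rpow_le_one hy.1.le hy.2 (by linarith)
      simp only
      rw [max_eq_left h2, Real.rpow_add_one hy.1.ne']
      simp [mul_comm]
    · have h1 : IntegrableOn (fun y : ℝ => y ^ (q + 1 - 2 * γ)) (Ioi 1) :=
        integrableOn_Ioi_rpow_of_lt (by linarith) one_pos
      refine h1.congr_fun (fun y hy => ?_) measurableSet_Ioi
      have hy0 : 0 < y := one_pos.trans hy
      have h2 : 1 ≤ y ^ γ := Real.one_le_rpow (le_of_lt hy) (by linarith)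
      simp only
      rw [max_eq_right h2, Real.rpow_sub hy0, Real.rpow_add_one hy0.ne', mul_comm 2 γ,
        Real.rpow_mul hy0.le, Real.rpow_two]
      simp
      ring
  refine lt_of_le_of_lt (lintegral_mono fun w => ENNReal.ofReal_le_ofReal ?_)
    (hint.const_mul (m ^ 2)⁻¹).lintegral_lt_top
  have h1 : 0 < m * max 1 (‖w‖ ^ γ) := mul_pos hm0 (lt_of_lt_of_le one_pos (le_max_left _ _))
  calc ‖w‖ ^ q / (D w + ε) ^ 2 ≤ ‖w‖ ^ q / (m * max 1 (‖w‖ ^ γ)) ^ 2 := by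
        gcongr
        exact hlow w
    _ = _ := by rw [mul_pow]; field_simp

/-- Schur's test with a single weight. -/
theorem schur_test {X : Type*} [MeasurableSpace X] {ρ : Measure X} [SFinite ρ]
    {κ : X → X → ℝ≥0∞} (hκ : Measurable (Function.uncurry κ)) {p : X → ℝ≥0∞} (hp : Measurable p)
    (hp0 : ∀ᵐ x ∂ρ, p x ≠ 0) (hpt : ∀ x, p x ≠ ⊤) {K₁ K₂ : ℝ≥0∞} (hK₁ : K₁ ≠ ⊤)
    (h₁ : ∀ᵐ x ∂ρ, ∫⁻ y, κ x y * p y ∂ρ ≤ K₁ * p x)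
    (h₂ : ∀ᵐ y ∂ρ, ∫⁻ x, κ x y * p x ∂ρ ≤ K₂ * p y) {u : X → ℝ≥0∞} (hu : Measurable u) :
    ∫⁻ x, (∫⁻ y, κ x y * u y ∂ρ) ^ 2 ∂ρ ≤ K₁ * K₂ * ∫⁻ y, u y ^ 2 ∂ρ := by
  have hκx : ∀ x, Measurable (κ x) := fun x => hκ.comp measurable_prodMk_left
  have hκy : ∀ y, Measurable fun x => κ x y := fun y => hκ.comp measurable_prodMk_right
  have hhalf : ∀ a : ℝ≥0∞, (a ^ (1 / 2 : ℝ)) ^ 2 = a := fun a => by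
    rw [← ENNReal.rpow_mul_natCast]; norm_num
  have hstep : ∀ᵐ x ∂ρ, (∫⁻ y, κ x y * u y ∂ρ) ^ 2 ≤
      K₁ * ∫⁻ y, κ x y * p x * (u y ^ 2 * (p y)⁻¹) ∂ρ := by
    filter_upwards [h₁] with x hx
    have hcs := lintegral_mul_sq_le (ν := ρ) (f := fun y => (κ x y * p y) ^ (1 / 2 : ℝ))
      (g := fun y => (κ x y * (u y ^ 2 * (p y)⁻¹)) ^ (1 / 2 : ℝ))
      (((hκx x).mul hp).pow_const _).aemeasurable
      (by have := hκx x; fun_prop)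
    simp only [hhalf] at hcs
    -- Cauchy–Schwarz after writing $\kappa u=(\kappa p)^{1/2}(\kappa u^2/p)^{1/2}$.
    calc (∫⁻ y, κ x y * u y ∂ρ) ^ 2 = (∫⁻ y, (κ x y * p y) ^ (1 / 2 : ℝ) *
          (κ x y * (u y ^ 2 * (p y)⁻¹)) ^ (1 / 2 : ℝ) ∂ρ) ^ 2 := by
          congr 1
          refine lintegral_congr_ae ?_
          filter_upwards [hp0] with y hy
          rw [← ENNReal.mul_rpow_of_nonneg _ _ (by norm_num)]
          have : κ x y * p y * (κ x y * (u y ^ 2 * (p y)⁻¹)) = (κ x y * u y) ^ 2 := by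
            calc _ = (κ x y * u y) ^ 2 * (p y * (p y)⁻¹) := by ring
              _ = _ := by rw [ENNReal.mul_inv_cancel hy (hpt y), mul_one]
          rw [this, ← ENNReal.rpow_natCast, ← ENNReal.rpow_mul]
          norm_num
      _ ≤ _ := hcs
      _ ≤ (K₁ * p x) * ∫⁻ y, κ x y * (u y ^ 2 * (p y)⁻¹) ∂ρ := by gcongr
      _ = _ := by
          rw [mul_assoc, ← lintegral_const_mul' _ _ (hpt x)]
          congr 1
          refine lintegral_congr fun y => ?_
          ring
  calc _ ≤ ∫⁻ x, K₁ * ∫⁻ y, κ x y * p x * (u y ^ 2 * (p y)⁻¹) ∂ρ ∂ρ := lintegral_mono_ae hstep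
    _ = K₁ * ∫⁻ y, ∫⁻ x, κ x y * p x * (u y ^ 2 * (p y)⁻¹) ∂ρ ∂ρ := by
        rw [lintegral_const_mul' _ _ hK₁, lintegral_lintegral_swap]
        exact ((hκ.mul (hp.comp measurable_fst)).mul
          (((hu.comp measurable_snd).pow_const 2).mul (hp.comp measurable_snd).inv)).aemeasurable
    _ ≤ K₁ * ∫⁻ y, K₂ * u y ^ 2 ∂ρ := by
        refine mul_le_mul_right (lintegral_mono_ae ?_) _
        filter_upwards [h₂, hp0] with y hy hy0
        have := hκy y
        rw [lintegral_mul_const _ (by fun_prop)]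
        calc _ ≤ K₂ * p y * (u y ^ 2 * (p y)⁻¹) := by gcongr
          _ = K₂ * u y ^ 2 * (p y * (p y)⁻¹) := by ring
          _ = _ := by rw [ENNReal.mul_inv_cancel hy0 (hpt y), mul_one]
    _ = _ := by rw [lintegral_const_mul _ (hu.pow_const 2), mul_assoc]

/-! ### Schur bounds for the Leray kernel -/

/-- The measure `|w| ^ (r - 1) dw` on `ℂ`. -/
noncomputable def radialMeasure (r : ℝ) : Measure ℂ :=
  volume.withDensity fun w => ENNReal.ofReal (‖w‖ ^ (r - 1))

instance (r : ℝ) : SigmaFinite (radialMeasure r) := by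
  unfold radialMeasure
  exact SigmaFinite.withDensity_ofReal _

theorem lintegral_radialMeasure (r : ℝ) {f : ℂ → ℝ≥0∞} (hf : Measurable f) :
    ∫⁻ w, f w ∂(radialMeasure r) = ∫⁻ w, ENNReal.ofReal (‖w‖ ^ (r - 1)) * f w := by
  rw [radialMeasure, lintegral_withDensity_eq_lintegral_mul _ (by fun_prop) hf]
  rfl

theorem ae_ne_zero_complex : ∀ᵐ w : ℂ, w ≠ 0 := Measure.ae_ne volume 0

theorem ae_ne_zero_radialMeasure (r : ℝ) : ∀ᵐ w ∂(radialMeasure r), w ≠ 0 :=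
  (withDensity_absolutelyContinuous _ _).ae_le ae_ne_zero_complex

theorem measurable_lerayPhase (γ : ℝ) : Measurable (Function.uncurry (lerayPhase γ)) := by
  unfold lerayPhase Function.uncurry
  fun_prop

theorem measurable_lerayPhase_left (γ : ℝ) (z : ℂ) : Measurable (fun w => lerayPhase γ w z) := by
  unfold lerayPhase
  fun_prop

theorem measurable_lerayPhase_right (γ : ℝ) (z : ℂ) : Measurable (lerayPhase γ z) := by
  unfold lerayPhase
  fun_prop

theorem lintegral_weight_div_phase_sq_lt_top {γ c r s κ : ℝ} (hγ : 1 < γ) (hc : 0 < c)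
    (h1 : -2 < r - 1 + 2 * s) (h2 : r - 1 + 2 * s < 2 * γ - 2) {z : ℂ} {D : ℂ → ℝ}
    (hDm : Measurable D) (hD : PhaseBound γ c z D) (hD0 : ∀ w, 0 ≤ D w) {ε : ℝ} (hε : 0 < ε) :
    ∫⁻ w, ENNReal.ofReal ((κ * ‖w‖ ^ s / (D w + ε)) ^ 2) ∂(radialMeasure r) < ⊤ := by
  rw [lintegral_radialMeasure r (by fun_prop)]
  have := lintegral_rpow_div_phase_sq_lt_top hγ hc h1 h2 hD hD0 hε
  refine lt_of_le_of_lt (le_of_eq ?_)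
    (ENNReal.mul_lt_top (ENNReal.ofReal_lt_top (r := κ ^ 2)) this)
  rw [← lintegral_const_mul' _ _ ENNReal.ofReal_ne_top]
  refine lintegral_congr_ae ?_
  filter_upwards [ae_ne_zero_complex] with w hw
  have hw' : 0 < ‖w‖ := norm_pos_iff.2 hw
  rw [← ENNReal.ofReal_mul (by positivity), ← ENNReal.ofReal_mul (by positivity)]
  congr 1
  rw [Real.rpow_add hw', mul_comm 2 s, Real.rpow_mul hw'.le, Real.rpow_two]
  have := hD0 w
  field_simp

/-- The two estimates in Schur's test for the Leray kernel at frequency `ξ`. -/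
theorem exists_schur_bounds {γ r : ℝ} (hγ : 1 < γ) (hr : r ∈ Ioo (-1 : ℝ) (2 * γ - 1)) {κ : ℝ}
    (hκ : 0 ≤ κ) :
    ∃ (τ : ℝ) (K₁ K₂ : ℝ≥0), ∀ ξ > 0,
      (∀ᵐ z ∂(radialMeasure r), ∫⁻ w, ENNReal.ofReal (ξ * (κ * ‖w‖ ^ (γ - 1 - r)) *
        Real.exp (-(ξ * (lerayPhase γ z w).re))) * ENNReal.ofReal (‖w‖ ^ (-τ)) ∂(radialMeasure r) ≤
        K₁ * ENNReal.ofReal (‖z‖ ^ (-τ))) ∧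
      (∀ᵐ w ∂(radialMeasure r), ∫⁻ z, ENNReal.ofReal (ξ * (κ * ‖w‖ ^ (γ - 1 - r)) *
        Real.exp (-(ξ * (lerayPhase γ z w).re))) * ENNReal.ofReal (‖z‖ ^ (-τ)) ∂(radialMeasure r) ≤
        K₂ * ENNReal.ofReal (‖w‖ ^ (-τ))) := by
  obtain ⟨c, hc, hphase⟩ := exists_phaseBound hγ
  obtain ⟨hr1, hr2⟩ := hr
  -- The exponents $-\tau$ and $r+1-\gamma-\tau$ of the two test integrals must lie in
  -- $(-\gamma,0]$, that is, $\max(0,r+1-\gamma)\le\tau<\min(\gamma,r+1)$. This range is nonempty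
  -- exactly when $-1<r<2\gamma-1$; the smallest value is taken.
  set τ : ℝ := max 0 (r + 1 - γ) with hτ
  have hτ0 : 0 ≤ τ := le_max_left _ _
  have hτ1 : r + 1 - γ ≤ τ := le_max_right _ _
  have hτ2 : τ < γ := max_lt (by linarith) (by linarith)
  have hτ3 : τ < r + 1 := max_lt (by linarith) (by linarith)
  obtain ⟨K₁, hK₁⟩ := lintegral_exp_phase_le (a := -τ) hγ hc (by linarith) (by linarith)
  obtain ⟨K₂, hK₂⟩ := lintegral_exp_phase_le (a := r + 1 - γ - τ) hγ hc (by linarith) (by linarith)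
  refine ⟨τ, Real.toNNReal κ * K₁, Real.toNNReal κ * K₂, fun ξ hξ => ⟨?_, ?_⟩⟩
  · filter_upwards [ae_ne_zero_radialMeasure r] with z hz
    have hm := measurable_lerayPhase_right γ z
    rw [lintegral_radialMeasure r (by fun_prop)]
    have hb := hK₁ z _ hz (hphase z).1 ξ hξ
    calc _ = ENNReal.ofReal κ * ∫⁻ w, ENNReal.ofReal (ξ * ‖w‖ ^ (γ - 2 + -τ) *
          Real.exp (-(ξ * (lerayPhase γ z w).re))) := by
          rw [← lintegral_const_mul' _ _ ENNReal.ofReal_ne_top]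
          refine lintegral_congr_ae ?_
          filter_upwards [ae_ne_zero_complex] with w hw
          have hw' : 0 < ‖w‖ := norm_pos_iff.2 hw
          rw [← ENNReal.ofReal_mul (by positivity), ← ENNReal.ofReal_mul (by positivity),
            ← ENNReal.ofReal_mul hκ]
          congr 1
          have : ‖w‖ ^ (γ - 2 + -τ) = ‖w‖ ^ (r - 1) * ‖w‖ ^ (γ - 1 - r) * ‖w‖ ^ (-τ) := by
            rw [← Real.rpow_add hw', ← Real.rpow_add hw']
            congr 1
            ring
          rw [this]
          ring
      _ ≤ ENNReal.ofReal κ * (K₁ * ENNReal.ofReal (‖z‖ ^ (-τ))) := by gcongr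
      _ = _ := by rw [ENNReal.coe_mul, mul_assoc]; rfl
  · filter_upwards [ae_ne_zero_radialMeasure r] with w hw
    have hm := measurable_lerayPhase_left γ w
    rw [lintegral_radialMeasure r (by fun_prop)]
    have hb := hK₂ w _ hw (hphase w).2 ξ hξ
    have hw' : 0 < ‖w‖ := norm_pos_iff.2 hw
    calc _ = ENNReal.ofReal (κ * ‖w‖ ^ (γ - 1 - r)) * ∫⁻ z, ENNReal.ofReal (ξ *
          ‖z‖ ^ (γ - 2 + (r + 1 - γ - τ)) * Real.exp (-(ξ * (lerayPhase γ z w).re))) := by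
          rw [← lintegral_const_mul' _ _ ENNReal.ofReal_ne_top]
          refine lintegral_congr_ae ?_
          filter_upwards [ae_ne_zero_complex] with z hz
          have hz' : 0 < ‖z‖ := norm_pos_iff.2 hz
          rw [← ENNReal.ofReal_mul (by positivity), ← ENNReal.ofReal_mul (by positivity),
            ← ENNReal.ofReal_mul (by positivity)]
          congr 1
          have : ‖z‖ ^ (γ - 2 + (r + 1 - γ - τ)) = ‖z‖ ^ (r - 1) * ‖z‖ ^ (-τ) := by
            rw [← Real.rpow_add hz']
            congr 1
            ring
          rw [this]
          ring
      _ ≤ ENNReal.ofReal (κ * ‖w‖ ^ (γ - 1 - r)) *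
          (K₂ * ENNReal.ofReal (‖w‖ ^ (r + 1 - γ - τ))) := by gcongr
      _ = ENNReal.ofReal κ * K₂ *
          ENNReal.ofReal (‖w‖ ^ (γ - 1 - r) * ‖w‖ ^ (r + 1 - γ - τ)) := by
          rw [ENNReal.ofReal_mul hκ, ENNReal.ofReal_mul (by positivity)]
          ring
      _ = _ := by
          rw [← Real.rpow_add hw', ENNReal.coe_mul]
          congr 4
          ring

/-- Passing to the conjugate transpose interchanges the two Schur estimates, so one constant serves
both kernels. Square integrability of the rows involves the exponents $2\gamma-3-r$ and $r-1$; each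
lies in $(-2,2\gamma-2)$ exactly when $-1<r<2\gamma-1$. -/
theorem exists_schurKernel_leray {γ r : ℝ} (hγ : 1 < γ) (hr : r ∈ Ioo (-1 : ℝ) (2 * γ - 1)) {κ : ℝ}
    (hκ : 0 ≤ κ) :
    ∃ C, SchurKernel (radialMeasure r) (fun _ w => κ * ‖w‖ ^ (γ - 1 - r)) (lerayPhase γ) C ∧
      SchurKernel (radialMeasure r) (fun z _ => κ * ‖z‖ ^ (γ - 1 - r))
        (fun z w => conj (lerayPhase γ w z)) C := by
  obtain ⟨c, hc, hphase⟩ := exists_phaseBound hγ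
  obtain ⟨τ, K₁, K₂, hK⟩ := exists_schur_bounds hγ hr hκ
  have hphm := measurable_lerayPhase γ
  have hphm' : Measurable (Function.uncurry fun z w => lerayPhase γ w z) := by
    unfold lerayPhase Function.uncurry
    fun_prop
  have hp : Measurable fun w : ℂ => ENNReal.ofReal (‖w‖ ^ (-τ)) := by fun_prop
  have hp0 : ∀ᵐ w ∂(radialMeasure r), ENNReal.ofReal (‖w‖ ^ (-τ)) ≠ 0 := by
    filter_upwards [ae_ne_zero_radialMeasure r] with w hw
    have := Real.rpow_pos_of_pos (norm_pos_iff.2 hw) (-τ)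
    simpa using this
  refine ⟨K₁ * K₂, ⟨?_, hphm, fun _ _ => by positivity, lerayPhase_re_nonneg hγ, fun z ε hε => ?_,
    fun η hη u hu => ?_⟩, ⟨?_, ?_, fun _ _ => by positivity, fun z w => ?_, fun z ε hε => ?_,
    fun η hη u hu => ?_⟩⟩
  · unfold Function.uncurry; fun_prop
  · have hm := measurable_lerayPhase_right γ z
    exact lintegral_weight_div_phase_sq_lt_top hγ hc (by linarith [hr.2]) (by linarith [hr.1])
      (by fun_prop) (hphase z).1 (fun w => lerayPhase_re_nonneg hγ z w) hε
  · rw [ENNReal.coe_mul]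
    refine schur_test ?_ hp hp0 (fun _ => ENNReal.ofReal_ne_top) ENNReal.coe_ne_top
      (hK η hη).1 (hK η hη).2 hu
    unfold Function.uncurry at hphm ⊢
    fun_prop
  · unfold Function.uncurry; fun_prop
  · exact Complex.continuous_conj.measurable.comp hphm'
  · simpa using lerayPhase_re_nonneg hγ w z
  · have hm := measurable_lerayPhase_left γ z
    simp only [Complex.conj_re]
    have := lintegral_weight_div_phase_sq_lt_top (κ := κ * ‖z‖ ^ (γ - 1 - r)) (s := 0) hγ hc
      (by linarith [hr.1]) (by linarith [hr.2] : r - 1 + 2 * 0 < 2 * γ - 2)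
      (by fun_prop) (hphase z).2 (fun w => lerayPhase_re_nonneg hγ w z) hε
    simpa using this
  · rw [ENNReal.coe_mul, mul_comm (K₁ : ℝ≥0∞)]
    simp only [Complex.conj_re]
    refine schur_test ?_ hp hp0 (fun _ => ENNReal.ofReal_ne_top) ENNReal.coe_ne_top
      (hK η hη).2 (hK η hη).1 hu
    unfold Function.uncurry at hphm' ⊢
    fun_prop

/-! ### Transfer between $M_\gamma$ and graph coordinates -/

/-- The graph parametrization as a measurable equivalence. -/
noncomputable def graphEquiv (γ : ℝ) : ℂ × ℝ ≃ᵐ M γ where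
  toFun := graphMap γ
  invFun ζ := (ζ.1.1, ζ.1.2.re)
  left_inv p := by simp [graphMap]
  right_inv ζ := by
    obtain ⟨⟨a, b⟩, h⟩ := ζ
    have h' : b.im = ‖a‖ ^ γ := h
    refine Subtype.ext (Prod.ext rfl ?_)
    apply Complex.ext <;> simp [graphMap, h']
  measurable_toFun := measurable_graphMap γ
  measurable_invFun := by
    show Measurable fun ζ : M γ => ((ζ.1.1, ζ.1.2.re) : ℂ × ℝ)
    fun_prop

theorem measurableEmbedding_graphMap (γ : ℝ) : MeasurableEmbedding (graphMap γ) :=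
  (graphEquiv γ).measurableEmbedding

theorem exists_graphMap_eq {γ : ℝ} (ζ : M γ) : ∃ p, graphMap γ p = ζ :=
  (graphEquiv γ).surjective ζ

/-- The measure `|w| ^ (r - 1) dw ds`, which is `μ γ r` in the graph parametrization. -/
noncomputable abbrev paramMeasure (r : ℝ) : Measure (ℂ × ℝ) := (radialMeasure r).prod volume

theorem paramMeasure_eq_withDensity (r : ℝ) :
    paramMeasure r = (volume : Measure (ℂ × ℝ)).withDensity
      fun q => ENNReal.ofReal (‖q.1‖ ^ (r - 1)) := by
  rw [paramMeasure, radialMeasure, prod_withDensity_left (by fun_prop)]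
  rfl

theorem map_graphMap_paramMeasure (γ r : ℝ) : (paramMeasure r).map (graphMap γ) = μ γ r := by
  ext s hs
  rw [Measure.map_apply (measurable_graphMap γ) hs, paramMeasure_eq_withDensity,
    withDensity_apply _ (measurable_graphMap γ hs), μ, withDensity_apply _ hs, surf,
    setLIntegral_map hs (by fun_prop) (measurable_graphMap γ)]
  rfl

theorem measurePreserving_graphMap (γ r : ℝ) :
    MeasurePreserving (graphMap γ) (paramMeasure r) (μ γ r) :=
  ⟨measurable_graphMap γ, map_graphMap_paramMeasure γ r⟩

theorem ae_fst_ne_zero : ∀ᵐ q : ℂ × ℝ, q.1 ≠ 0 :=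
  Measure.quasiMeasurePreserving_fst.ae ae_ne_zero_complex

theorem ae_surf_ne_zero (γ : ℝ) : ∀ᵐ ζ ∂(surf γ), ζ.1.1 ≠ 0 := by
  rw [surf, (measurableEmbedding_graphMap γ).ae_map_iff]
  exact ae_fst_ne_zero

/-- The density can vanish only where $\zeta_1=0$, a null set. Hence all the weights share their
null sets, and almost-everywhere statements pass freely between them. -/
theorem ae_mu_eq (γ r : ℝ) : ae (μ γ r) = ae (surf γ) := by
  refine le_antisymm (withDensity_absolutelyContinuous _ _).ae_le
    (withDensity_absolutelyContinuous' (by fun_prop) ?_).ae_le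
  filter_upwards [ae_surf_ne_zero γ] with ζ hζ
  have : 0 < ‖ζ.1.1‖ := norm_pos_iff.2 hζ
  have h : 0 < ‖ζ.1.1‖ ^ (r - 1) := by positivity
  simpa using h

section Transport

variable {γ r : ℝ} {G : M γ → ℂ} {F : ℂ × ℝ → ℂ}

theorem integrable_surf_iff
    (h : ∀ q : ℂ × ℝ, q.1 ≠ 0 → G (graphMap γ q) = (‖q.1‖ ^ (r - 1) : ℝ) * F q) :
    Integrable G (surf γ) ↔ Integrable F (paramMeasure r) := by
  rw [surf, (measurableEmbedding_graphMap γ).integrable_map_iff, paramMeasure_eq_withDensity,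
    integrable_withDensity_iff_integrable_smul' (by fun_prop) (by simp)]
  refine integrable_congr ?_
  filter_upwards [ae_fst_ne_zero] with q hq
  rw [Function.comp_apply, h q hq, ENNReal.toReal_ofReal (by positivity), Complex.real_smul]

theorem integral_surf_eq
    (h : ∀ q : ℂ × ℝ, q.1 ≠ 0 → G (graphMap γ q) = (‖q.1‖ ^ (r - 1) : ℝ) * F q) :
    ∫ ζ, G ζ ∂(surf γ) = ∫ q, F q ∂(paramMeasure r) := by
  rw [surf, (measurableEmbedding_graphMap γ).integral_map, paramMeasure_eq_withDensity,
    integral_withDensity_eq_integral_toReal_smul (by fun_prop) (by simp)]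
  refine integral_congr_ae ?_
  filter_upwards [ae_fst_ne_zero] with q hq
  rw [h q hq, ENNReal.toReal_ofReal (by positivity), Complex.real_smul]

end Transport

theorem conj_mul_rpow_mul_self {γ : ℝ} (hγ : 1 < γ) (w : ℂ) :
    conj w * ((‖w‖ ^ (γ - 2) : ℝ) : ℂ) * w = ((‖w‖ ^ γ : ℝ) : ℂ) := by
  have h : ‖w‖ ^ (γ - 2) * ‖w‖ ^ 2 = ‖w‖ ^ γ := by
    rcases eq_or_ne w 0 with rfl | hw
    · simp [Real.zero_rpow (by linarith : γ ≠ 0)]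
    · rw [← Real.rpow_two, ← Real.rpow_add (norm_pos_iff.2 hw)]
      congr 1
      ring
  rw [← h, mul_right_comm, Complex.conj_mul']
  push_cast
  ring

/-- The imaginary parts of $\zeta_2$ and $z_2$, multiplied by $i$, become the real contribution
$|z|^\gamma+\varepsilon-|w|^\gamma$, which combines with $\gamma|w|^\gamma$; the vertical lift thus
only adds $\varepsilon$ to the phase. -/
theorem leray_denom_eq {γ : ℝ} (hγ : 1 < γ) (ε : ℝ) (p q : ℂ × ℝ) :
    (γ : ℂ) * conj (graphMap γ q).1.1 * ((‖(graphMap γ q).1.1‖ ^ (γ - 2) : ℝ) : ℂ) *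
        ((graphMap γ q).1.1 - (lift ε (graphMap γ p).1).1) +
      Complex.I * ((graphMap γ q).1.2 - (lift ε (graphMap γ p).1).2) =
    lerayPhase γ p.1 q.1 + ε + Complex.I * (q.2 - p.2) := by
  have h := conj_mul_rpow_mul_self hγ q.1
  simp only [graphMap, lift, lerayPhase]
  linear_combination (γ : ℂ) * h +
    (((‖q.1‖ ^ γ : ℝ) : ℂ) - ((‖p.1‖ ^ γ : ℝ) : ℂ) - ε) * Complex.I_sq

theorem adjoint_denom_eq {γ : ℝ} (hγ : 1 < γ) (ε : ℝ) (p q : ℂ × ℝ) :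
    (γ : ℂ) * (graphMap γ p).1.1 * ((‖(graphMap γ p).1.1‖ ^ (γ - 2) : ℝ) : ℂ) *
        (conj (graphMap γ p).1.1 - conj (lift ε (graphMap γ q).1).1) -
      Complex.I * (conj (graphMap γ p).1.2 - conj (lift ε (graphMap γ q).1).2) =
    conj (lerayPhase γ q.1 p.1) + ε + Complex.I * (q.2 - p.2) := by
  have h := conj_mul_rpow_mul_self hγ p.1
  simp only [graphMap, lift, lerayPhase, map_add, map_sub, map_mul, Complex.conj_ofReal,
    Complex.conj_I, Complex.conj_conj, map_one]
  linear_combination (γ : ℂ) * h +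
    (((‖p.1‖ ^ γ : ℝ) : ℂ) - ((‖q.1‖ ^ γ : ℝ) : ℂ) - ε) * Complex.I_sq

theorem lerayIntegrand_graphMap {γ : ℝ} (hγ : 1 < γ) (r : ℝ) (f : M γ → ℂ) (ε : ℝ) (p q : ℂ × ℝ)
    (hq : q.1 ≠ 0) :
    lerayIntegrand γ f (lift ε (graphMap γ p).1) (graphMap γ q) = (‖q.1‖ ^ (r - 1) : ℝ) *
      (f (graphMap γ q) * (((‖q.1‖ ^ (γ - 1 - r) : ℝ) : ℂ) /
        (lerayPhase γ p.1 q.1 + ε + Complex.I * (q.2 - p.2)) ^ 2)) := by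
  have h : ‖q.1‖ ^ (γ - 2) = ‖q.1‖ ^ (r - 1) * ‖q.1‖ ^ (γ - 1 - r) := by
    rw [← Real.rpow_add (norm_pos_iff.2 hq)]
    congr 1
    ring
  rw [lerayIntegrand, leray_denom_eq hγ]
  simp only [graphMap]
  rw [h]
  push_cast
  ring

theorem adjointIntegrand_graphMap {γ : ℝ} (hγ : 1 < γ) (r : ℝ) (g : M γ → ℂ) (ε : ℝ)
    (p q : ℂ × ℝ) :
    adjointIntegrand γ r g ε (graphMap γ p) (graphMap γ q) = (‖q.1‖ ^ (r - 1) : ℝ) *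
      (g (graphMap γ q) * (1 / (conj (lerayPhase γ q.1 p.1) + ε + Complex.I * (q.2 - p.2)) ^ 2)) := by
  rw [adjointIntegrand, adjoint_denom_eq hγ]
  simp only [graphMap]
  ring

theorem lerayIntegral_graphMap {γ : ℝ} (hγ : 1 < γ) (r : ℝ) (f : M γ → ℂ) (ε : ℝ) (p : ℂ × ℝ) :
    lerayIntegral γ f (lift ε (graphMap γ p).1) =
      resolventIntegral (radialMeasure r)
        (fun _ w => γ ^ 2 / (4 * Real.pi ^ 2) * ‖w‖ ^ (γ - 1 - r)) (lerayPhase γ) ε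
        (f ∘ graphMap γ) p := by
  rw [lerayIntegral, integral_surf_eq (lerayIntegrand_graphMap hγ r f ε p), resolventIntegral,
    ← integral_const_mul]
  refine integral_congr_ae (Eventually.of_forall fun q => ?_)
  simp only [resolventKernel, Function.comp_apply]
  push_cast
  ring

theorem adjointIntegral_graphMap {γ : ℝ} (hγ : 1 < γ) (r : ℝ) (g : M γ → ℂ) (ε : ℝ) (p : ℂ × ℝ) :
    adjointIntegral γ r g ε (graphMap γ p) =
      resolventIntegral (radialMeasure r)
        (fun z _ => γ ^ 2 / (4 * Real.pi ^ 2) * ‖z‖ ^ (γ - 1 - r))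
        (fun z w => conj (lerayPhase γ w z)) ε (g ∘ graphMap γ) p := by
  rw [adjointIntegral, integral_surf_eq fun q _ => adjointIntegrand_graphMap hγ r g ε p q,
    resolventIntegral, ← integral_const_mul]
  refine integral_congr_ae (Eventually.of_forall fun q => ?_)
  simp only [resolventKernel, Function.comp_apply, graphMap]
  push_cast
  ring

/-- Composition with the graph parametrization. -/
noncomputable def paramIsometry (γ r : ℝ) : L2 γ r ≃ₗᵢ[ℂ] Lp ℂ 2 (paramMeasure r) :=
  LinearIsometryEquiv.ofSurjective
    (Lp.compMeasurePreservingₗᵢ ℂ (graphMap γ) (measurePreserving_graphMap γ r)) fun f => by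
      have hs : MeasurePreserving (graphEquiv γ).symm (μ γ r) (paramMeasure r) :=
        (measurePreserving_graphMap γ r).symm (graphEquiv γ)
      refine ⟨Lp.compMeasurePreserving _ hs f, ?_⟩
      refine Lp.ext ?_
      have h1 := Lp.coeFn_compMeasurePreserving (Lp.compMeasurePreserving _ hs f)
        (measurePreserving_graphMap γ r)
      have h2 := (measurePreserving_graphMap γ r).quasiMeasurePreserving.ae
        (Lp.coeFn_compMeasurePreserving f hs)
      refine h1.trans ?_
      filter_upwards [h2] with p hp
      rw [Function.comp_apply, hp, Function.comp_apply]
      exact congrArg f ((graphEquiv γ).symm_apply_apply p)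

theorem coeFn_paramIsometry {γ r : ℝ} (f : L2 γ r) :
    paramIsometry γ r f =ᵐ[paramMeasure r] f ∘ graphMap γ :=
  Lp.coeFn_compMeasurePreserving f (measurePreserving_graphMap γ r)

theorem adjoint_conj_isometryEquiv {E F : Type*} [NormedAddCommGroup E] [InnerProductSpace ℂ E]
    [CompleteSpace E] [NormedAddCommGroup F] [InnerProductSpace ℂ F] [CompleteSpace F]
    (Φ : E ≃ₗᵢ[ℂ] F) (T : F →L[ℂ] F) :
    ContinuousLinearMap.adjoint
        ((Φ.symm : F →L[ℂ] E) ∘L T ∘L (Φ : E →L[ℂ] F)) =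
      (Φ.symm : F →L[ℂ] E) ∘L ContinuousLinearMap.adjoint T ∘L (Φ : E →L[ℂ] F) := by
  symm
  rw [ContinuousLinearMap.eq_adjoint_iff]
  intro x y
  simp only [ContinuousLinearMap.comp_apply]
  change inner ℂ (Φ.symm _) y = inner ℂ x (Φ.symm _)
  rw [← Φ.inner_map_map, ← Φ.inner_map_map x, Φ.apply_symm_apply, Φ.apply_symm_apply]
  exact ContinuousLinearMap.adjoint_inner_left T _ _

theorem eLpNorm_mu_eq (γ r : ℝ) (F : M γ → ℂ) :
    eLpNorm F 2 (μ γ r) = eLpNorm (F ∘ graphMap γ) 2 (paramMeasure r) := by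
  rw [← map_graphMap_paramMeasure, (measurableEmbedding_graphMap γ).eLpNorm_map_measure]

theorem memLp_comp_graphMap {γ r : ℝ} (f : L2 γ r) :
    MemLp (f ∘ graphMap γ) 2 (paramMeasure r) :=
  (Lp.memLp f).comp_measurePreserving (measurePreserving_graphMap γ r)

theorem resolventIntegral_congr_ae {X : Type*} [MeasurableSpace X] {ρ : Measure X} (k : X → X → ℝ)
    (A : X → X → ℂ) (ε : ℝ) {f g : X × ℝ → ℂ} (h : f =ᵐ[ρ.prod volume] g) :
    resolventIntegral ρ k A ε f = resolventIntegral ρ k A ε g := by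
  ext p
  refine integral_congr_ae ?_
  filter_upwards [h] with q hq
  rw [hq]

theorem tendsto_eLpNorm_paramIsometry_symm {γ r : ℝ} {k : ℂ → ℂ → ℝ} {A : ℂ → ℂ → ℂ}
    {T : Lp ℂ 2 (paramMeasure r) →L[ℂ] Lp ℂ 2 (paramMeasure r)}
    (hT : ∀ f : Lp ℂ 2 (paramMeasure r), Tendsto (fun ε : ℝ => eLpNorm
      (fun p => resolventIntegral (radialMeasure r) k A ε f p - T f p) 2 (paramMeasure r))
      (𝓝[>] 0) (𝓝 0)) (f : L2 γ r) {I : ℝ → M γ → ℂ}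
    (hI : ∀ ε p, I ε (graphMap γ p) =
      resolventIntegral (radialMeasure r) k A ε (f ∘ graphMap γ) p) :
    Tendsto (fun ε : ℝ => eLpNorm
      (fun z => I ε z - (paramIsometry γ r).symm (T (paramIsometry γ r f)) z) 2 (μ γ r))
      (𝓝[>] 0) (𝓝 0) := by
  refine (hT (paramIsometry γ r f)).congr fun ε => ?_
  rw [eLpNorm_mu_eq]
  refine eLpNorm_congr_ae ?_
  have h := coeFn_paramIsometry ((paramIsometry γ r).symm (T (paramIsometry γ r f)))
  rw [LinearIsometryEquiv.apply_symm_apply] at h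
  filter_upwards [h] with p hp
  rw [hp, resolventIntegral_congr_ae k A ε (coeFn_paramIsometry f), Function.comp_apply,
    Function.comp_apply, hI]

theorem exists_eq_lift_graphMap {γ : ℝ} {z : ℂ × ℂ} (hz : z ∈ Ω γ) :
    ∃ ε > 0, ∃ p, z = lift ε (graphMap γ p).1 := by
  refine ⟨z.2.im - ‖z.1‖ ^ γ, sub_pos.2 hz, (z.1, z.2.re), ?_⟩
  refine Prod.ext rfl ?_
  apply Complex.ext <;> simp [graphMap, lift]

theorem integrable_lerayIntegrand {γ r : ℝ} (hγ : 1 < γ) (hr : r ∈ Ioo (-1 : ℝ) (2 * γ - 1))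
    (f : L2 γ r) {z : ℂ × ℂ} (hz : z ∈ Ω γ) : Integrable (lerayIntegrand γ f z) (surf γ) := by
  obtain ⟨ε, hε, p, rfl⟩ := exists_eq_lift_graphMap hz
  obtain ⟨C, h, -⟩ := exists_schurKernel_leray hγ hr zero_le_one
  rw [integrable_surf_iff (lerayIntegrand_graphMap hγ r f ε p)]
  simpa [resolventKernel] using h.integrable_mul_kernel hε p (memLp_comp_graphMap f)

/-- The factor $|z_1|^{\gamma-1-r}$ of the Schur kernel may vanish at $z_1=0$ and cannot then be
divided out. The estimate is therefore made with weight $1$, which covers every $z$. -/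
theorem integrable_adjointIntegrand {γ r : ℝ} (hγ : 1 < γ) (hr : r ∈ Ioo (-1 : ℝ) (2 * γ - 1))
    (g : L2 γ r) {ε : ℝ} (hε : 0 < ε) (z : M γ) :
    Integrable (adjointIntegrand γ r g ε z) (surf γ) := by
  obtain ⟨p, rfl⟩ := exists_graphMap_eq z
  obtain ⟨c, hc, hphase⟩ := exists_phaseBound hγ
  rw [integrable_surf_iff fun q _ => adjointIntegrand_graphMap hγ r g ε p q]
  have h := integrable_mul_resolvent (ρ := radialMeasure r) (κ := fun _ => 1)
    (a := fun w => conj (lerayPhase γ w p.1)) measurable_const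
    (RCLike.continuous_conj.measurable.comp (measurable_lerayPhase_left γ p.1))
    (fun w => by simpa using lerayPhase_re_nonneg hγ w p.1) hε ?_ p.2 (memLp_comp_graphMap g)
  · simpa using h
  · have := lintegral_weight_div_phase_sq_lt_top (r := r) (s := 0) (κ := 1) hγ hc
      (by linarith [hr.1]) (by linarith [hr.2])
      (Complex.measurable_re.comp (measurable_lerayPhase_left γ p.1)) (hphase p.1).2
      (fun w => lerayPhase_re_nonneg hγ w p.1) hε
    simpa using this

theorem exists_lerayTransform {γ r : ℝ} (hγ : 1 < γ) (hr : r ∈ Ioo (-1 : ℝ) (2 * γ - 1)) :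
    ∃ L : L2 γ r →L[ℂ] L2 γ r, IsLerayTransform γ r L ∧
      ∀ g : L2 γ r, Tendsto (fun ε : ℝ => eLpNorm (fun z : M γ =>
        adjointIntegral γ r g ε z - ContinuousLinearMap.adjoint L g z) 2 (μ γ r))
        (𝓝[>] 0) (𝓝 0) := by
  obtain ⟨C, h, h'⟩ := exists_schurKernel_leray hγ hr
    (κ := γ ^ 2 / (4 * Real.pi ^ 2)) (by positivity)
  obtain ⟨T, hT⟩ := h.exists_limit
  obtain ⟨T', hT'⟩ := h'.exists_limit
  have hTT' : T' = ContinuousLinearMap.adjoint T :=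
    eq_adjoint_of_tendsto h h' (fun _ _ => rfl) (fun _ _ => rfl) hT hT'
  set Φ := paramIsometry γ r
  refine ⟨(Φ.symm : _ →L[ℂ] L2 γ r) ∘L T ∘L (Φ : L2 γ r →L[ℂ] _), fun f =>
    ⟨fun z hz => integrable_lerayIntegrand hγ hr f hz, ?_⟩, fun g => ?_⟩
  · exact tendsto_eLpNorm_paramIsometry_symm hT f
      (I := fun ε z => lerayIntegral γ f (lift ε z.1)) (lerayIntegral_graphMap hγ r f)
  · rw [adjoint_conj_isometryEquiv, ← hTT']
    exact tendsto_eLpNorm_paramIsometry_symm hT' g (adjointIntegral_graphMap hγ r g)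

/-! ### The literal adjoint integral at $\varepsilon=0$ -/

theorem stronglyMeasurable_adjointIntegrand (γ q ε : ℝ) {g : M γ → ℂ} (hg : StronglyMeasurable g) :
    StronglyMeasurable (Function.uncurry (adjointIntegrand γ q g ε)) := by
  have hg' := hg.measurable
  refine Measurable.stronglyMeasurable ?_
  unfold adjointIntegrand lift Function.uncurry
  have h : Measurable fun x : M γ × M γ => g x.2 := hg'.comp measurable_snd
  fun_prop

theorem stronglyMeasurable_adjointIntegral (γ q ε : ℝ) {g : M γ → ℂ} (hg : StronglyMeasurable g) :
    StronglyMeasurable (adjointIntegral γ q g ε) := by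
  have : SFinite (surf γ) := by unfold surf; infer_instance
  unfold adjointIntegral
  refine StronglyMeasurable.mul ?_
    (stronglyMeasurable_adjointIntegrand γ q ε hg).integral_prod_right
  exact Measurable.stronglyMeasurable (by fun_prop)

/-- The denominator can vanish only on the graph $s=t+\operatorname{Im}A$, which is null by Fubini.
-/
theorem ae_conj_phase_ne_zero {γ : ℝ} (p : ℂ × ℝ) :
    ∀ᵐ q : ℂ × ℝ, conj (lerayPhase γ q.1 p.1) + Complex.I * (q.2 - p.2) ≠ 0 := by
  have hm := measurable_lerayPhase_left γ p.1
  have hs : MeasurableSet {q : ℂ × ℝ | q.2 = p.2 + (lerayPhase γ q.1 p.1).im} :=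
    measurableSet_eq_fun (by fun_prop) (by fun_prop)
  have h0 : (volume : Measure (ℂ × ℝ)) {q : ℂ × ℝ | q.2 = p.2 + (lerayPhase γ q.1 p.1).im} = 0 := by
    rw [Measure.volume_eq_prod, Measure.measure_prod_null hs]
    refine Eventually.of_forall fun w => ?_
    simp [preimage]
  have h1 : ∀ᵐ q : ℂ × ℝ, ¬ (q.2 = p.2 + (lerayPhase γ q.1 p.1).im) := by
    rw [ae_iff]
    simpa using h0
  filter_upwards [h1] with q hq h
  apply hq
  have := congrArg Complex.im h
  simp at this
  linarith

/-- Since the phase has nonnegative real part, adding $\varepsilon$ only enlarges the denominator,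
and the integrand at $\varepsilon=0$ is an integrable majorant. Zeros of the denominator must be
excluded, as division by zero gives $0$ there. -/
theorem tendsto_adjointIntegral {γ : ℝ} (hγ : 1 < γ) (q : ℝ) {g : M γ → ℂ}
    (hg : StronglyMeasurable g) {z : M γ} (hz : Integrable (adjointIntegrand γ q g 0 z) (surf γ)) :
    Tendsto (fun ε => adjointIntegral γ q g ε z) (𝓝[>] 0) (𝓝 (adjointIntegral γ q g 0 z)) := by
  obtain ⟨p, rfl⟩ := exists_graphMap_eq z
  have hne : ∀ᵐ ζ ∂(surf γ), ∃ x : ℂ × ℝ, graphMap γ x = ζ ∧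
      conj (lerayPhase γ x.1 p.1) + Complex.I * (x.2 - p.2) ≠ 0 := by
    rw [surf, (measurableEmbedding_graphMap γ).ae_map_iff]
    filter_upwards [ae_conj_phase_ne_zero p] with x hx using ⟨x, rfl, hx⟩
  unfold adjointIntegral
  refine Tendsto.const_mul _ ?_
  refine tendsto_integral_filter_of_dominated_convergence
    (fun ζ => ‖adjointIntegrand γ q g 0 (graphMap γ p) ζ‖) ?_ ?_ hz.norm ?_
  · exact Eventually.of_forall fun ε => (stronglyMeasurable_adjointIntegrand γ q ε hg
      |>.comp_measurable measurable_prodMk_left).aestronglyMeasurable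
  · filter_upwards [self_mem_nhdsWithin] with ε hε
    have hε' : (0 : ℝ) < ε := hε
    filter_upwards [hne] with ζ hζ
    obtain ⟨x, rfl, hx⟩ := hζ
    rw [adjointIntegrand_graphMap hγ, adjointIntegrand_graphMap hγ, norm_mul, norm_mul, norm_mul,
      norm_mul, norm_div, norm_div, norm_pow, norm_pow]
    have h0 : 0 ≤ (lerayPhase γ x.1 p.1).re := lerayPhase_re_nonneg hγ _ _
    set D := conj (lerayPhase γ x.1 p.1) + Complex.I * (x.2 - p.2) with hD
    have hre : D.re = (lerayPhase γ x.1 p.1).re := by simp [hD]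
    have e0 : conj (lerayPhase γ x.1 p.1) + ((0 : ℝ) : ℂ) + Complex.I * (x.2 - p.2) = D := by
      rw [hD]; push_cast; ring
    have e1 : conj (lerayPhase γ x.1 p.1) + (ε : ℂ) + Complex.I * (x.2 - p.2) = D + ε := by
      rw [hD]; ring
    have hle : ‖D‖ ≤ ‖D + ε‖ := by
      rw [Complex.norm_def, Complex.norm_def]
      refine Real.sqrt_le_sqrt ?_
      rw [Complex.normSq_apply, Complex.normSq_apply]
      simp only [Complex.add_re, Complex.ofReal_re, Complex.add_im, Complex.ofReal_im, add_zero]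
      nlinarith
    have hpos : 0 < ‖D‖ := norm_pos_iff.2 hx
    rw [e0, e1]
    gcongr
  · filter_upwards [hne] with ζ hζ
    obtain ⟨x, rfl, hx⟩ := hζ
    simp only [adjointIntegrand_graphMap hγ]
    have hc : ContinuousAt (fun ε : ℝ => (‖x.1‖ ^ (q - 1) : ℝ) * (g (graphMap γ x) *
        (1 / (conj (lerayPhase γ x.1 p.1) + (ε : ℂ) + Complex.I * (x.2 - p.2)) ^ 2))) 0 := by
      refine continuousAt_const.mul (continuousAt_const.mul (continuousAt_const.div ?_ ?_))
      · fun_prop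
      · simpa using hx
    exact hc.tendsto.mono_left nhdsWithin_le_nhds

/-- Convergence in `L²(M_γ, μ_p)` forces convergence almost everywhere along a sequence. -/
theorem exists_seq_ae_tendsto {γ p : ℝ} {F : ℝ → M γ → ℂ} {G : M γ → ℂ}
    (hF : ∀ ε, StronglyMeasurable (F ε)) (hG : AEStronglyMeasurable G (μ γ p)) {l : Filter ℝ}
    [NeBot l] [IsCountablyGenerated l]
    (h : Tendsto (fun ε => eLpNorm (fun z => F ε z - G z) 2 (μ γ p)) l (𝓝 0)) :
    ∃ e : ℕ → ℝ, Tendsto e atTop l ∧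
      ∀ᵐ z ∂(surf γ), Tendsto (fun n => F (e n) z) atTop (𝓝 (G z)) := by
  have := (tendstoInMeasure_of_tendsto_eLpNorm (by norm_num)
    (fun ε => (hF ε).aestronglyMeasurable) hG h).exists_seq_tendsto_ae'
  rwa [ae_mu_eq] at this

/-- Two successive subsequences converge almost everywhere, and the weights have the same null sets,
so limits taken in different weighted spaces agree. -/
theorem ae_eq_of_tendsto_eLpNorm {γ p p' : ℝ} {F : ℝ → M γ → ℂ} {G G' : M γ → ℂ}
    (hF : ∀ ε, StronglyMeasurable (F ε)) (hG : AEStronglyMeasurable G (μ γ p))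
    (hG' : AEStronglyMeasurable G' (μ γ p'))
    (h : Tendsto (fun ε => eLpNorm (fun z => F ε z - G z) 2 (μ γ p)) (𝓝[>] 0) (𝓝 0))
    (h' : Tendsto (fun ε => eLpNorm (fun z => F ε z - G' z) 2 (μ γ p')) (𝓝[>] 0) (𝓝 0)) :
    G =ᵐ[surf γ] G' := by
  obtain ⟨e, he, hae⟩ := exists_seq_ae_tendsto hF hG h
  have := (tendstoInMeasure_of_tendsto_eLpNorm (by norm_num)
    (fun ε => (hF ε).aestronglyMeasurable) hG' h').comp he |>.exists_seq_tendsto_ae'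
  rw [ae_mu_eq] at this
  obtain ⟨e', he', hae'⟩ := this
  filter_upwards [hae, hae'] with z hz hz'
  exact tendsto_nhds_unique (hz.comp he') hz'

theorem ae_eq_adjointIntegral_zero {γ q p : ℝ} (hγ : 1 < γ) {g T : M γ → ℂ}
    (hg : StronglyMeasurable g) (hT : AEStronglyMeasurable T (μ γ p))
    (h : Tendsto (fun ε => eLpNorm (fun z => adjointIntegral γ q g ε z - T z) 2 (μ γ p))
      (𝓝[>] 0) (𝓝 0)) :
    ∀ᵐ z ∂(μ γ p), Integrable (adjointIntegrand γ q g 0 z) (surf γ) →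
      T z = adjointIntegral γ q g 0 z := by
  obtain ⟨e, he, hae⟩ :=
    exists_seq_ae_tendsto (fun ε => stronglyMeasurable_adjointIntegral γ q ε hg) hT h
  rw [ae_mu_eq]
  filter_upwards [hae] with z hz hint
  exact tendsto_nhds_unique hz ((tendsto_adjointIntegral hγ q hg hint).comp he)

/-! ### Multiplication by powers of $|\zeta_1|$ -/

section WeightMultiplication

variable {γ r r' b : ℝ}

theorem eLpNorm_rpow_mul (h : r' = r + 2 * b) (F : M γ → ℂ) :
    eLpNorm (fun ζ => ((‖ζ.1.1‖ ^ b : ℝ) : ℂ) * F ζ) 2 (μ γ r) = eLpNorm F 2 (μ γ r') := by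
  rw [← (ENNReal.pow_right_strictMono two_ne_zero).injective.eq_iff, eLpNorm_two_sq,
    eLpNorm_two_sq, μ, μ,
    lintegral_withDensity_eq_lintegral_mul_non_measurable₀ _ (by fun_prop) (by simp),
    lintegral_withDensity_eq_lintegral_mul_non_measurable₀ _ (by fun_prop) (by simp)]
  refine lintegral_congr_ae ?_
  filter_upwards [ae_surf_ne_zero γ] with ζ hζ
  have hpos : 0 < ‖ζ.1.1‖ := norm_pos_iff.2 hζ
  have e : ‖ζ.1.1‖ ^ (r' - 1) = ‖ζ.1.1‖ ^ (r - 1) * (‖ζ.1.1‖ ^ b) ^ 2 := by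
    rw [← Real.rpow_mul_natCast hpos.le, ← Real.rpow_add hpos, h]
    congr 1
    push_cast
    ring
  simp only [Pi.mul_apply]
  rw [enorm_mul, mul_pow, ← mul_assoc, e, ENNReal.ofReal_mul (by positivity),
    ENNReal.ofReal_pow (by positivity)]
  congr 3
  rw [← ofReal_norm, Complex.norm_real, Real.norm_of_nonneg (by positivity)]

theorem memLp_rpow_mul (h : r' = r + 2 * b) (g : L2 γ r') :
    MemLp (fun ζ => ((‖ζ.1.1‖ ^ b : ℝ) : ℂ) * g ζ) 2 (μ γ r) := by
  refine ⟨StronglyMeasurable.aestronglyMeasurable ?_, ?_⟩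
  · refine StronglyMeasurable.mul (Measurable.stronglyMeasurable (by fun_prop))
      (Lp.stronglyMeasurable g)
  · rw [eLpNorm_rpow_mul h]
    exact (Lp.memLp g).2

/-- Multiplication by `|ζ₁| ^ b` as an isometry. -/
noncomputable def rpowMul (γ : ℝ) (h : r' = r + 2 * b) : L2 γ r' →ₗᵢ[ℂ] L2 γ r where
  toFun g := (memLp_rpow_mul h g).toLp _
  map_add' f g := by
    rw [← MemLp.toLp_add, MemLp.toLp_eq_toLp_iff]
    have := Lp.coeFn_add f g
    rw [EventuallyEq, ae_mu_eq] at *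
    filter_upwards [this] with ζ hζ
    rw [hζ, Pi.add_apply, Pi.add_apply, mul_add]
  map_smul' c g := by
    rw [RingHom.id_apply, ← MemLp.toLp_const_smul, MemLp.toLp_eq_toLp_iff]
    have := Lp.coeFn_smul c g
    rw [EventuallyEq, ae_mu_eq] at *
    filter_upwards [this] with ζ hζ
    rw [hζ, Pi.smul_apply, Pi.smul_apply, smul_eq_mul, smul_eq_mul, mul_left_comm]
  norm_map' g := by
    change ‖(memLp_rpow_mul h g).toLp _‖ = ‖g‖
    rw [Lp.norm_toLp, Lp.norm_def, eLpNorm_rpow_mul h]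

theorem coeFn_rpowMul (h : r' = r + 2 * b) (g : L2 γ r') :
    rpowMul γ h g =ᵐ[surf γ] fun ζ => ((‖ζ.1.1‖ ^ b : ℝ) : ℂ) * g ζ := by
  have : rpowMul γ h g =ᵐ[μ γ r] fun ζ => ((‖ζ.1.1‖ ^ b : ℝ) : ℂ) * g ζ :=
    (memLp_rpow_mul h g).coeFn_toLp
  rwa [EventuallyEq, ae_mu_eq] at this

/-- Multiplication by `|ζ₁| ^ b` as an isometric isomorphism. -/
noncomputable def rpowMulEquiv (γ : ℝ) (h : r' = r + 2 * b) : L2 γ r' ≃ₗᵢ[ℂ] L2 γ r :=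
  LinearIsometryEquiv.ofSurjective (rpowMul γ h) fun f => by
    have h' : r = r' + 2 * (-b) := by linarith
    refine ⟨rpowMul γ h' f, Lp.ext ?_⟩
    rw [EventuallyEq, ae_mu_eq]
    filter_upwards [coeFn_rpowMul h (rpowMul γ h' f), coeFn_rpowMul h' f, ae_surf_ne_zero γ]
      with ζ h1 h2 h3
    have hpos : 0 < ‖ζ.1.1‖ := norm_pos_iff.2 h3
    rw [h1, h2, ← mul_assoc, ← Complex.ofReal_mul, ← Real.rpow_add hpos]
    simp

theorem coeFn_rpowMulEquiv (h : r' = r + 2 * b) (g : L2 γ r') :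
    rpowMulEquiv γ h g =ᵐ[surf γ] fun ζ => ((‖ζ.1.1‖ ^ b : ℝ) : ℂ) * g ζ :=
  coeFn_rpowMul h g

end WeightMultiplication

theorem adjointIntegrand_rpow_mul_ae_eq {γ r : ℝ} {g G : M γ → ℂ}
    (hG : G =ᵐ[surf γ] fun ζ => ((‖ζ.1.1‖ ^ (γ - 1 - r) : ℝ) : ℂ) * g ζ) (ε : ℝ) (z : M γ) :
    adjointIntegrand γ r G ε z =ᵐ[surf γ] adjointIntegrand γ (γ - 1) g ε z := by
  filter_upwards [hG, ae_surf_ne_zero γ] with ζ h1 h2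
  have e : ‖ζ.1.1‖ ^ (γ - 1 - 1) = ‖ζ.1.1‖ ^ (γ - 1 - r) * ‖ζ.1.1‖ ^ (r - 1) := by
    rw [← Real.rpow_add (norm_pos_iff.2 h2)]
    congr 1
    ring
  rw [adjointIntegrand, adjointIntegrand, h1, e]
  push_cast
  ring

/-- The kernel is the same for every weight; only the powers outside it change. This intertwining is
an identity at each $\varepsilon$ and each point, before any limit. -/
theorem rpow_mul_adjointIntegral {γ r : ℝ} {g G : M γ → ℂ}
    (hG : G =ᵐ[surf γ] fun ζ => ((‖ζ.1.1‖ ^ (γ - 1 - r) : ℝ) : ℂ) * g ζ) (ε : ℝ) (z : M γ) :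
    ((‖z.1.1‖ ^ (γ - 1 - r) : ℝ) : ℂ) * adjointIntegral γ (γ - 1) g ε z =
      adjointIntegral γ r G ε z := by
  rw [adjointIntegral, adjointIntegral, integral_congr_ae (adjointIntegrand_rpow_mul_ae_eq hG ε z),
    sub_self, Real.rpow_zero]
  push_cast
  ring

theorem adjointIntegral_congr_ae {γ : ℝ} (q : ℝ) {g h : M γ → ℂ} (hgh : g =ᵐ[surf γ] h) :
    adjointIntegral γ q g = adjointIntegral γ q h := by
  ext ε z
  rw [adjointIntegral, adjointIntegral]
  congr 1
  refine integral_congr_ae ?_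
  filter_upwards [hgh] with ζ hζ
  rw [adjointIntegrand, adjointIntegrand, hζ]

end LerayModel

/-! ### The main theorem -/

open LerayModel in
theorem theoremT (γ r : ℝ) (hγ : 1 < γ) (hr : r ∈ Set.Ioo (-1 : ℝ) (2 * γ - 1)) :
    -- the Leray transform `L` on `L²(M_γ, μ_r)` and the Leray transform `Lσ` on `L²(M_γ, σ)`
    ∃ (L : L2 γ r →L[ℂ] L2 γ r) (Lσ : L2 γ (γ - 1) →L[ℂ] L2 γ (γ - 1)),
      IsLerayTransform γ r L ∧ IsLerayTransform γ (γ - 1) Lσ ∧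
      -- the adjoint of `L` in `L²(M_γ, μ_r)` is given by the explicit integral
      IsAdjointIntegral γ r r (ContinuousLinearMap.adjoint L) ∧
      -- with `r' = 2(γ-1) - r`, the multiplication `R` by `|ζ₁|^(γ-1-r)` is an isometry of
      -- `L²(M_γ, μ_r')` onto `L²(M_γ, μ_r)`
      ∃ R : L2 γ (2 * (γ - 1) - r) ≃ₗᵢ[ℂ] L2 γ r,
        (∀ g : L2 γ (2 * (γ - 1) - r),
          R g =ᵐ[μ γ r] fun ζ => ((‖ζ.1.1‖ ^ (γ - 1 - r) : ℝ) : ℂ) * g ζ) ∧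
        -- the `σ`-adjoint acts as a bounded operator `T` on `L²(M_γ, μ_r')`
        ∃ T : L2 γ (2 * (γ - 1) - r) →L[ℂ] L2 γ (2 * (γ - 1) - r),
          (∀ (g : L2 γ (2 * (γ - 1) - r)) (h : L2 γ (γ - 1)), g =ᵐ[surf γ] h →
            T g =ᵐ[surf γ] ContinuousLinearMap.adjoint Lσ h) ∧
          IsAdjointIntegral γ (γ - 1) (2 * (γ - 1) - r) T ∧
          -- `L^(*,μ_r) = R L^(*,σ) R⁻¹`
          ∀ g : L2 γ r, ContinuousLinearMap.adjoint L g = R (T (R.symm g)) := by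
  obtain ⟨L, hL, hLadj⟩ := exists_lerayTransform hγ hr
  obtain ⟨Lσ, hLσ, hLσadj⟩ :=
    exists_lerayTransform (γ := γ) (r := γ - 1) hγ ⟨by linarith, by linarith⟩
  have hL0 (g : L2 γ r) := ae_eq_adjointIntegral_zero hγ (Lp.stronglyMeasurable g)
    (Lp.aestronglyMeasurable _) (hLadj g)
  have hw : 2 * (γ - 1) - r = r + 2 * (γ - 1 - r) := by ring
  set R := rpowMulEquiv γ hw
  have hRg (g : L2 γ (2 * (γ - 1) - r)) :
      R g =ᵐ[surf γ] fun ζ => ((‖ζ.1.1‖ ^ (γ - 1 - r) : ℝ) : ℂ) * g ζ := coeFn_rpowMulEquiv hw g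
  -- With $T$ defined by conjugation, the final identity is immediate; what needs proof is that $T$
  -- extends the $\sigma$-adjoint and is computed by its integral.
  set T : L2 γ (2 * (γ - 1) - r) →L[ℂ] L2 γ (2 * (γ - 1) - r) :=
    (R.symm : L2 γ r →L[ℂ] L2 γ (2 * (γ - 1) - r)) ∘L ContinuousLinearMap.adjoint L ∘L
      (R : L2 γ (2 * (γ - 1) - r) →L[ℂ] L2 γ r)
  have hRT (g) : R (T g) = ContinuousLinearMap.adjoint L (R g) := R.apply_symm_apply _
  have hTlim (g : L2 γ (2 * (γ - 1) - r)) : Tendsto (fun ε : ℝ => eLpNorm (fun z : M γ =>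
      adjointIntegral γ (γ - 1) g ε z - T g z) 2 (μ γ (2 * (γ - 1) - r))) (𝓝[>] 0) (𝓝 0) := by
    refine (hLadj (R g)).congr fun ε => ?_
    rw [← eLpNorm_rpow_mul hw]
    refine eLpNorm_congr_ae ?_
    rw [EventuallyEq, ae_mu_eq]
    filter_upwards [hRg (T g)] with z hz
    rw [mul_sub (_ : ℂ), ← hz, rpow_mul_adjointIntegral (hRg g), ← hRT]
  refine ⟨L, Lσ, hL, hLσ, fun g => ⟨fun ε hε z => integrable_adjointIntegrand hγ hr g hε z,
    hLadj g, hL0 g⟩, R, fun g => ?_, T, fun g h hgh => ?_, fun g => ⟨fun ε hε z => ?_, hTlim g, ?_⟩,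
    fun g => ?_⟩
  · rw [EventuallyEq, ae_mu_eq]
    exact hRg g
  -- On the intersection, $Tg$ and the $\sigma$-adjoint of $h$ are limits of the same integrals in
  -- two weighted spaces, hence equal almost everywhere.
  · have hgh' := adjointIntegral_congr_ae (γ - 1) hgh
    have h2 := hLσadj h
    rw [← hgh'] at h2
    exact ae_eq_of_tendsto_eLpNorm
      (fun ε => stronglyMeasurable_adjointIntegral γ (γ - 1) ε (Lp.stronglyMeasurable g))
      (Lp.aestronglyMeasurable _) (Lp.aestronglyMeasurable _) (hTlim g) h2
  · exact (integrable_congr (adjointIntegrand_rpow_mul_ae_eq (hRg g) ε z)).1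
      (integrable_adjointIntegrand hγ hr (R g) hε z)
  · exact ae_eq_adjointIntegral_zero hγ (Lp.stronglyMeasurable g) (Lp.aestronglyMeasurable _)
      (hTlim g)
  · rw [hRT, R.apply_symm_apply]
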